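/- **Setting and conventions.** Let $\mathbf H^n=\mathbf C^n\oplus j\mathbf C^n$ with coordinates $(z,w)$, flat metric $g$, complex structures $I(z,w)=(iz,iw)$, $J(z,w)=(-\bar w,\bar z)$, $K=IJ$, and Kähler forms $\omega_1(u,v)=g(Iu,v)$, etc., so that $\omega_1=\frac i2\sum(dz_i\wedge d\bar z_i+dw_i\wedge d\bar w_i)$ and $\omega_2+i\omega_3=\sum dz_i\wedge dw_i$. Let $G\subset U(n)$ be a closed subgroup with Lie algebra $\mathfrak g$, acting on $\mathbf H^n$ by $(z,w)\mapsto(Az,\bar A w)$, and let $\nu=(\nu_1,\nu_2,\nu_3)$, $\langle\nu_a(x),\xi\rangle=\frac12\omega_a(\xi x,x)$, be the standard quadratic hyperkähler moment map (so $d\langle\nu_a,\xi\rangle=i_{\xi x}\omega_a$). Let $c\in\mathfrak g^*$ be $G$-invariant and integral, with corresponding continuous homomorphism $\chi:G\to U(1)$, $d\chi=ic$. A real 2-form $F$ is called the curvature of a hermitian connection $\nabla$ if $\nabla^2=iF$; $d^cf=-df\circ I$. *Hyperholomorphic line bundle.* Let $M$ be a hyperkähler manifold with an isometric circle action, generated by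 the vector field $X$, which fixes $\omega_1$ and satisfies $\omega_2+i\omega_3\mapsto e^{ik\theta}(\omega_2+i\omega_3)$. Let $(L,h_0,\nabla^0)$ be a hermitian line bundle with unitary connection with curvature $\omega_1$ (unique up to a flat unitary line bundle) together with a lift of the circle action preserving $h_0$ and $\nabla^0$, with infinitesimal action $\nabla^0_X+i\mu$ on sections, where $i_X\omega_1=d\mu$. The hyperholomorphic line bundle is $L$ with the rescaled metric $h=e^{2\mu/k}h_0$ and the unitary connection $\nabla$ of $h$ with the same $(0,1)$-part relative to $I$ as $\nabla^0$; its curvature is $\omega_1+\frac1k dd^c\mu$. **Theorem.** Suppose that the hyperkähler quotient $\bar M=\nu^{-1}(c,0,0)/G$ is smooth, i.e. $G$ acts freely on $\nu^{-1}(c,0,0)$ and $\bar M$ carries the quotient manifold structure, for which the projection is a smooth submersion; give $\bar M$ the quotient metric and complex structures. Scalar multiplication $(z,w)\mapsto e^{i\theta}(z,w)$ induces an isometric circle action on $\bar M$ which fixes $\bar\omega_1$ and under which $\bar\omega_2+i\bar\omega_3\mapsto e^{2i\theta}(\bar\omega_2+i\bar\omega_3)$. The hyperholomorphic line bundle of $\bar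 M$ for this action ($k=2$) is the associated bundle $\nu^{-1}(c,0,0)\times_G\mathbf C$, where $G$ acts on $\mathbf C$ via $\chi$ (so $(x,v)\sim(gx,\chi(g)v)$), with the metric $|[x,v]|^2=|v|^2$ and with the canonical connection, namely the one induced from the connection on the principal $G$-bundle $\nu^{-1}(c,0,0)\to\bar M$ whose horizontal spaces are the orthogonal complements of the orbit directions. All hyperholomorphic line bundles of $\bar M$ for this action have the same curvature $\bar\omega_1+\frac12dd^c\bar\mu$ ($\bar\mu$ a moment map), which is therefore the curvature of this connection, and which is of type $(1,1)$ with respect to $I,J,K$. -/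

import Mathlib

open scoped Manifold ContDiff Topology ComplexConjugate

noncomputable section

/-! ### Line bundles with connection on a manifold, and the hyperholomorphic line bundle -/

section General

variable {d : ℕ} {M : Type} [TopologicalSpace M] [ChartedSpace (EuclideanSpace ℝ (Fin d)) M]

/-- The exterior derivative of a (vector valued) 1-form `α`, computed at `m` in the chart at `m`:
`(dα)(u,v) = ∂_u (α(v)) - ∂_v (α(u))` for constant coordinate vector fields `u`, `v`. -/
def extD {V : Type} [NormedAddCommGroup V] [NormedSpace ℝ V]
    (α : ∀ m : M, TangentSpace (𝓡 d) m → V) (m : M) (u v : TangentSpace (𝓡 d) m) : V :=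
  let ψ : EuclideanSpace ℝ (Fin d) → M := (extChartAt (𝓡 d) m).symm
  let coeff : EuclideanSpace ℝ (Fin d) → EuclideanSpace ℝ (Fin d) → V :=
    fun w y => α (ψ y) (mfderiv 𝓘(ℝ, EuclideanSpace ℝ (Fin d)) (𝓡 d) ψ y w)
  fderiv ℝ (coeff v) (extChartAt (𝓡 d) m m) u - fderiv ℝ (coeff u) (extChartAt (𝓡 d) m m) v

/-- The differential of a complex function, as a complex number. -/
def dC (f : M → ℂ) (m : M) (u : TangentSpace (𝓡 d) m) : ℂ := mfderiv (𝓡 d) 𝓘(ℝ, ℂ) f m u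

/-- The differential of a real function, as a real number. -/
def dR (f : M → ℝ) (m : M) (u : TangentSpace (𝓡 d) m) : ℝ := mfderiv (𝓡 d) 𝓘(ℝ, ℝ) f m u

/-- A Riemannian metric and three endomorphisms `I, J, K` of the tangent bundle. -/
structure HyperStructure (d : ℕ) (M : Type) [TopologicalSpace M]
    [ChartedSpace (EuclideanSpace ℝ (Fin d)) M] where
  metric : ∀ m : M, TangentSpace (𝓡 d) m → TangentSpace (𝓡 d) m → ℝ
  cplx : Fin 3 → ∀ m : M, TangentSpace (𝓡 d) m → TangentSpace (𝓡 d) m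

/-- The forms `ω₁, ω₂, ω₃` (indexed by `0, 1, 2`): `ω_a(u,v) = g(I_a u, v)`. -/
def HyperStructure.form (S : HyperStructure d M) (a : Fin 3) (m : M)
    (u v : TangentSpace (𝓡 d) m) : ℝ :=
  S.metric m (S.cplx a m u) v

/-- The vector field generated by a circle action. -/
def generator (ρ : Circle → M → M) (m : M) : TangentSpace (𝓡 d) m :=
  mfderiv 𝓘(ℝ, ℝ) (𝓡 d) (fun t : ℝ => ρ (Circle.exp t) m) 0 (1 : ℝ)

/-- A smooth isometric circle action which fixes `ω₁` and acts by
`ω₂ + i ω₃ ↦ e^{ikθ} (ω₂ + i ω₃)`. -/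
structure IsRotatingAction (S : HyperStructure d M) (ρ : Circle → M → M) (k : ℕ) : Prop where
  one : ∀ m, ρ 1 m = m
  mul : ∀ s t m, ρ (s * t) m = ρ s (ρ t m)
  smooth : ContMDiff (𝓘(ℝ, ℝ).prod (𝓡 d)) (𝓡 d) ∞
    (fun p : ℝ × M => ρ (Circle.exp p.1) p.2)
  metric : ∀ t m u v, S.metric (ρ t m) (mfderiv (𝓡 d) (𝓡 d) (ρ t) m u)
    (mfderiv (𝓡 d) (𝓡 d) (ρ t) m v) = S.metric m u v
  form_one : ∀ t m u v, S.form 0 (ρ t m) (mfderiv (𝓡 d) (𝓡 d) (ρ t) m u)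
    (mfderiv (𝓡 d) (𝓡 d) (ρ t) m v) = S.form 0 m u v
  form_cplx : ∀ t m u v,
    (S.form 1 (ρ t m) (mfderiv (𝓡 d) (𝓡 d) (ρ t) m u) (mfderiv (𝓡 d) (𝓡 d) (ρ t) m v) : ℂ)
      + Complex.I * (S.form 2 (ρ t m) (mfderiv (𝓡 d) (𝓡 d) (ρ t) m u)
          (mfderiv (𝓡 d) (𝓡 d) (ρ t) m v) : ℂ)
    = (t : ℂ) ^ k * ((S.form 1 m u v : ℂ) + Complex.I * (S.form 2 m u v : ℂ))

/-- `μ` is a moment map for the circle action: `i_X ω₁ = dμ`. -/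
def IsMomentMap (S : HyperStructure d M) (ρ : Circle → M → M) (μ : M → ℝ) : Prop :=
  ContMDiff (𝓡 d) 𝓘(ℝ, ℝ) ∞ μ ∧
  ∀ m (u : TangentSpace (𝓡 d) m),
    S.form 0 m (generator ρ m) u = dR μ m u

/-- The 2-form `ω₁ + (1/k) d d^c μ`, where `d^c μ = -dμ ∘ I`. -/
def twistedForm (S : HyperStructure d M) (k : ℕ) (μ : M → ℝ) (m : M)
    (u v : TangentSpace (𝓡 d) m) : ℝ :=
  S.form 0 m u v + (1 / k : ℝ) * extD (fun y w => -dR μ y (S.cplx 0 y w)) m u v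

/-- The data of a family of complex vector spaces over `M` together with the class of its
smooth sections over open sets; the axioms of a line bundle are in `IsLineBundle`. -/
structure LineBundle (M : Type) where
  Fib : M → Type
  [grp : ∀ m, AddCommGroup (Fib m)]
  [mod : ∀ m, Module ℂ (Fib m)]
  /-- `SmoothOn U s`: the section `s` is smooth over the open set `U`. -/
  SmoothOn : Set M → (∀ m, Fib m) → Prop

attribute [instance] LineBundle.grp LineBundle.mod

/-- A not necessarily continuous section, defined on all of `M`. -/
abbrev LineBundle.Sec (L : LineBundle M) : Type := ∀ m, L.Fib m

/-- The total space. -/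
abbrev LineBundle.Tot (L : LineBundle M) : Type := Σ m, L.Fib m

/-- `L` is a smooth complex line bundle: the fibres are complex lines, and the smooth sections
form a sheaf which locally is generated freely by one nowhere vanishing section over the sheaf of
smooth complex functions. -/
structure IsLineBundle (d : ℕ) {M : Type} [TopologicalSpace M]
    [ChartedSpace (EuclideanSpace ℝ (Fin d)) M] (L : LineBundle M) : Prop where
  rank_one : ∀ m, Module.finrank ℂ (L.Fib m) = 1
  congr : ∀ U, IsOpen U → ∀ s t : L.Sec, (∀ m ∈ U, s m = t m) → L.SmoothOn U s → L.SmoothOn U t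
  mono : ∀ U V, IsOpen U → IsOpen V → V ⊆ U → ∀ s, L.SmoothOn U s → L.SmoothOn V s
  glue : ∀ U, IsOpen U → ∀ s, (∀ m ∈ U, ∃ V, IsOpen V ∧ m ∈ V ∧ V ⊆ U ∧ L.SmoothOn V s) →
    L.SmoothOn U s
  frame : ∀ m, ∃ U, IsOpen U ∧ m ∈ U ∧ ∃ e : L.Sec, (∀ y ∈ U, e y ≠ 0) ∧
    ∀ V, IsOpen V → V ⊆ U → ∀ f : M → ℂ,
      (L.SmoothOn V (fun y => f y • e y) ↔ ContMDiffOn (𝓡 d) 𝓘(ℝ, ℂ) ∞ f V)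

/-- `h` is a smooth hermitian metric on `L` (conjugate linear in the first variable). -/
structure IsHermitianMetric (d : ℕ) {M : Type} [TopologicalSpace M]
    [ChartedSpace (EuclideanSpace ℝ (Fin d)) M] (L : LineBundle M)
    (h : ∀ m, L.Fib m → L.Fib m → ℂ) : Prop where
  add_right : ∀ m a b b', h m a (b + b') = h m a b + h m a b'
  smul_right : ∀ m (z : ℂ) a b, h m a (z • b) = z * h m a b
  symm : ∀ m a b, h m b a = conj (h m a b)
  pos : ∀ m a, a ≠ 0 → 0 < (h m a a).re
  smooth : ∀ U, IsOpen U → ∀ s t : L.Sec, L.SmoothOn U s → L.SmoothOn U t →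
    ContMDiffOn (𝓡 d) 𝓘(ℝ, ℂ) ∞ (fun m => h m (s m) (t m)) U

/-- The type of covariant derivatives: `D s m u` is `∇_u s` at `m`. -/
abbrev CovDer (d : ℕ) {M : Type} [TopologicalSpace M]
    [ChartedSpace (EuclideanSpace ℝ (Fin d)) M] (L : LineBundle M) : Type :=
  L.Sec → ∀ m : M, TangentSpace (𝓡 d) m → L.Fib m

/-- `D` is a smooth connection on `L` preserving the hermitian metric `h`. -/
structure IsUnitaryConnection [IsManifold (𝓡 d) ∞ M] (L : LineBundle M) (h : ∀ m, L.Fib m → L.Fib m → ℂ)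
    (D : CovDer d L) : Prop where
  congr : ∀ U, IsOpen U → ∀ s t : L.Sec, L.SmoothOn U s → (∀ m ∈ U, s m = t m) →
    ∀ m ∈ U, ∀ u, D s m u = D t m u
  add_vec : ∀ U, IsOpen U → ∀ s, L.SmoothOn U s → ∀ m ∈ U, ∀ u v,
    D s m (u + v) = D s m u + D s m v
  smul_vec : ∀ U, IsOpen U → ∀ s, L.SmoothOn U s → ∀ m ∈ U, ∀ (r : ℝ) u,
    D s m (r • u) = (r : ℂ) • D s m u
  add_sec : ∀ U, IsOpen U → ∀ s t : L.Sec, L.SmoothOn U s → L.SmoothOn U t → ∀ m ∈ U, ∀ u,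
    D (fun y => s y + t y) m u = D s m u + D t m u
  leibniz : ∀ U, IsOpen U → ∀ (f : M → ℂ) (s : L.Sec), ContMDiffOn (𝓡 d) 𝓘(ℝ, ℂ) ∞ f U →
    L.SmoothOn U s → ∀ m ∈ U, ∀ u,
    D (fun y => f y • s y) m u = dC f m u • s m + f m • D s m u
  smooth : ∀ U, IsOpen U → ∀ (s : L.Sec) (X : ∀ m : M, TangentSpace (𝓡 d) m), L.SmoothOn U s →
    ContMDiffOn (𝓡 d) (𝓡 d).tangent ∞ (fun m => (⟨m, X m⟩ : TangentBundle (𝓡 d) M)) U →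
    L.SmoothOn U (fun m => D s m (X m))
  metric : ∀ U, IsOpen U → ∀ s t : L.Sec, L.SmoothOn U s → L.SmoothOn U t → ∀ m ∈ U, ∀ u,
    dC (fun y => h y (s y) (t y)) m u
      = h m (D s m u) (t m) + h m (s m) (D t m u)

/-- The connection `D` has curvature `F`, a real 2-form, in the normalization where
the curvature of `∇` as an operator is `i F`: if `∇ e = A ⊗ e` for a local frame `e`,
then `dA = i F`. -/
def HasCurvature (L : LineBundle M) (D : CovDer d L)
    (F : ∀ m : M, TangentSpace (𝓡 d) m → TangentSpace (𝓡 d) m → ℝ) : Prop :=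
  ∀ U, IsOpen U → ∀ e : L.Sec, L.SmoothOn U e → (∀ m ∈ U, e m ≠ 0) →
    ∀ A : ∀ m : M, TangentSpace (𝓡 d) m → ℂ, (∀ m ∈ U, ∀ u, D e m u = A m u • e m) →
      ∀ m ∈ U, ∀ u v, extD A m u v = Complex.I * (F m u v : ℂ)

/-- `τ` is a lift of the circle action `ρ` to `L`, by fibrewise linear maps preserving the
hermitian metric and the connection, and with moment map `μ`: on sections the infinitesimal
action is `∇_X + i μ`. -/
structure IsLift (L : LineBundle M) (h : ∀ m, L.Fib m → L.Fib m → ℂ) (D : CovDer d L)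
    (ρ : Circle → M → M) (μ : M → ℝ) (τ : Circle → L.Tot → L.Tot) : Prop where
  base : ∀ t a, (τ t a).1 = ρ t a.1
  one : ∀ a, τ 1 a = a
  mul : ∀ s t a, τ (s * t) a = τ s (τ t a)
  smul : ∀ t m (z : ℂ) (a : L.Fib m),
    τ t ⟨m, z • a⟩ = ⟨(τ t ⟨m, a⟩).1, z • (τ t ⟨m, a⟩).2⟩
  metric : ∀ t (a : L.Tot), h (τ t a).1 (τ t a).2 (τ t a).2 = h a.1 a.2 a.2
  connection : ∀ t U, IsOpen U → ∀ s s' : L.Sec, L.SmoothOn U s →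
    (∀ m ∈ U, τ t ⟨m, s m⟩ = ⟨ρ t m, s' (ρ t m)⟩) →
    L.SmoothOn (ρ t '' U) s' ∧
    ∀ m ∈ U, ∀ u, τ t ⟨m, D s m u⟩ = ⟨ρ t m, D s' (ρ t m) (mfderiv (𝓡 d) (𝓡 d) (ρ t) m u)⟩
  infinitesimal : ∀ U, IsOpen U → ∀ s : L.Sec, L.SmoothOn U s → ∀ m ∈ U, ∀ e : L.Fib m, e ≠ 0 →
    ∀ (z : ℝ → ℂ) (w : ℂ),
    (∀ᶠ t in 𝓝 (0 : ℝ), τ (Circle.exp (-t)) ⟨ρ (Circle.exp t) m, s (ρ (Circle.exp t) m)⟩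
      = ⟨m, z t • e⟩) →
    D s m (generator ρ m) + (Complex.I * (μ m : ℂ)) • s m = w • e → HasDerivAt z w 0

/-- `(L, h, D)` is a hyperholomorphic line bundle of `(M, S)` with respect to a circle action `ρ`
under which `ω₂ + i ω₃` has weight `k`. There is a hermitian metric `h₀` and a unitary connection
`D₀` on `L` with curvature `ω₁`, and a lift of the action with moment map `μ`, such that `h` is
`h₀` rescaled by `e^{2f}`, where `f = μ / k`, and `D` is the connection compatible with `h` and
with the `∂bar`-operator of `D₀` relative to `I`. -/
def IsHyperholomorphicLineBundle [IsManifold (𝓡 d) ∞ M] (S : HyperStructure d M) (ρ : Circle → M → M) (k : ℕ)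
    (L : LineBundle M) (h : ∀ m, L.Fib m → L.Fib m → ℂ) (D : CovDer d L) : Prop :=
  IsLineBundle d L ∧ IsHermitianMetric d L h ∧ IsUnitaryConnection L h D ∧
  ∃ (h₀ : ∀ m, L.Fib m → L.Fib m → ℂ) (D₀ : CovDer d L) (μ : M → ℝ)
    (τ : Circle → L.Tot → L.Tot),
    IsHermitianMetric d L h₀ ∧ IsUnitaryConnection L h₀ D₀ ∧
    HasCurvature L D₀ (S.form 0) ∧
    IsMomentMap S ρ μ ∧ IsLift L h₀ D₀ ρ μ τ ∧
    (∀ m a b, h m a b = (Real.exp (2 * (μ m / k)) : ℂ) * h₀ m a b) ∧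
    (∀ U, IsOpen U → ∀ s : L.Sec, L.SmoothOn U s → ∀ m ∈ U, ∀ u,
      D s m u + Complex.I • D s m (S.cplx 0 m u)
        = D₀ s m u + Complex.I • D₀ s m (S.cplx 0 m u))

end General

/-! ### Flat quaternionic space and the action of `U(n)` -/

/-- `ℍⁿ = ℂⁿ ⊕ j ℂⁿ`; the coordinates `z` and `w` are indexed by the two summands of
`Fin n ⊕ Fin n`. -/
abbrev Hn (n : ℕ) : Type := EuclideanSpace ℂ (Fin n ⊕ Fin n)

/-- `I (z, w) = (i z, i w)`. -/
def opI {n : ℕ} (x : Hn n) : Hn n := Complex.I • x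

/-- `J (z, w) = (-w̄, z̄)`. -/
def opJ {n : ℕ} (x : Hn n) : Hn n :=
  WithLp.toLp 2 (Sum.elim (fun i => -conj (x (Sum.inr i))) (fun i => conj (x (Sum.inl i))))

/-- The three complex structures `I`, `J`, `K = I J`. -/
def quat {n : ℕ} : Fin 3 → Hn n → Hn n := ![opI, opJ, fun x => opI (opJ x)]

/-- The flat Kähler forms `ω_a(u,v) = g(I_a u, v)`, so that
`ω₁ = (i/2) ∑ (dz ∧ dz̄ + dw ∧ dw̄)` and `ω₂ + i ω₃ = ∑ dz ∧ dw`. -/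
def flatForm {n : ℕ} (a : Fin 3) (u v : Hn n) : ℝ := inner ℝ (quat a u) v

/-- The action `(z, w) ↦ (A z, Ā w)` of complex matrices, which is left multiplication of `z + j w`
by `A`; used both for the group `U(n)` and for its Lie algebra. -/
def rep {n : ℕ} (A : Matrix (Fin n) (Fin n) ℂ) : Hn n →L[ℂ] Hn n :=
  Matrix.toEuclideanCLM (𝕜 := ℂ) (Matrix.fromBlocks A 0 0 (A.map conj))

section Group

variable {n : ℕ}

/-- `γ` is a smooth curve in `G` with `γ(0) = 1` and velocity `ξ` at `0`. -/
def IsCurveWithVelocity (G : Subgroup (Matrix.unitaryGroup (Fin n) ℂ)) (γ : ℝ → G)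
    (ξ : Matrix (Fin n) (Fin n) ℂ) : Prop :=
  γ 0 = 1 ∧ ∀ i j, ContDiff ℝ ∞ (fun t => ((γ t : Matrix.unitaryGroup (Fin n) ℂ) :
      Matrix (Fin n) (Fin n) ℂ) i j) ∧
    HasDerivAt (fun t => ((γ t : Matrix.unitaryGroup (Fin n) ℂ) :
      Matrix (Fin n) (Fin n) ℂ) i j) (ξ i j) 0

/-- The Lie algebra of `G`: the tangent space at the identity. -/
def lieAlg (G : Subgroup (Matrix.unitaryGroup (Fin n) ℂ)) :
    Submodule ℝ (Matrix (Fin n) (Fin n) ℂ) where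
  carrier := {ξ | ∃ γ : ℝ → G, IsCurveWithVelocity G γ ξ}
  zero_mem' := ⟨fun _ => 1, rfl, fun i j => ⟨contDiff_const, by
    simpa using hasDerivAt_const (0 : ℝ) ((1 : Matrix (Fin n) (Fin n) ℂ) i j)⟩⟩
  add_mem' := by
    rintro ξ η ⟨γ, h0, h⟩ ⟨δ, k0, k⟩
    refine ⟨fun t => γ t * δ t, by simp [h0, k0], fun i j => ⟨?_, ?_⟩⟩
    · simp only [Subgroup.coe_mul, Matrix.UnitaryGroup.mul_val, Matrix.mul_apply]
      exact ContDiff.sum fun l _ => (h i l).1.mul (k l j).1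
    · simp only [Subgroup.coe_mul, Matrix.UnitaryGroup.mul_val, Matrix.mul_apply]
      have := HasDerivAt.fun_sum (u := Finset.univ)
        (fun l _ => (h i l).2.mul (k l j).2)
      refine this.congr_deriv ?_
      simp [h0, k0, Matrix.one_apply, Finset.sum_add_distrib]
  smul_mem' := by
    rintro r ξ ⟨γ, h0, h⟩
    refine ⟨fun t => γ (r * t), by simp [h0], fun i j => ⟨?_, ?_⟩⟩
    · exact (h i j).1.comp (contDiff_const.mul contDiff_id)
    · have h2 : HasDerivAt (fun t : ℝ => r * t) r 0 := by
        simpa using (hasDerivAt_id (0 : ℝ)).const_mul r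
      have h1 := (h i j).2
      rw [show (0 : ℝ) = r * 0 by simp] at h1
      have := HasDerivAt.scomp (0 : ℝ) h1 h2
      simpa [Function.comp_def] using this

variable (G : Subgroup (Matrix.unitaryGroup (Fin n) ℂ)) (c : lieAlg G →ₗ[ℝ] ℝ)

/-- `c` is invariant under the coadjoint action. -/
def IsCoadInvariant : Prop :=
  ∀ (g : G) (ξ η : lieAlg G),
    (η : Matrix (Fin n) (Fin n) ℂ) = ((g : Matrix.unitaryGroup (Fin n) ℂ) :
      Matrix (Fin n) (Fin n) ℂ) * ξ * star ((g : Matrix.unitaryGroup (Fin n) ℂ) :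
      Matrix (Fin n) (Fin n) ℂ) → c η = c ξ

/-- The differential of `χ : G → U(1)` at the identity is `i c`. -/
def HasDifferential (χ : G →* Circle) : Prop :=
  ∀ (ξ : lieAlg G) (γ : ℝ → G), IsCurveWithVelocity G γ ξ →
    HasDerivAt (fun t => (χ (γ t) : ℂ)) (Complex.I * (c ξ : ℂ)) 0

/-- The standard quadratic hyperkähler moment map, `⟨ν_a(x), ξ⟩ = ω_a(ξ x, x) / 2`; it satisfies
`d⟨ν_a, ξ⟩ = i_{ξ x} ω_a`. -/
def momentMap (a : Fin 3) (ξ : Matrix (Fin n) (Fin n) ℂ) (x : Hn n) : ℝ :=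
  flatForm a (rep ξ x) x / 2

/-- The level set `ν⁻¹(c, 0, 0)`. -/
def levelSet : Set (Hn n) :=
  {x | ∀ ξ : lieAlg G, momentMap 0 (ξ : Matrix (Fin n) (Fin n) ℂ) x = c ξ ∧
    momentMap 1 (ξ : Matrix (Fin n) (Fin n) ℂ) x = 0 ∧
    momentMap 2 (ξ : Matrix (Fin n) (Fin n) ℂ) x = 0}

/-- The action of an element of `G` on `ℍⁿ`. -/
def gact (g : G) (x : Hn n) : Hn n :=
  rep ((g : Matrix.unitaryGroup (Fin n) ℂ) : Matrix (Fin n) (Fin n) ℂ) x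

theorem gact_one (x : Hn n) : gact G 1 x = x := by
  simp [gact, rep, Matrix.map_one]

theorem gact_mul (g h : G) (x : Hn n) : gact G (g * h) x = gact G g (gact G h x) := by
  have : rep (((g * h : G) : Matrix.unitaryGroup (Fin n) ℂ) : Matrix (Fin n) (Fin n) ℂ)
      = rep ((g : Matrix.unitaryGroup (Fin n) ℂ) : Matrix (Fin n) (Fin n) ℂ)
        * rep ((h : Matrix.unitaryGroup (Fin n) ℂ) : Matrix (Fin n) (Fin n) ℂ) := by
    unfold rep
    rw [← map_mul, Matrix.fromBlocks_multiply]
    simp [Matrix.map_mul]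
  simp only [gact, this]
  rfl

theorem gact_inv (g : G) (x : Hn n) : gact G g⁻¹ (gact G g x) = x := by
  rw [← gact_mul, inv_mul_cancel, gact_one]

theorem gact_smul (g : G) (t : Circle) (x : Hn n) :
    gact G g ((t : ℂ) • x) = (t : ℂ) • gact G g x := by
  simp [gact]

/-- `G` acts freely on the level set. -/
def ActsFreely : Prop := ∀ x ∈ levelSet G c, ∀ g : G, gact G g x = x → g = 1

/-- Two points of the level set are equivalent if they lie in the same `G`-orbit. -/
def orbitSetoid : Setoid (levelSet G c) where
  r x y := ∃ g : G, gact G g x = y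
  iseqv :=
    { refl := fun x => ⟨1, gact_one G x⟩
      symm := fun ⟨g, h⟩ => ⟨g⁻¹, by rw [← h, gact_inv]⟩
      trans := fun ⟨g, h⟩ ⟨k, l⟩ => ⟨k * g, by rw [gact_mul, h, l]⟩ }

/-- The hyperkähler quotient `ν⁻¹(c, 0, 0) / G`, with the quotient topology. -/
abbrev HKQuotient : Type := Quotient (orbitSetoid G c)

/-- The projection `ν⁻¹(c, 0, 0) → ν⁻¹(c, 0, 0) / G`. -/
def proj (x : levelSet G c) : HKQuotient G c := Quotient.mk (orbitSetoid G c) x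

theorem flat_smul_aux (t : Circle) (y x : Hn n) :
    flatForm 0 ((t : ℂ) • y) ((t : ℂ) • x) = flatForm 0 y x ∧
    (flatForm 1 y x = 0 → flatForm 2 y x = 0 →
      flatForm 1 ((t : ℂ) • y) ((t : ℂ) • x) = 0 ∧
      flatForm 2 ((t : ℂ) • y) ((t : ℂ) • x) = 0) := by
  have hJ : opJ ((t : ℂ) • y) = conj (t : ℂ) • opJ y := by
    ext i
    rcases i with i | i <;> simp [opJ]
  have ht : conj (t : ℂ) * (t : ℂ) = 1 := by
    rw [mul_comm, Complex.mul_conj, Circle.normSq_coe]; simp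
  have hre : ∀ a b : Hn n, inner ℝ a b = (inner ℂ a b).re := fun a b => by
    simp [PiLp.inner_apply, Complex.re_sum, Complex.inner]
  refine ⟨?_, fun h1 h2 => ?_⟩
  · simp only [flatForm, quat, Matrix.cons_val_zero, opI, hre, inner_smul_left, inner_smul_right]
    congr 1
    linear_combination (conj Complex.I * inner ℂ y x) * ht
  · simp only [flatForm, quat, Matrix.cons_val_one, Matrix.cons_val, opI, hre, inner_smul_left,
      inner_smul_right, hJ, Complex.conj_I, Complex.conj_conj] at h1 h2 ⊢
    have h2' : (inner ℂ (opJ y) x).im = 0 := by simpa using h2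
    have h0 : inner ℂ (opJ y) x = 0 := Complex.ext h1 h2'
    rw [h0]; simp

theorem smul_mem_levelSet (t : Circle) {x : Hn n} (hx : x ∈ levelSet G c) :
    (t : ℂ) • x ∈ levelSet G c := by
  intro ξ
  obtain ⟨h0, h1, h2⟩ := hx ξ
  simp only [momentMap, map_smul] at h0 h1 h2 ⊢
  obtain ⟨a0, a⟩ := flat_smul_aux t (rep (ξ : Matrix (Fin n) (Fin n) ℂ) x) x
  obtain ⟨a1, a2⟩ := a (by linarith) (by linarith)
  rw [a0, a1, a2]
  exact ⟨h0, by simp, by simp⟩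

/-- The circle action on the hyperkähler quotient induced by `(z, w) ↦ (e^{iθ} z, e^{iθ} w)`. -/
def circleAct (t : Circle) : HKQuotient G c → HKQuotient G c :=
  Quotient.map (fun x : levelSet G c => ⟨(t : ℂ) • (x : Hn n), smul_mem_levelSet G c t x.2⟩)
    (by
      rintro x y ⟨g, h⟩
      exact ⟨g, by rw [gact_smul, h]⟩)

/-! ### The geometry of the quotient -/

section Geometry

variable (d : ℕ) [ChartedSpace (EuclideanSpace ℝ (Fin d)) (HKQuotient G c)]

/-- The manifold structure on the quotient is the quotient structure: the projection is smooth,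
and it is a submersion, which is to say that it has a smooth local section through each point of
the level set. -/
def IsSmoothQuotient : Prop :=
  (∀ Q : Hn n → HKQuotient G c, (∀ x : levelSet G c, Q x = proj G c x) →
    ContMDiffOn 𝓘(ℝ, Hn n) (𝓡 d) ∞ Q (levelSet G c)) ∧
  ∀ x : levelSet G c, ∃ (V : Set (HKQuotient G c)) (σ : HKQuotient G c → Hn n),
    IsOpen V ∧ proj G c x ∈ V ∧ ContMDiffOn (𝓡 d) 𝓘(ℝ, Hn n) ∞ σ V ∧ σ (proj G c x) = x ∧
    ∀ m ∈ V, ∃ h : σ m ∈ levelSet G c, proj G c ⟨σ m, h⟩ = m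

open Classical in
/-- The projection, extended by a constant off the level set. -/
def projExt (x : levelSet G c) (y : Hn n) : HKQuotient G c :=
  if h : y ∈ levelSet G c then proj G c ⟨y, h⟩ else proj G c x

/-- The differential at `x` of the projection; only its values on vectors tangent to the level
set are meaningful. -/
def dproj (x : levelSet G c) : Hn n → TangentSpace (𝓡 d) (proj G c x) :=
  fun v => mfderivWithin 𝓘(ℝ, Hn n) (𝓡 d) (projExt G c x) (levelSet G c) x v

/-- The horizontal space at `x`. Orthogonality to `I ξ x`, `J ξ x`, `K ξ x` says that `v` is in the
kernel of `dν`, the tangent space of the level set; orthogonality to `ξ x` says that `v` is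
orthogonal to the orbit directions. -/
def horizontal (x : Hn n) : Set (Hn n) :=
  {v | ∀ ξ : lieAlg G, inner ℝ (rep (ξ : Matrix (Fin n) (Fin n) ℂ) x) v = 0 ∧
    ∀ a, inner ℝ (quat a (rep (ξ : Matrix (Fin n) (Fin n) ℂ) x)) v = 0}

/-- The horizontal lift at `x` of a tangent vector of the quotient. -/
def hlift (x : levelSet G c) (u : TangentSpace (𝓡 d) (proj G c x)) : Hn n :=
  Classical.epsilon fun v => v ∈ horizontal G (x : Hn n) ∧ dproj G c d x v = u

/-- A point of the level set over `m`. (The constructions below do not depend on this choice,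
since everything is `G`-invariant.) -/
def pt (m : HKQuotient G c) : levelSet G c := Quotient.out m

theorem proj_pt (m : HKQuotient G c) : proj G c (pt G c m) = m := Quotient.out_eq m

/-- The horizontal lift at the chosen point. -/
def hliftPt (m : HKQuotient G c) (u : TangentSpace (𝓡 d) m) : Hn n :=
  hlift G c d (pt G c m) u

/-- The quotient metric and the quotient complex structures `I, J, K`. -/
def quotientStructure : HyperStructure d (HKQuotient G c) where
  metric m u v := inner ℝ (hliftPt G c d m u) (hliftPt G c d m v)
  cplx a m u := dproj G c d (pt G c m) (quat a (hliftPt G c d m u))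

end Geometry

/-! ### The associated line bundle and its canonical connection -/

section Associated

variable (χ : G →* Circle)

/-- The diagonal action of `G` on `ν⁻¹(c, 0, 0) × ℂ`, through `χ` on `ℂ`. -/
def assocSetoid : Setoid (levelSet G c × ℂ) where
  r p q := ∃ g : G, gact G g p.1 = q.1 ∧ (χ g : ℂ) * p.2 = q.2
  iseqv :=
    { refl := fun p => ⟨1, gact_one G p.1, by simp⟩
      symm := fun {p q} ⟨g, h, k⟩ => ⟨g⁻¹, by rw [← h, gact_inv], by
        rw [← k, ← mul_assoc, ← Circle.coe_mul, ← map_mul]; simp⟩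
      trans := fun {p q r} ⟨g, h, k⟩ ⟨g', h', k'⟩ => ⟨g' * g, by rw [gact_mul, h, h'], by
        rw [← k', ← k, map_mul, Circle.coe_mul, mul_assoc]⟩ }

/-- The total space `ν⁻¹(c, 0, 0) ×_G ℂ`. -/
def AssocTotal : Type := Quotient (assocSetoid G c χ)

/-- The bundle projection. -/
def assocProj : AssocTotal G c χ → HKQuotient G c :=
  Quotient.lift (fun p : levelSet G c × ℂ => proj G c p.1)
    (by rintro p q ⟨g, h, -⟩; exact Quotient.sound ⟨g, h⟩)

/-- The fibre over `m`. -/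
def AssocFib (m : HKQuotient G c) : Type := {a : AssocTotal G c χ // assocProj G c χ a = m}

/-- The point `[x, v]` of the fibre over the orbit of `x`. -/
def assocMk {m : HKQuotient G c} (x : levelSet G c) (hx : proj G c x = m) (v : ℂ) :
    AssocFib G c χ m :=
  ⟨Quotient.mk (assocSetoid G c χ) (x, v), hx⟩

variable {c}

theorem assocMk_bijective (hfree : ActsFreely G c) {m : HKQuotient G c} (x : levelSet G c)
    (hx : proj G c x = m) : Function.Bijective (assocMk G c χ x hx) := by
  constructor
  · intro v v' h
    obtain ⟨g, h1, h2⟩ := Quotient.exact (congrArg Subtype.val h)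
    have := hfree x x.2 g h1
    subst this
    simpa using h2
  · rintro ⟨a, ha⟩
    induction a using Quotient.inductionOn with
    | h p =>
      obtain ⟨y, v⟩ := p
      have hy : proj G c y = proj G c x := ha.trans hx.symm
      obtain ⟨g, hg⟩ := Quotient.exact hy
      exact ⟨χ g * v, Subtype.ext (Quotient.sound ((assocSetoid G c χ).symm ⟨g, hg, rfl⟩))⟩

/-- The linear coordinate `[x, v] ↦ v` on the fibre over the orbit of `x`. -/
def assocCoord (hfree : ActsFreely G c) {m : HKQuotient G c} (x : levelSet G c)
    (hx : proj G c x = m) : AssocFib G c χ m ≃ ℂ :=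
  (Equiv.ofBijective _ (assocMk_bijective G χ hfree x hx)).symm

open Classical in
/-- The equivariant function on the level set that describes a section of the associated bundle:
`s([x]) = [x, f(x)]`; it is set to `0` off the level set. -/
def sectionFun (hfree : ActsFreely G c) (s : ∀ m, AssocFib G c χ m) (x : Hn n) : ℂ :=
  if h : x ∈ levelSet G c then
    assocCoord G χ hfree ⟨x, h⟩ rfl (s (proj G c ⟨x, h⟩))
  else 0

/-- The line bundle `ν⁻¹(c, 0, 0) ×_G ℂ`; the linear structure of the fibres is that of the second
component, and a section is smooth if its equivariant function on the level set is smooth. -/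
def assocBundle (hfree : ActsFreely G c) : LineBundle (HKQuotient G c) where
  Fib := AssocFib G c χ
  grp m := (assocCoord G χ hfree (pt G c m) (proj_pt G c m)).addCommGroup
  mod m := letI := (assocCoord G χ hfree (pt G c m) (proj_pt G c m)).addCommGroup
    (assocCoord G χ hfree (pt G c m) (proj_pt G c m)).module ℂ
  SmoothOn U s := ContDiffOn ℝ ∞ (sectionFun G χ hfree s)
    {x | ∃ h : x ∈ levelSet G c, proj G c ⟨x, h⟩ ∈ U}

/-- The hermitian metric `|[x, v]|² = |v|²` on the associated bundle. -/
def assocMetric (hfree : ActsFreely G c) (m : HKQuotient G c)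
    (a b : (assocBundle G χ hfree).Fib m) : ℂ :=
  conj (assocCoord G χ hfree (pt G c m) (proj_pt G c m) a) *
    assocCoord G χ hfree (pt G c m) (proj_pt G c m) b

/-- The canonical connection of the associated bundle: `∇_u s` at the orbit of `x` is
`[x, df(u^H)]`, where `f` is the equivariant function of `s` and `u^H` is the horizontal lift of
`u` at `x`. -/
def canonicalConnection (hfree : ActsFreely G c) (d : ℕ)
    [ChartedSpace (EuclideanSpace ℝ (Fin d)) (HKQuotient G c)] :
    CovDer d (assocBundle G χ hfree) :=
  fun s m u => assocMk G c χ (pt G c m) (proj_pt G c m)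
    (fderivWithin ℝ (sectionFun G χ hfree s) (levelSet G c) (pt G c m : Hn n)
      (hliftPt G c d m u))

end Associated

end Group

end

/-! Everything is computed upstairs on the level set N = ν⁻¹(c,0,0), where a section of the
associated bundle is a function f with f(gx) = χ(g) f(x). The heart of the proof is a one-parameter
family of metrics and connections: `scaledMetric κ` is e^{κ|x|²/2}|v|², and `scaledConn κ` is the
canonical connection plus κ times the form ½⟨x, u^H⟩, with ⟨·,·⟩ the complex inner product,
conjugate linear in the first slot. At κ = 0 it is the pair (h, ∇) of the theorem; at κ = 1 it is
the pair (h₀, ∇⁰) with curvature ω₁ that the definition asks for.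

In the trivialisation given by a local section σ of N → M̄, the connection form is (κ/2)⟨σ,dσ⟩ −
i(1−κ) c(Θ), where Θ = θ_σ(dσ) is the gauge potential of the orthogonal connection
(`fibEquiv_scaledConn_sec`). The terms combine in this way because ν₁ = c means ⟨x, ξx⟩ = −2i c(ξ)
(`inner_complex_act`). At κ = 1 only ½⟨σ,dσ⟩ survives. Its exterior derivative is i times the
pullback of the flat ω₁ by σ, and this pullback is the quotient form since ω₁ pairs orbit directions
to zero with tangent vectors of N (`hasCurvature_scaledConn`). The lift [x,v] ↦ [e^{iθ}x, v] has
moment map μ = −|x|²/2 (`isLift_liftAct`), and e^μ e^{|x|²/2} = 1 turns h₀ into h. As ⟨x,·⟩ is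
complex linear, varying κ does not change the (0,1)-part (`scaledConn_zero_one`).

For an arbitrary hyperholomorphic line bundle, the rescaling of the metric fixes the real part of ∇
− ∇⁰ and the common (0,1)-part then fixes its imaginary part: ∇ = ∇⁰ + (1/k)(dμ + i d^cμ)
(`connection_form_eq`). The exact term drops out of the curvature, and dμ = i_X ω₁ is the same for
all moment maps.

For the type, ω̄₁ + ½dd^cμ equals −c(dΘ) (`twistedForm_eq`). Since c vanishes on brackets
(`map_bracket`), dΘ can be replaced by the curvature Ω of the principal connection. Differentiating
the orthogonality of horizontal vectors to the orbits gives ⟨Ω(u,v)x, ηx⟩ = 2⟨v^H, ηu^H⟩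
(`exists_curvature`). The right side is unchanged when u and v are both rotated by I, J or K, as
these are isometries commuting with η; hence so is Ω.

The foundation is `exists_gauge`: near a point of a local section, N is the section times a
neighbourhood of 1 in G, with a smooth logarithm in the group direction. It rests on the closed
subgroup theorem (`exp_mem_matSet_of_tendsto`), on compactness and on freeness. Derivatives along N
are always evaluated on curves, so no manifold structure on N is used. -/

noncomputable section

/-! ### Flat quaternionic linear algebra. -/

section Flat

variable {n : ℕ}

theorem real_inner_eq_re (a b : Hn n) : inner ℝ a b = (inner ℂ a b).re := by
  simp [PiLp.inner_apply, Complex.re_sum, Complex.inner]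

theorem rep_add (A B : Matrix (Fin n) (Fin n) ℂ) : rep (A + B) = rep A + rep B := by
  unfold rep
  rw [← map_add, Matrix.fromBlocks_add]
  simp [Matrix.map_add]

theorem rep_real_smul (r : ℝ) (A : Matrix (Fin n) (Fin n) ℂ) : rep (r • A) = (r : ℂ) • rep A := by
  unfold rep
  rw [← map_smul, Matrix.fromBlocks_smul]
  congr 2
  · simp
  · simp
  · ext i j; simp

theorem rep_mul (A B : Matrix (Fin n) (Fin n) ℂ) : rep (A * B) = rep A * rep B := by
  unfold rep
  rw [← map_mul, Matrix.fromBlocks_multiply]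
  simp [Matrix.map_mul]

theorem rep_one : rep (1 : Matrix (Fin n) (Fin n) ℂ) = 1 := by
  simp [rep, Matrix.map_one]

/-- The representation of matrices as a real linear map into operators. -/
def repL : Matrix (Fin n) (Fin n) ℂ →ₗ[ℝ] (Hn n →L[ℂ] Hn n) where
  toFun := rep
  map_add' := rep_add
  map_smul' r A := by
    rw [rep_real_smul]; ext x i; simp

theorem rep_neg (A : Matrix (Fin n) (Fin n) ℂ) : rep (-A) = -rep A := map_neg repL A

theorem rep_sub (A B : Matrix (Fin n) (Fin n) ℂ) : rep (A - B) = rep A - rep B := map_sub repL A B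

theorem rep_star (A : Matrix (Fin n) (Fin n) ℂ) : rep (star A) = star (rep A) := by
  unfold rep
  rw [← map_star, Matrix.star_eq_conjTranspose, Matrix.star_eq_conjTranspose,
    Matrix.fromBlocks_conjTranspose]
  congr 2 <;> ext i j <;> simp

theorem inner_rep_left (A : Matrix (Fin n) (Fin n) ℂ) (x y : Hn n) :
    inner ℝ (rep A x) y = inner ℝ x (rep (star A) y) := by
  rw [real_inner_eq_re, real_inner_eq_re, rep_star, ContinuousLinearMap.star_eq_adjoint,
    ContinuousLinearMap.adjoint_inner_right]

/-- `J` interchanges the two summands and conjugates, so it turns `A` on one into `Ā` on the other;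
this is why the second block of `rep` is `Ā`. -/
theorem quat_rep (a : Fin 3) (A : Matrix (Fin n) (Fin n) ℂ) (x : Hn n) :
    quat a (rep A x) = rep A (quat a x) := by
  have hI : ∀ x : Hn n, opI (rep A x) = rep A (opI x) := fun x => by simp [opI]
  have hJ : ∀ x : Hn n, opJ (rep A x) = rep A (opJ x) := fun x => by
    ext i
    rcases i with i | i <;>
      simp [opJ, rep, Matrix.ofLp_toEuclideanCLM, Matrix.mulVec, dotProduct]
  fin_cases a
  · exact hI x
  · exact hJ x
  · change opI (opJ _) = rep A (opI (opJ x))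
    rw [hJ, hI]

theorem opJ_add (x y : Hn n) : opJ (x + y) = opJ x + opJ y := by
  ext i; rcases i with i | i <;> simp [opJ]; ring

theorem opJ_smul (r : ℝ) (x : Hn n) : opJ (r • x) = r • opJ x := by
  ext i; rcases i with i | i <;> simp [opJ]

theorem opJ_cplx_smul (z : ℂ) (x : Hn n) : opJ (z • x) = conj z • opJ x := by
  ext i; rcases i with i | i <;> simp [opJ]

/-- The complex structures as real continuous linear maps. -/
def quatL (a : Fin 3) : Hn n →L[ℝ] Hn n :=
  LinearMap.toContinuousLinearMap
    { toFun := quat a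
      map_add' := by
        intro x y
        fin_cases a
        · simp [quat, opI]
        · exact opJ_add x y
        · change opI (opJ _) = opI (opJ _) + opI (opJ _)
          simp [opI, opJ_add]
      map_smul' := by
        intro r x
        fin_cases a
        · simp only [quat, opI, RingHom.id_apply]; exact smul_comm _ _ _
        · exact opJ_smul r x
        · change opI (opJ _) = r • opI (opJ _)
          simp only [opI, opJ_smul]; exact smul_comm _ _ _ }

theorem quat_sub (a : Fin 3) (x y : Hn n) : quat a (x - y) = quat a x - quat a y :=
  map_sub (quatL a) x y

theorem opI_opI (x : Hn n) : opI (opI x) = -x := by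
  simp [opI, smul_smul]

theorem opJ_opJ (x : Hn n) : opJ (opJ x) = -x := by
  ext i; rcases i with i | i <;> simp [opJ]

theorem opJ_opI (x : Hn n) : opJ (opI x) = -opI (opJ x) := by
  simp [opI, opJ_cplx_smul]

theorem opI_neg (x : Hn n) : opI (-x) = -opI x := by simp [opI]

theorem quat_quat (a : Fin 3) (x : Hn n) : quat a (quat a x) = -x := by
  fin_cases a
  · exact opI_opI x
  · exact opJ_opJ x
  · change opI (opJ (opI (opJ x))) = -x
    rw [opJ_opI, opI_neg, opI_opI, opJ_opJ]; simp

/-- The quaternion relations up to a real factor, which is all that orthogonality arguments need: a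
unit moved across an inner product merges with the other one into a single unit. -/
theorem quat_comp (a b : Fin 3) : a = b ∨ ∃ (e : Fin 3) (r : ℝ), ∀ x : Hn n,
    quat a (quat b x) = r • quat e x := by
  fin_cases a <;> fin_cases b <;> simp only [Fin.zero_eta, Fin.mk_one, Fin.reduceFinMk,
    true_or] <;> right
  · exact ⟨2, 1, fun x => by simp [quat]⟩
  · exact ⟨1, -1, fun x => by
      change opI (opI (opJ x)) = (-1 : ℝ) • opJ x
      rw [opI_opI]; simp⟩
  · exact ⟨2, -1, fun x => by
      change opJ (opI x) = (-1 : ℝ) • opI (opJ x)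
      rw [opJ_opI]; simp⟩
  · exact ⟨0, 1, fun x => by
      change opJ (opI (opJ x)) = (1 : ℝ) • opI x
      rw [opJ_opI, opJ_opJ, opI_neg]; simp⟩
  · exact ⟨1, 1, fun x => by
      change opI (opJ (opI x)) = (1 : ℝ) • opJ x
      rw [opJ_opI, opI_neg, opI_opI]; simp⟩
  · exact ⟨0, -1, fun x => by
      change opI (opJ (opJ x)) = (-1 : ℝ) • opI x
      rw [opJ_opJ, opI_neg]; simp⟩

theorem inner_quat_quat (a : Fin 3) (x y : Hn n) :
    inner ℝ (quat a x) (quat a y) = inner ℝ x y := by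
  have hI : ∀ x y : Hn n, inner ℝ (opI x) (opI y) = inner ℝ x y := fun x y => by
    rw [real_inner_eq_re, real_inner_eq_re, opI, opI, inner_smul_left, inner_smul_right,
      ← mul_assoc]
    simp
  have hJ : ∀ x y : Hn n, inner ℝ (opJ x) (opJ y) = inner ℝ x y := fun x y => by
    simp only [PiLp.inner_apply, Fintype.sum_sum_type, opJ, Complex.inner]
    simp [add_comm, mul_comm]
  fin_cases a
  · exact hI x y
  · exact hJ x y
  · change inner ℝ (opI (opJ x)) (opI (opJ y)) = _
    rw [hI, hJ]

theorem inner_quat_left (a : Fin 3) (x y : Hn n) :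
    inner ℝ (quat a x) y = -inner ℝ x (quat a y) := by
  rw [← inner_quat_quat a x (quat a y), quat_quat, inner_neg_right, neg_neg]

theorem flatForm_antisymm (a : Fin 3) (x y : Hn n) : flatForm a x y = -flatForm a y x := by
  rw [flatForm, flatForm, inner_quat_left, real_inner_comm]

/-- The complex form `ω₂ + i ω₃`. -/
theorem flatForm_cplx_smul (t : Circle) (x y : Hn n) :
    (flatForm 1 ((t : ℂ) • x) ((t : ℂ) • y) : ℂ)
      + Complex.I * flatForm 2 ((t : ℂ) • x) ((t : ℂ) • y)
    = (t : ℂ) ^ 2 * ((flatForm 1 x y : ℂ) + Complex.I * flatForm 2 x y) := by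
  -- ω₂ + iω₃ is the complex inner product with Jx in the conjugate linear slot. As J is itself
  -- antilinear, the form is complex bilinear, hence the weight 2.
  have key : ∀ x y : Hn n, (flatForm 1 x y : ℂ) + Complex.I * flatForm 2 x y
      = inner ℂ (opJ x) y := by
    intro x y
    have h1 : flatForm 1 x y = (inner ℂ (opJ x) y).re := real_inner_eq_re _ _
    have h2 : flatForm 2 x y = (inner ℂ (opJ x) y).im := by
      change inner ℝ (opI (opJ x)) y = _
      rw [real_inner_eq_re, opI, inner_smul_left]; simp
    rw [h1, h2, mul_comm]
    exact Complex.re_add_im _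
  rw [key, key, opJ_cplx_smul, inner_smul_left, inner_smul_right, Complex.conj_conj]
  ring

theorem inner_circle_smul (t : Circle) (x y : Hn n) :
    inner ℝ ((t : ℂ) • x) ((t : ℂ) • y) = inner ℝ x y := by
  rw [real_inner_eq_re, real_inner_eq_re, inner_smul_left, inner_smul_right, ← mul_assoc,
    mul_comm (conj _), Complex.mul_conj, Circle.normSq_coe]
  simp

theorem quat_zero_circle_smul (t : Circle) (x : Hn n) :
    quat 0 ((t : ℂ) • x) = (t : ℂ) • quat 0 x := smul_comm _ _ _

theorem inner_rep_unitary {A : Matrix (Fin n) (Fin n) ℂ} (hA : A ∈ Matrix.unitaryGroup (Fin n) ℂ)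
    (x y : Hn n) : inner ℝ (rep A x) (rep A y) = inner ℝ x y := by
  rw [inner_rep_left, ← mul_apply_eq_comp, ← rep_mul,
    (Matrix.mem_unitaryGroup_iff').1 hA, rep_one]
  rfl

end Flat

end

noncomputable section

/-! ### Closed subgroups of U(n): exponential map, Lie algebra and characters. -/

section LieGroup

attribute [local instance] Matrix.linftyOpNormedRing Matrix.linftyOpNormedAlgebra

open Filter

variable {n : ℕ} (G : Subgroup (Matrix.unitaryGroup (Fin n) ℂ))

/-- The set of matrices which belong to `G`. -/
def matSet : Set (Matrix (Fin n) (Fin n) ℂ) :=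
  Subtype.val '' (G : Set (Matrix.unitaryGroup (Fin n) ℂ))

variable {G}

theorem coe_mem_matSet (g : G) :
    ((g : Matrix.unitaryGroup (Fin n) ℂ) : Matrix (Fin n) (Fin n) ℂ) ∈ matSet G :=
  ⟨g, g.2, rfl⟩

theorem mem_matSet_iff {A : Matrix (Fin n) (Fin n) ℂ} : A ∈ matSet G ↔
    ∃ g : G, ((g : Matrix.unitaryGroup (Fin n) ℂ) : Matrix (Fin n) (Fin n) ℂ) = A :=
  ⟨fun ⟨u, hu, h⟩ => ⟨⟨u, hu⟩, h⟩, fun ⟨g, h⟩ => h ▸ coe_mem_matSet g⟩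

theorem one_mem_matSet : (1 : Matrix (Fin n) (Fin n) ℂ) ∈ matSet G := ⟨1, G.one_mem, rfl⟩

theorem mul_mem_matSet {A B : Matrix (Fin n) (Fin n) ℂ} (hA : A ∈ matSet G) (hB : B ∈ matSet G) :
    A * B ∈ matSet G := by
  obtain ⟨u, hu, rfl⟩ := hA
  obtain ⟨v, hv, rfl⟩ := hB
  exact ⟨u * v, G.mul_mem hu hv, rfl⟩

theorem pow_mem_matSet {A : Matrix (Fin n) (Fin n) ℂ} (hA : A ∈ matSet G) (k : ℕ) :
    A ^ k ∈ matSet G := by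
  induction k with
  | zero => simpa using one_mem_matSet
  | succ k ih => rw [pow_succ]; exact mul_mem_matSet ih hA

theorem star_mem_matSet {A : Matrix (Fin n) (Fin n) ℂ} (hA : A ∈ matSet G) :
    star A ∈ matSet G := by
  obtain ⟨u, hu, rfl⟩ := hA
  exact ⟨u⁻¹, G.inv_mem hu, rfl⟩

theorem unitary_of_mem_matSet {A : Matrix (Fin n) (Fin n) ℂ} (hA : A ∈ matSet G) :
    A ∈ Matrix.unitaryGroup (Fin n) ℂ := by
  obtain ⟨u, hu, rfl⟩ := hA
  exact u.2

theorem isClosed_unitaryGroup :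
    IsClosed (Matrix.unitaryGroup (Fin n) ℂ : Set (Matrix (Fin n) (Fin n) ℂ)) := by
  have : (Matrix.unitaryGroup (Fin n) ℂ : Set (Matrix (Fin n) (Fin n) ℂ))
      = {A | A * star A = 1} := by
    ext A; exact Matrix.mem_unitaryGroup_iff
  rw [this]
  exact isClosed_eq (continuous_id.mul continuous_star) continuous_const

theorem isClosed_matSet (hG : IsClosed (G : Set (Matrix.unitaryGroup (Fin n) ℂ))) :
    IsClosed (matSet G) :=
  isClosed_unitaryGroup.isClosedEmbedding_subtypeVal.isClosedMap _ hG

theorem isCompact_matSet (hG : IsClosed (G : Set (Matrix.unitaryGroup (Fin n) ℂ))) :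
    IsCompact (matSet G) := by
  have hK : IsCompact (Set.pi Set.univ fun _ : Fin n =>
      Set.pi Set.univ fun _ : Fin n => Metric.closedBall (0 : ℂ) 1) :=
    isCompact_univ_pi fun _ => isCompact_univ_pi fun _ => isCompact_closedBall _ _
  refine IsCompact.of_isClosed_subset hK (isClosed_matSet hG) fun A hA i _ j _ => ?_
  rw [mem_closedBall_zero_iff]
  exact entry_norm_bound_of_unitary (unitary_of_mem_matSet hA) i j

/-- Matrices carry the product topology, so difference quotients converge as soon as their entries
do. -/
theorem HasDerivAt.matrix_of_entries {f : ℝ → Matrix (Fin n) (Fin n) ℂ}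
    {f' : Matrix (Fin n) (Fin n) ℂ} {t : ℝ}
    (h : ∀ i j, HasDerivAt (fun s => f s i j) (f' i j) t) : HasDerivAt f f' t := by
  refine hasDerivAt_iff_tendsto_slope.2 ?_
  refine tendsto_pi_nhds.2 fun i => tendsto_pi_nhds.2 fun j => ?_
  exact hasDerivAt_iff_tendsto_slope.1 (h i j)

theorem HasDerivAt.matrix_entry {f : ℝ → Matrix (Fin n) (Fin n) ℂ}
    {f' : Matrix (Fin n) (Fin n) ℂ} {t : ℝ} (h : HasDerivAt f f' t) (i j : Fin n) :
    HasDerivAt (fun s => f s i j) (f' i j) t := by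
  refine hasDerivAt_iff_tendsto_slope.2 ?_
  exact tendsto_pi_nhds.1 (tendsto_pi_nhds.1 (hasDerivAt_iff_tendsto_slope.1 h) i) j

theorem contDiff_matrix_exp :
    ContDiff ℝ ∞ (NormedSpace.exp : Matrix (Fin n) (Fin n) ℂ → Matrix (Fin n) (Fin n) ℂ) :=
  contDiff_iff_contDiffAt.2 fun x => (NormedSpace.exp_analytic (𝕂 := ℝ) x).contDiffAt

theorem hasDerivAt_matrix_exp (ξ : Matrix (Fin n) (Fin n) ℂ) (t : ℝ) :
    HasDerivAt (fun s : ℝ => NormedSpace.exp (s • ξ)) (NormedSpace.exp (t • ξ) * ξ) t :=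
  hasDerivAt_exp_smul_const ξ t

theorem hasDerivAt_matrix_exp_zero (ξ : Matrix (Fin n) (Fin n) ℂ) :
    HasDerivAt (fun s : ℝ => NormedSpace.exp (s • ξ)) ξ 0 := by
  simpa using hasDerivAt_matrix_exp ξ 0

theorem exp_neg_mul_exp (ξ : Matrix (Fin n) (Fin n) ℂ) :
    NormedSpace.exp (-ξ) * NormedSpace.exp ξ = 1 := by
  rw [← Matrix.exp_add_of_commute _ _ ((Commute.refl ξ).neg_left)]
  simp

theorem exp_mul_exp_neg (ξ : Matrix (Fin n) (Fin n) ℂ) :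
    NormedSpace.exp ξ * NormedSpace.exp (-ξ) = 1 := by
  rw [← Matrix.exp_add_of_commute _ _ ((Commute.refl ξ).neg_right)]
  simp

/-- A limit of rescaled differences `g k - 1` of elements of a closed group of matrices
exponentiates into the group. -/
theorem exp_mem_matSet_of_tendsto (hG : IsClosed (G : Set (Matrix.unitaryGroup (Fin n) ℂ)))
    {g : ℕ → Matrix (Fin n) (Fin n) ℂ} (hg : ∀ k, g k ∈ matSet G) {r : ℕ → ℝ}
    (hr : Tendsto r atTop atTop) {ξ : Matrix (Fin n) (Fin n) ℂ}
    (h : Tendsto (fun k => r k • (g k - 1)) atTop (𝓝 ξ)) (t : ℝ) :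
    NormedSpace.exp (t • ξ) ∈ matSet G := by
  have hg1 : Tendsto (fun k => g k - 1) atTop (𝓝 0) := by
    have : Tendsto (fun k => (r k)⁻¹ • (r k • (g k - 1))) atTop (𝓝 ((0 : ℝ) • ξ)) :=
      (tendsto_inv_atTop_zero.comp hr).smul h
    rw [zero_smul] at this
    refine this.congr' ?_
    filter_upwards [hr.eventually_gt_atTop 0] with k hk
    rw [smul_smul, inv_mul_cancel₀ hk.ne', one_smul]
  have hstrict : HasStrictFDerivAt (NormedSpace.exp : Matrix (Fin n) (Fin n) ℂ → _)
      ((ContinuousLinearEquiv.refl ℝ (Matrix (Fin n) (Fin n) ℂ)) :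
        Matrix (Fin n) (Fin n) ℂ →L[ℝ] Matrix (Fin n) (Fin n) ℂ) 0 :=
    hasStrictFDerivAt_exp_zero
  set lg := hstrict.localInverse NormedSpace.exp
    (ContinuousLinearEquiv.refl ℝ (Matrix (Fin n) (Fin n) ℂ)) 0
  have hlg : HasStrictFDerivAt lg _ (NormedSpace.exp (0 : Matrix (Fin n) (Fin n) ℂ)) :=
    hstrict.to_localInverse
  have hlg0 : lg 1 = 0 := by
    have := hstrict.localInverse_apply_image
    rwa [NormedSpace.exp_zero] at this
  have hright : ∀ᶠ A in 𝓝 (1 : Matrix (Fin n) (Fin n) ℂ), NormedSpace.exp (lg A) = A := by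
    have := hstrict.eventually_right_inverse
    rwa [NormedSpace.exp_zero] at this
  rw [NormedSpace.exp_zero] at hlg
  have hgt : Tendsto g atTop (𝓝 1) := by simpa using hg1.add_const 1
  -- The logarithm has the identity as derivative at 1, so log g k and g k − 1 have the same
  -- rescaled limit.
  have hlim : Tendsto (fun k => r k • lg (g k)) atTop (𝓝 ξ) := by
    have := hlg.hasFDerivAt.hasFDerivWithinAt.lim (s := Set.univ) (l := atTop) (c := r)
      (d := fun k => g k - 1) (v := ξ) hg1 (by simp) h
    simp only [add_sub_cancel, hlg0, sub_zero] at this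
    exact this
  have hpos : ∀ s : ℝ, 0 ≤ s → NormedSpace.exp (s • ξ) ∈ matSet G := by
    intro s hs
    -- With exponent ⌊s r_k⌋, the powers of g k lie in G and converge to exp(sξ); closedness puts
    -- the limit in G.
    have hfl : Tendsto (fun k => ((⌊s * r k⌋₊ : ℝ)) / r k) atTop (𝓝 s) :=
      (tendsto_nat_floor_mul_div_atTop (R := ℝ) hs).comp hr
    have h2 : Tendsto (fun k => (⌊s * r k⌋₊ : ℝ) • lg (g k)) atTop (𝓝 (s • ξ)) := by
      refine (hfl.smul hlim).congr' ?_
      filter_upwards [hr.eventually_gt_atTop 0] with k hk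
      rw [smul_smul, div_mul_cancel₀ _ hk.ne']
    have h3 : Tendsto (fun k => NormedSpace.exp ((⌊s * r k⌋₊ : ℝ) • lg (g k))) atTop
        (𝓝 (NormedSpace.exp (s • ξ))) :=
      (contDiff_matrix_exp.continuous.tendsto _).comp h2
    refine (isClosed_matSet hG).mem_of_tendsto h3 ?_
    filter_upwards [hgt.eventually hright] with k hk
    rw [Nat.cast_smul_eq_nsmul, Matrix.exp_nsmul, hk]
    exact pow_mem_matSet (hg k) _
  rcases le_total 0 t with ht | ht
  · exact hpos t ht
  · have h1 := hpos (-t) (by linarith)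
    have h2 := star_mem_matSet h1
    have h3 : NormedSpace.exp ((-t) • ξ) * NormedSpace.exp (t • ξ) = 1 := by
      rw [neg_smul]; exact exp_neg_mul_exp _
    have h4 : star (NormedSpace.exp ((-t) • ξ)) * NormedSpace.exp ((-t) • ξ) = 1 :=
      Matrix.mem_unitaryGroup_iff'.1 (unitary_of_mem_matSet h1)
    rw [left_inv_eq_right_inv h4 h3] at h2
    exact h2

theorem isCurveWithVelocity_exp {ξ : Matrix (Fin n) (Fin n) ℂ} {γ : ℝ → G}
    (h : ∀ t : ℝ, ((γ t : Matrix.unitaryGroup (Fin n) ℂ) : Matrix (Fin n) (Fin n) ℂ)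
      = NormedSpace.exp (t • ξ)) : IsCurveWithVelocity G γ ξ := by
  have h' : (fun t => ((γ t : Matrix.unitaryGroup (Fin n) ℂ) : Matrix (Fin n) (Fin n) ℂ))
      = fun t : ℝ => NormedSpace.exp (t • ξ) := funext h
  have hc : ContDiff ℝ ∞ (fun t : ℝ => NormedSpace.exp (t • ξ)) :=
    contDiff_matrix_exp.comp (contDiff_id.smul contDiff_const)
  refine ⟨Subtype.ext (Subtype.ext (by simpa using h 0)), fun i j => ⟨?_, ?_⟩⟩
  · have he : ContDiff ℝ ∞ (fun A : Matrix (Fin n) (Fin n) ℂ => A i j) :=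
      (LinearMap.toContinuousLinearMap (Matrix.entryLinearMap ℝ ℂ i j)).contDiff
    simp only [h]
    exact he.comp hc
  · simp only [h]
    exact (hasDerivAt_matrix_exp_zero ξ).matrix_entry i j

theorem mem_lieAlg_of_exp_mem {ξ : Matrix (Fin n) (Fin n) ℂ}
    (h : ∀ t : ℝ, NormedSpace.exp (t • ξ) ∈ matSet G) : ξ ∈ lieAlg G := by
  choose γ hγ using fun t => mem_matSet_iff.1 (h t)
  exact ⟨γ, isCurveWithVelocity_exp hγ⟩

/-- The elements γ(1/k), rescaled by k, have the velocity of γ as limit, so the closed subgroup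
argument applies to them. -/
theorem exp_mem_matSet (hG : IsClosed (G : Set (Matrix.unitaryGroup (Fin n) ℂ)))
    {ξ : Matrix (Fin n) (Fin n) ℂ} (hξ : ξ ∈ lieAlg G) : NormedSpace.exp ξ ∈ matSet G := by
  obtain ⟨γ, h0, h⟩ := hξ
  have hd : HasDerivAt (fun t => ((γ t : Matrix.unitaryGroup (Fin n) ℂ) :
      Matrix (Fin n) (Fin n) ℂ)) ξ 0 := HasDerivAt.matrix_of_entries fun i j => (h i j).2
  have hr : Tendsto (fun k : ℕ => (k : ℝ)) atTop atTop := tendsto_natCast_atTop_atTop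
  have := exp_mem_matSet_of_tendsto (ξ := ξ) hG (g := fun k : ℕ =>
    ((γ ((k : ℝ)⁻¹) : Matrix.unitaryGroup (Fin n) ℂ) : Matrix (Fin n) (Fin n) ℂ))
    (fun k => coe_mem_matSet _) hr ?_ 1
  · simpa using this
  · have h1 := hd.hasFDerivAt.hasFDerivWithinAt.lim (s := Set.univ) (l := (atTop : Filter ℕ))
      (c := fun k => (k : ℝ)) (d := fun k => (k : ℝ)⁻¹) (v := 1)
      (tendsto_inv_atTop_zero.comp hr) (by simp) ?_
    · simpa [h0] using h1
    · refine tendsto_const_nhds.congr' ?_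
      filter_upwards [hr.eventually_gt_atTop 0] with k hk
      simp [hk.ne']

/-- Differentiate exp(tξ) exp(tξ*) = 1 at t = 0. -/
theorem star_eq_neg_of_mem_lieAlg (hG : IsClosed (G : Set (Matrix.unitaryGroup (Fin n) ℂ)))
    {ξ : Matrix (Fin n) (Fin n) ℂ} (hξ : ξ ∈ lieAlg G) : star ξ = -ξ := by
  have h1 : ∀ t : ℝ, NormedSpace.exp (t • ξ) * NormedSpace.exp (t • star ξ) = 1 := by
    intro t
    have h := Matrix.mem_unitaryGroup_iff.1
      (unitary_of_mem_matSet (exp_mem_matSet hG ((lieAlg G).smul_mem t hξ)))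
    rw [Matrix.star_eq_conjTranspose, ← Matrix.exp_conjTranspose,
      Matrix.conjTranspose_smul, ← Matrix.star_eq_conjTranspose] at h
    simpa using h
  have h2 := (hasDerivAt_matrix_exp_zero ξ).mul (hasDerivAt_matrix_exp_zero (star ξ))
  have h3 : HasDerivAt (fun t : ℝ => NormedSpace.exp (t • ξ) * NormedSpace.exp (t • star ξ)) 0 0 := by
    simp only [h1]; exact hasDerivAt_const _ _
  have h4 := h2.unique h3
  simp only [zero_smul, NormedSpace.exp_zero, mul_one, one_mul] at h4
  exact eq_neg_of_add_eq_zero_right h4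

theorem conj_mem_lieAlg (hG : IsClosed (G : Set (Matrix.unitaryGroup (Fin n) ℂ)))
    {A ξ : Matrix (Fin n) (Fin n) ℂ} (hA : A ∈ matSet G) (hξ : ξ ∈ lieAlg G) :
    A * ξ * star A ∈ lieAlg G := by
  refine mem_lieAlg_of_exp_mem fun t => ?_
  have hu := unitary_of_mem_matSet hA
  have hinv : A⁻¹ = star A := Matrix.inv_eq_left_inv (Matrix.mem_unitaryGroup_iff'.1 hu)
  have hunit : IsUnit A := IsUnit.of_mul_eq_one _ (Matrix.mem_unitaryGroup_iff.1 hu)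
  have : t • (A * ξ * star A) = A * (t • ξ) * A⁻¹ := by
    rw [hinv, Matrix.mul_smul, Matrix.smul_mul]
  rw [this, Matrix.exp_conj _ _ hunit, hinv]
  exact mul_mem_matSet (mul_mem_matSet hA (exp_mem_matSet hG ((lieAlg G).smul_mem t hξ)))
    (star_mem_matSet hA)

/-- The bracket is the derivative at 0 of exp(tξ) η exp(−tξ), a curve in the Lie algebra, which is
closed because it is a finite-dimensional subspace. -/
theorem bracket_mem_lieAlg (hG : IsClosed (G : Set (Matrix.unitaryGroup (Fin n) ℂ)))
    {ξ η : Matrix (Fin n) (Fin n) ℂ} (hξ : ξ ∈ lieAlg G) (hη : η ∈ lieAlg G) :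
    ξ * η - η * ξ ∈ lieAlg G := by
  have h1 : ∀ t : ℝ, NormedSpace.exp (t • ξ) * η * NormedSpace.exp (t • (-ξ)) ∈ lieAlg G := by
    intro t
    have hm := exp_mem_matSet hG ((lieAlg G).smul_mem t hξ)
    have := conj_mem_lieAlg hG hm hη
    rwa [left_inv_eq_right_inv (Matrix.mem_unitaryGroup_iff'.1 (unitary_of_mem_matSet hm))
      (exp_mul_exp_neg (t • ξ)), ← smul_neg] at this
  have h2 := ((hasDerivAt_matrix_exp_zero ξ).mul_const η).mul (hasDerivAt_matrix_exp_zero (-ξ))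
  simp only [zero_smul, NormedSpace.exp_zero, mul_one, one_mul, mul_neg] at h2
  rw [hasDerivAt_iff_tendsto_slope] at h2
  have hcl : IsClosed (lieAlg G : Set (Matrix (Fin n) (Fin n) ℂ)) :=
    Submodule.closed_of_finiteDimensional _
  rw [sub_eq_add_neg]
  refine hcl.mem_of_tendsto h2 (Eventually.of_forall fun t => ?_)
  rw [slope_def_module]
  exact (lieAlg G).smul_mem _ ((lieAlg G).sub_mem (h1 t) (h1 0))

variable {c : lieAlg G →ₗ[ℝ] ℝ} {χ : G →* Circle}

/-- Multiplicativity carries the derivative of t ↦ χ(exp tξ) from 0 to all times, so its product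
with e^{−itc(ξ)} is constant; compare t = 0 with t = 1. -/
theorem character_exp (hG : IsClosed (G : Set (Matrix.unitaryGroup (Fin n) ℂ)))
    (hdχ : HasDifferential G c χ) (ξ : lieAlg G) (g : G)
    (hg : ((g : Matrix.unitaryGroup (Fin n) ℂ) : Matrix (Fin n) (Fin n) ℂ)
      = NormedSpace.exp (ξ : Matrix (Fin n) (Fin n) ℂ)) :
    (χ g : ℂ) = Complex.exp (Complex.I * c ξ) := by
  choose γ hγ using fun t : ℝ => mem_matSet_iff.1 (exp_mem_matSet hG ((lieAlg G).smul_mem t ξ.2))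
  have hadd : ∀ s t, γ (s + t) = γ s * γ t := fun s t => by
    refine Subtype.ext (Subtype.ext ?_)
    change _ = ((γ s : Matrix.unitaryGroup (Fin n) ℂ) : Matrix (Fin n) (Fin n) ℂ) *
      ((γ t : Matrix.unitaryGroup (Fin n) ℂ) : Matrix (Fin n) (Fin n) ℂ)
    rw [hγ, hγ, hγ, add_smul]
    exact Matrix.exp_add_of_commute _ _ (((Commute.refl _).smul_left _).smul_right _)
  have hder := hdχ ξ γ (isCurveWithVelocity_exp hγ)
  have hder' : ∀ t, HasDerivAt (fun s => (χ (γ s) : ℂ)) (χ (γ t) * (Complex.I * c ξ)) t := by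
    intro t
    have h1 : HasDerivAt (fun s => (χ (γ (s - t)) : ℂ)) (Complex.I * c ξ) t := by
      have := HasDerivAt.comp_sub_const t t (f := fun s => (χ (γ s) : ℂ)) (f' := Complex.I * c ξ)
        (by simpa using hder)
      exact this
    refine (h1.const_mul (χ (γ t) : ℂ)).congr_of_eventuallyEq (Eventually.of_forall fun s => ?_)
    simp only
    rw [← Circle.coe_mul, ← map_mul, ← hadd, add_sub_cancel]
  have hconst : ∀ t, HasDerivAt (fun s : ℝ => (χ (γ s) : ℂ) * Complex.exp (-(s * (Complex.I * c ξ))))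
      0 t := by
    intro t
    have h1 : HasDerivAt (fun s : ℝ => -((s : ℂ) * (Complex.I * c ξ))) (-(Complex.I * c ξ)) t := by
      have := ((Complex.ofRealCLM.hasDerivAt (x := t)).mul_const (Complex.I * (c ξ : ℂ))).neg
      simp only [Complex.ofRealCLM_apply, Complex.ofReal_one, one_mul] at this
      exact this
    refine ((hder' t).mul h1.cexp).congr_deriv ?_
    ring
  have heq : (χ (γ 1) : ℂ) * Complex.exp (-(((1 : ℝ) : ℂ) * (Complex.I * c ξ)))
      = (χ (γ 0) : ℂ) * Complex.exp (-(((0 : ℝ) : ℂ) * (Complex.I * c ξ))) :=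
    is_const_of_deriv_eq_zero (fun t => (hconst t).differentiableAt) (fun t => (hconst t).deriv) 1 0
  have h0 : γ 0 = 1 := (isCurveWithVelocity_exp hγ).1
  have h1 : γ 1 = g := Subtype.ext (Subtype.ext (by rw [hγ, one_smul, hg]))
  rw [h0, h1] at heq
  simp only [Complex.ofReal_one, one_mul, map_one, Circle.coe_one, Complex.ofReal_zero, zero_mul,
    neg_zero, Complex.exp_zero, mul_one] at heq
  calc (χ g : ℂ) = (χ g : ℂ) * Complex.exp (-(Complex.I * c ξ)) * Complex.exp (Complex.I * c ξ) := by
        rw [mul_assoc, ← Complex.exp_add]; simp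
    _ = _ := by rw [heq, one_mul]

end LieGroup

end

noncomputable section

/-! ### The level set: Gram form of the orbits, tangent and horizontal spaces. -/

section LevelSet

attribute [local instance] Matrix.linftyOpNormedRing Matrix.linftyOpNormedAlgebra

open Filter

variable {n : ℕ} (G : Subgroup (Matrix.unitaryGroup (Fin n) ℂ))

/-- A coordinate space for the Lie algebra. -/
abbrev LieW : Type := EuclideanSpace ℝ (Fin (Module.finrank ℝ (lieAlg G)))

/-- Coordinates on the Lie algebra. -/
def lieEquiv : LieW G ≃ₗ[ℝ] lieAlg G :=
  LinearEquiv.ofFinrankEq _ _ (by simp)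

/-- The Lie algebra element with given coordinates, as a matrix. -/
def lam : LieW G →L[ℝ] Matrix (Fin n) (Fin n) ℂ :=
  LinearMap.toContinuousLinearMap ((lieAlg G).subtype ∘ₗ (lieEquiv G).toLinearMap)

/-- The infinitesimal action of the Lie algebra on `ℍⁿ`. -/
def act : LieW G →L[ℝ] Hn n →L[ℝ] Hn n :=
  LinearMap.toContinuousBilinearMap
    (LinearMap.mk₂ ℝ (fun (ξ : LieW G) (x : Hn n) => rep (lam G ξ) x)
      (fun ξ η x => by simp [rep_add]) (fun r ξ x => by
        rw [map_smul, rep_real_smul]; rfl)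
      (fun ξ x y => map_add _ _ _) (fun r ξ x => by
        exact map_smul ((rep (lam G ξ)).restrictScalars ℝ) r x))

/-- `pairL x v` is the linear form `η ↦ ⟨v, η x⟩` on the Lie algebra. -/
def pairL : Hn n →L[ℝ] Hn n →L[ℝ] StrongDual ℝ (LieW G) :=
  LinearMap.toContinuousBilinearMap
    (LinearMap.mk₂ ℝ (fun (x v : Hn n) => (innerSL ℝ v).comp ((act G).flip x))
      (fun x y v => by ext η; simp)
      (fun r x v => by
        rw [map_smul]; ext η; exact inner_smul_right v (act G η x) r)
      (fun x v w => by ext η; simp)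
      (fun r x v => by ext η; simp))

@[simp] theorem pairL_apply (x v : Hn n) (η : LieW G) :
    pairL G x v η = inner ℝ v (rep (lam G η) x) := rfl

/-- The Gram form of the orbit map at `x`. -/
def gram (x : Hn n) : LieW G →L[ℝ] StrongDual ℝ (LieW G) :=
  (pairL G x).comp ((act G).flip x)

@[simp] theorem gram_apply (x : Hn n) (ξ η : LieW G) :
    gram G x ξ η = inner ℝ (rep (lam G ξ) x)
      (rep (lam G η) x) := rfl

theorem contDiff_gram : ContDiff ℝ ∞ (gram G) :=
  (pairL G).contDiff.clm_comp (act G).flip.contDiff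

/-- The Lie algebra element `θ_x(v)` for which `θ_x(v) x` is the orthogonal projection of `v` to
the orbit directions. -/
def theta (x v : Hn n) : LieW G := (gram G x).inverse (pairL G x v)

/-- The tangent space of the level set. -/
def tangentSub (x : Hn n) : Submodule ℝ (Hn n) where
  carrier := {v | ∀ (ξ : LieW G) (a : Fin 3),
    inner ℝ (quat a (rep (lam G ξ) x)) v = 0}
  add_mem' h k ξ a := by rw [inner_add_right, h ξ a, k ξ a, add_zero]
  zero_mem' ξ a := inner_zero_right _
  smul_mem' r v h ξ a := by rw [inner_smul_right, h ξ a, mul_zero]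

/-- The horizontal space as a linear subspace. -/
def horSub (x : Hn n) : Submodule ℝ (Hn n) where
  carrier := {v | ∀ ξ : LieW G, inner ℝ (rep (lam G ξ) x) v = 0 ∧
    ∀ a, inner ℝ (quat a (rep (lam G ξ) x)) v = 0}
  add_mem' h k ξ := ⟨by rw [inner_add_right, (h ξ).1, (k ξ).1, add_zero], fun a => by
    rw [inner_add_right, (h ξ).2 a, (k ξ).2 a, add_zero]⟩
  zero_mem' ξ := ⟨inner_zero_right _, fun a => inner_zero_right _⟩
  smul_mem' r v h ξ := ⟨by rw [inner_smul_right, (h ξ).1, mul_zero], fun a => by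
    rw [inner_smul_right, (h ξ).2 a, mul_zero]⟩

variable {G}

theorem lam_apply (ξ : LieW G) : lam G ξ = (lieEquiv G ξ : Matrix (Fin n) (Fin n) ℂ) := rfl

theorem lam_mem (ξ : LieW G) : lam G ξ ∈ lieAlg G := (lieEquiv G ξ).2

theorem exists_lam_eq {ξ : Matrix (Fin n) (Fin n) ℂ} (h : ξ ∈ lieAlg G) : ∃ w, lam G w = ξ :=
  ⟨(lieEquiv G).symm ⟨ξ, h⟩, by simp [lam_apply]⟩

theorem lam_injective : Function.Injective (lam G) :=
  Subtype.val_injective.comp (lieEquiv G).injective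

theorem mem_horSub {x v : Hn n} : v ∈ horSub G x ↔ v ∈ horizontal G x := by
  refine ⟨fun h ξ => ?_, fun h ξ => h (lieEquiv G ξ)⟩
  obtain ⟨w, hw⟩ := exists_lam_eq ξ.2
  rw [← hw]
  exact h w

theorem horSub_le_tangentSub (x : Hn n) : horSub G x ≤ tangentSub G x := fun _ hv ξ a => (hv ξ).2 a

theorem mem_horSub_iff {x v : Hn n} : v ∈ horSub G x ↔ v ∈ tangentSub G x ∧ pairL G x v = 0 := by
  refine ⟨fun h => ⟨horSub_le_tangentSub x h, ?_⟩, fun h ξ => ⟨?_, fun a => h.1 ξ a⟩⟩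
  · ext η
    rw [pairL_apply, real_inner_comm]
    exact (h η).1
  · rw [real_inner_comm]
    exact DFunLike.congr_fun h.2 ξ

/-- The conditions defining the horizontal space say that v is orthogonal to the quaternionic span
of the orbit directions, and the complement of a quaternionic subspace is quaternionic. -/
theorem quat_mem_horSub {x v : Hn n} (a : Fin 3) (hv : v ∈ horSub G x) :
    quat a v ∈ horSub G x := by
  intro ξ
  refine ⟨?_, fun b => ?_⟩
  · rw [← neg_eq_zero, ← inner_quat_left]; exact (hv ξ).2 a
  · rw [← neg_eq_zero, ← inner_quat_left]
    rcases quat_comp (n := n) a b with rfl | ⟨e, r, h⟩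
    · rw [quat_quat, inner_neg_left, (hv ξ).1, neg_zero]
    · rw [h, inner_smul_left, (hv ξ).2 e, mul_zero]

section Skew

variable (hG : IsClosed (G : Set (Matrix.unitaryGroup (Fin n) ℂ)))

include hG

theorem inner_act_left (ξ : LieW G) (x y : Hn n) :
    inner ℝ (rep (lam G ξ) x) y
      = -inner ℝ x (rep (lam G ξ) y) := by
  rw [inner_rep_left, star_eq_neg_of_mem_lieAlg hG (lam_mem ξ), rep_neg]
  simp

theorem inner_act_self (ξ : LieW G) (x : Hn n) :
    inner ℝ x (rep (lam G ξ) x) = 0 := by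
  have h := inner_act_left hG ξ x x
  rw [real_inner_comm] at h
  linarith

end Skew

theorem rep_smul_apply (r : ℝ) (A : Matrix (Fin n) (Fin n) ℂ) (x : Hn n) :
    rep (r • A) x = r • rep A x := by
  rw [rep_real_smul]; rfl

/-- `A ↦ A x` as a real continuous linear map on matrices. -/
def repEval (x : Hn n) : Matrix (Fin n) (Fin n) ℂ →L[ℝ] Hn n :=
  LinearMap.toContinuousLinearMap
    { toFun := fun A => rep A x
      map_add' := fun A B => by simp [rep_add]
      map_smul' := fun r A => rep_smul_apply r A x }

@[simp] theorem repEval_apply (x : Hn n) (A : Matrix (Fin n) (Fin n) ℂ) :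
    repEval x A = rep A x := rfl

theorem hasDerivAt_exp_act (ξ : Matrix (Fin n) (Fin n) ℂ) (x : Hn n) (t : ℝ) :
    HasDerivAt (fun s : ℝ => rep (NormedSpace.exp (s • ξ)) x)
      (rep (NormedSpace.exp (t • ξ)) (rep ξ x)) t := by
  have := (repEval x).hasFDerivAt.comp_hasDerivAt t (hasDerivAt_matrix_exp ξ t)
  have h2 : repEval x (NormedSpace.exp (t • ξ) * ξ) = rep (NormedSpace.exp (t • ξ)) (rep ξ x) := by
    rw [repEval_apply, rep_mul]; rfl
  rw [← h2]
  exact this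

theorem hasDerivAt_exp_act_zero (ξ : Matrix (Fin n) (Fin n) ℂ) (x : Hn n) :
    HasDerivAt (fun s : ℝ => rep (NormedSpace.exp (s • ξ)) x) (rep ξ x) 0 := by
  have := hasDerivAt_exp_act ξ x 0
  rwa [zero_smul, NormedSpace.exp_zero, rep_one] at this

variable {c : lieAlg G →ₗ[ℝ] ℝ}

variable (c) in
/-- The functional `c` in coordinates. -/
def cW : StrongDual ℝ (LieW G) :=
  LinearMap.toContinuousLinearMap (c ∘ₗ (lieEquiv G).toLinearMap)

theorem cW_apply (ξ : LieW G) : cW c ξ = c (lieEquiv G ξ) := rfl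

theorem exists_gact_of_mem {A : Matrix (Fin n) (Fin n) ℂ} (hA : A ∈ matSet G) :
    ∃ g : G, ((g : Matrix.unitaryGroup (Fin n) ℂ) : Matrix (Fin n) (Fin n) ℂ) = A ∧
      ∀ x, gact G g x = rep A x := by
  obtain ⟨g, rfl⟩ := mem_matSet_iff.1 hA
  exact ⟨g, rfl, fun _ => rfl⟩

/-- A Lie algebra element which annihilates a point of the level set vanishes. -/
theorem act_injective (hG : IsClosed (G : Set (Matrix.unitaryGroup (Fin n) ℂ)))
    (hfree : ActsFreely G c) {x : Hn n} (hx : x ∈ levelSet G c) {ξ : LieW G}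
    (h : rep (lam G ξ) x = 0) : ξ = 0 := by
  have h1 : ∀ t : ℝ, rep (NormedSpace.exp (t • (lam G ξ))) x = x := by
    intro t
    have hd : ∀ t, HasDerivAt (fun s : ℝ =>
        rep (NormedSpace.exp (s • (lam G ξ))) x) 0 t := fun t => by
      simpa [h] using hasDerivAt_exp_act (lam G ξ) x t
    have := is_const_of_deriv_eq_zero (fun t => (hd t).differentiableAt)
      (fun t => (hd t).deriv) t 0
    simpa [rep_one] using this
  -- Freeness: the one-parameter group fixes x, so it is trivial, and so is its velocity.
  have h2 : ∀ t : ℝ, NormedSpace.exp (t • (lam G ξ)) = 1 := by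
    intro t
    obtain ⟨g, hg, hgx⟩ := exists_gact_of_mem (exp_mem_matSet hG ((lieAlg G).smul_mem t (lam_mem ξ)))
    have : g = 1 := hfree x hx g (by rw [hgx, h1])
    rw [← hg, this]; rfl
  have h3 := hasDerivAt_matrix_exp_zero (lam G ξ)
  simp only [h2] at h3
  exact lam_injective ((h3.unique (hasDerivAt_const _ _)).trans (map_zero _).symm)

theorem finrank_strongDual_lieAlg :
    Module.finrank ℝ (LieW G) = Module.finrank ℝ (StrongDual ℝ (LieW G)) := by
  rw [← Subspace.dual_finrank_eq]
  exact LinearEquiv.finrank_eq LinearMap.toContinuousLinearMap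

/-- On the diagonal the Gram form is |ξx|², which by freeness vanishes only for ξ = 0; equality of
dimensions does the rest. -/
theorem exists_gram_equiv (hG : IsClosed (G : Set (Matrix.unitaryGroup (Fin n) ℂ)))
    (hfree : ActsFreely G c) {x : Hn n} (hx : x ∈ levelSet G c) :
    ∃ e : LieW G ≃L[ℝ] StrongDual ℝ (LieW G), (e : LieW G →L[ℝ] _) = gram G x := by
  have hinj : Function.Injective (gram G x : LieW G →ₗ[ℝ] StrongDual ℝ (LieW G)) := by
    refine (injective_iff_map_eq_zero _).2 fun ξ hξ => ?_
    refine act_injective hG hfree hx ?_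
    have := DFunLike.congr_fun hξ ξ
    exact inner_self_eq_zero (𝕜 := ℝ).1 this
  refine ⟨(LinearMap.linearEquivOfInjective _ hinj
    finrank_strongDual_lieAlg).toContinuousLinearEquiv, ?_⟩
  ext ξ η
  rfl

section Theta

variable (hG : IsClosed (G : Set (Matrix.unitaryGroup (Fin n) ℂ)))
  (hfree : ActsFreely G c) {x : Hn n} (hx : x ∈ levelSet G c)

include hG hfree hx

theorem gram_theta (v : Hn n) : gram G x (theta G x v) = pairL G x v := by
  obtain ⟨e, he⟩ := exists_gram_equiv hG hfree hx
  rw [theta, ← he, ContinuousLinearMap.inverse_equiv]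
  simp

theorem pairL_sub_theta (v : Hn n) :
    pairL G x (v - rep (lam G (theta G x v)) x) = 0 := by
  rw [map_sub, sub_eq_zero, ← gram_theta hG hfree hx v]
  rfl

/-- Inversion of operators is smooth near an invertible one, so invertibility of the Gram form at x
makes θ smooth on a full neighbourhood in the ambient space, including points off the level set. -/
theorem contDiffAt_theta_uncurry (v : Hn n) :
    ContDiffAt ℝ ∞ (fun p : Hn n × Hn n => theta G p.1 p.2) (x, v) := by
  obtain ⟨e, he⟩ := exists_gram_equiv hG hfree hx
  have h1 : ContDiffAt ℝ ∞ (ContinuousLinearMap.inverse :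
      (LieW G →L[ℝ] StrongDual ℝ (LieW G)) → _) (gram G x) := by
    rw [← he]; exact contDiffAt_map_inverse e
  have h2 : ContDiffAt ℝ ∞ (fun p : Hn n × Hn n => (gram G p.1).inverse) (x, v) :=
    ContDiffAt.comp (x, v) (g := ContinuousLinearMap.inverse)
      (f := fun p : Hn n × Hn n => gram G p.1) h1
      ((contDiff_gram G).comp contDiff_fst).contDiffAt
  exact h2.clm_apply (((pairL G).contDiff.comp contDiff_fst).clm_apply contDiff_snd).contDiffAt

end Theta

theorem theta_add (x v w : Hn n) : theta G x (v + w) = theta G x v + theta G x w := by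
  simp [theta]

theorem theta_smul (x : Hn n) (r : ℝ) (v : Hn n) : theta G x (r • v) = r • theta G x v := by
  simp [theta]

/-- Moving g across the inner product replaces ξ by g*ξg, on which c takes the same value; this is
equivariance of the moment map. -/
theorem gact_mem_levelSet (hG : IsClosed (G : Set (Matrix.unitaryGroup (Fin n) ℂ)))
    (hc : IsCoadInvariant G c) (g : G) {x : Hn n} (hx : x ∈ levelSet G c) :
    gact G g x ∈ levelSet G c := by
  intro ξ
  set A : Matrix (Fin n) (Fin n) ℂ :=
    ((g : Matrix.unitaryGroup (Fin n) ℂ) : Matrix (Fin n) (Fin n) ℂ) with hAdef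
  have hA : A ∈ matSet G := coe_mem_matSet g
  have hmem := conj_mem_lieAlg hG (star_mem_matSet hA) ξ.2
  have hmm : ∀ a, momentMap a (ξ : Matrix (Fin n) (Fin n) ℂ) (gact G g x)
      = momentMap a (star A * (ξ : Matrix (Fin n) (Fin n) ℂ) * star (star A)) x := by
    intro a
    simp only [momentMap, flatForm]
    congr 1
    rw [star_star, rep_mul, rep_mul]
    change inner ℝ (quat a (rep _ (rep A x))) (rep A x)
      = inner ℝ (quat a (rep (star A) (rep _ (rep A x)))) x
    rw [quat_rep a (star A), inner_rep_left (star A), star_star]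
  obtain ⟨h0, h1, h2⟩ := hx ⟨_, hmem⟩
  rw [hmm, hmm, hmm]
  refine ⟨h0.trans (hc g⁻¹ ξ ⟨_, hmem⟩ rfl), h1, h2⟩

theorem rep_exp_mem_levelSet (hG : IsClosed (G : Set (Matrix.unitaryGroup (Fin n) ℂ)))
    (hc : IsCoadInvariant G c) {x : Hn n} (hx : x ∈ levelSet G c) (ξ : LieW G) :
    rep (NormedSpace.exp (lam G ξ)) x ∈ levelSet G c := by
  obtain ⟨g, -, hg⟩ := exists_gact_of_mem (exp_mem_matSet hG (lam_mem ξ))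
  rw [← hg]
  exact gact_mem_levelSet hG hc g hx

variable (G) in
/-- The three components of the moment map, with values in the dual of the Lie algebra. -/
def momentVec (x : Hn n) (a : Fin 3) : StrongDual ℝ (LieW G) :=
  -((1 / 2 : ℝ) • pairL G x (quatL a x))

variable (G) in
/-- The differential of the moment map. -/
def momentDeriv (x : Hn n) : Hn n →L[ℝ] (Fin 3 → StrongDual ℝ (LieW G)) :=
  ContinuousLinearMap.pi fun a => -((pairL G x).comp (quatL a))

theorem momentVec_apply (x : Hn n) (a : Fin 3) (ξ : LieW G) :
    momentVec G x a ξ = momentMap a (lam G ξ) x := by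
  change -((1 / 2 : ℝ) * inner ℝ (quat a x) (rep (lam G ξ) x))
    = inner ℝ (quat a (rep (lam G ξ) x)) x / 2
  rw [inner_quat_left a x, inner_quat_left a _ x, real_inner_comm,
    inner_quat_left]
  ring

theorem momentDeriv_apply (x v : Hn n) (a : Fin 3) (ξ : LieW G) :
    momentDeriv G x v a ξ = inner ℝ (quat a (rep (lam G ξ) x)) v := by
  change -inner ℝ (quat a v) (rep (lam G ξ) x) = _
  rw [inner_quat_left a v, real_inner_comm, neg_neg]

theorem mem_tangentSub_iff {x v : Hn n} : v ∈ tangentSub G x ↔ momentDeriv G x v = 0 := by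
  constructor
  · intro h; ext a ξ
    rw [momentDeriv_apply]; exact h ξ a
  · intro h ξ a
    rw [← momentDeriv_apply, h]; rfl

theorem mem_levelSet_iff {x : Hn n} : x ∈ levelSet G c ↔
    ∀ (a : Fin 3) (ξ : LieW G), momentVec G x a ξ = if a = 0 then cW c ξ else 0 := by
  simp only [momentVec_apply]
  constructor
  · intro h a ξ
    obtain ⟨h0, h1, h2⟩ := h (lieEquiv G ξ)
    rw [lam_apply, cW_apply]
    fin_cases a <;> simp [h0, h1, h2]
  · intro h ξ
    obtain ⟨w, rfl⟩ := (lieEquiv G).surjective ξ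
    exact ⟨h 0 w, h 1 w, h 2 w⟩

theorem mem_levelSet_of_momentVec_eq {x y : Hn n} (hx : x ∈ levelSet G c)
    (h : momentVec G y = momentVec G x) : y ∈ levelSet G c := by
  rw [mem_levelSet_iff] at hx ⊢
  rwa [h]

theorem momentVec_eq {x y : Hn n} (hx : x ∈ levelSet G c) (hy : y ∈ levelSet G c) :
    momentVec G y = momentVec G x := by
  ext a ξ
  rw [mem_levelSet_iff.1 hx, mem_levelSet_iff.1 hy]

/-- The moment map is quadratic, and the two terms of its derivative agree because ξ is skew and
commutes with the complex structures; this cancels the factor ½. -/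
theorem hasStrictFDerivAt_momentVec (hG : IsClosed (G : Set (Matrix.unitaryGroup (Fin n) ℂ)))
    (x : Hn n) : HasStrictFDerivAt (momentVec G) (momentDeriv G x) x := by
  have hcd : ContDiff ℝ ∞ (momentVec G) := by
    refine contDiff_pi.2 fun a => ?_
    exact (((pairL G).contDiff.clm_apply (quatL a).contDiff).const_smul (1 / 2 : ℝ)).neg
  have hd : HasFDerivAt (momentVec G) (momentDeriv G x) x := by
    refine hasFDerivAt_pi.2 fun a => ?_
    have h := (((pairL G).hasFDerivAt_of_bilinear (hasFDerivAt_id x)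
      ((quatL (n := n) a).hasFDerivAt (x := x))).const_smul (1 / 2 : ℝ)).neg
    refine h.congr_fderiv ?_
    ext v ξ
    change -((1 / 2 : ℝ) * (inner ℝ (quat a v) (rep (lam G ξ) x)
      + inner ℝ (quat a x) (rep (lam G ξ) v)))
      = -inner ℝ (quat a v) (rep (lam G ξ) x)
    have : inner ℝ (quat a x) (rep (lam G ξ) v)
        = inner ℝ (quat a v) (rep (lam G ξ) x) := by
      rw [inner_quat_left a x, quat_rep, ← inner_act_left hG, real_inner_comm]
    rw [this]; ring
  exact hcd.contDiffAt.hasStrictFDerivAt' hd (by simp)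

/-- Curves in the level set have tangent velocity. -/
theorem mem_tangentSub_of_curve (hG : IsClosed (G : Set (Matrix.unitaryGroup (Fin n) ℂ)))
    {y : ℝ → Hn n} {v : Hn n} {t : ℝ} (hL : ∀ᶠ s in 𝓝 t, y s ∈ levelSet G c)
    (hy : HasDerivAt y v t) : v ∈ tangentSub G (y t) := by
  rw [mem_tangentSub_iff]
  have h1 := (hasStrictFDerivAt_momentVec hG (y t)).hasFDerivAt.comp_hasDerivAt t hy
  refine h1.unique ((hasDerivAt_const t (momentVec G (y t))).congr_of_eventuallyEq ?_)
  filter_upwards [hL] with s hs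
  exact momentVec_eq hL.self_of_nhds hs

/-- The curve exp(tξ)x stays in the level set. Unfolding the tangent space, this says that the
orbits are isotropic for all three Kähler forms. -/
theorem act_mem_tangentSub (hG : IsClosed (G : Set (Matrix.unitaryGroup (Fin n) ℂ)))
    (hc : IsCoadInvariant G c) {x : Hn n} (hx : x ∈ levelSet G c) (ξ : LieW G) :
    rep (lam G ξ) x ∈ tangentSub G x := by
  have := mem_tangentSub_of_curve (c := c) hG (Eventually.of_forall fun t => ?_)
    (hasDerivAt_exp_act_zero (lam G ξ) x)
  · simpa [rep_one] using this
  · have := rep_exp_mem_levelSet hG hc hx (t • ξ)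
    rwa [map_smul] at this

theorem inner_quat_act_act (hG : IsClosed (G : Set (Matrix.unitaryGroup (Fin n) ℂ)))
    (hc : IsCoadInvariant G c) {x : Hn n} (hx : x ∈ levelSet G c) (a : Fin 3) (ξ η : LieW G) :
    inner ℝ (quat a (rep (lam G ξ) x))
      (rep (lam G η) x) = 0 :=
  act_mem_tangentSub hG hc hx η ξ a

theorem sub_theta_mem_horSub (hG : IsClosed (G : Set (Matrix.unitaryGroup (Fin n) ℂ)))
    (hc : IsCoadInvariant G c) (hfree : ActsFreely G c) {x v : Hn n} (hx : x ∈ levelSet G c)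
    (hv : v ∈ tangentSub G x) :
    v - rep (lam G (theta G x v)) x ∈ horSub G x :=
  mem_horSub_iff.2 ⟨(tangentSub G x).sub_mem hv (act_mem_tangentSub hG hc hx _),
    pairL_sub_theta hG hfree hx v⟩

/-- On vectors ∑ I_b ζ_b x the differential of ν is block diagonal, since distinct quaternionic
images of orbit directions are orthogonal, and each block is the Gram form. Hence ζ_b is found by
inverting the latter. -/
theorem momentDeriv_range (hG : IsClosed (G : Set (Matrix.unitaryGroup (Fin n) ℂ)))
    (hc : IsCoadInvariant G c) (hfree : ActsFreely G c) {x : Hn n} (hx : x ∈ levelSet G c) :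
    (momentDeriv G x : Hn n →ₗ[ℝ] (Fin 3 → StrongDual ℝ (LieW G))).range = ⊤ := by
  rw [LinearMap.range_eq_top]
  intro f
  obtain ⟨e, he⟩ := exists_gram_equiv hG hfree hx
  set ζ : Fin 3 → LieW G := fun a => e.symm (f a)
  have hζ : ∀ a, gram G x (ζ a) = f a := fun a => by rw [← he]; simp [ζ]
  refine ⟨∑ b, quat b (rep (lam G (ζ b)) x), ?_⟩
  ext a η
  change momentDeriv G x _ a η = _
  rw [momentDeriv_apply, inner_sum, Finset.sum_eq_single a]
  · rw [inner_quat_quat, ← hζ a, gram_apply, real_inner_comm]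
  · intro b _ hb
    rw [← neg_eq_zero, ← inner_quat_left]
    rcases quat_comp (n := n) b a with h | ⟨e, r, h⟩
    · exact absurd h hb
    · rw [h, inner_smul_left, inner_quat_act_act hG hc hx, mul_zero]
  · simp

/-- Every tangent vector of the level set is the velocity of a curve. -/
theorem exists_curve (hG : IsClosed (G : Set (Matrix.unitaryGroup (Fin n) ℂ)))
    (hc : IsCoadInvariant G c) (hfree : ActsFreely G c) {x v : Hn n} (hx : x ∈ levelSet G c)
    (hv : v ∈ tangentSub G x) :
    ∃ y : ℝ → Hn n, y 0 = x ∧ (∀ᶠ t in 𝓝 0, y t ∈ levelSet G c) ∧ HasDerivAt y v 0 := by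
  have hs := hasStrictFDerivAt_momentVec hG x
  have hr := momentDeriv_range hG hc hfree hx
  set w : (momentDeriv G x : Hn n →ₗ[ℝ] (Fin 3 → StrongDual ℝ (LieW G))).ker := ⟨v, mem_tangentSub_iff.1 hv⟩
  -- The fibre of ν through x is parametrised by ker dν; the required curve is the image of a line
  -- there.
  set f := hs.implicitFunction (momentVec G) (momentDeriv G x) hr (momentVec G x)
  have hcont : Tendsto (fun t : ℝ => t • w) (𝓝 0) (𝓝 0) := by
    have : Continuous fun t : ℝ => t • w := continuous_id.smul continuous_const
    simpa using this.tendsto 0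
  refine ⟨fun t => f (t • w), ?_, ?_, ?_⟩
  · simp only [zero_smul]
    exact hs.implicitFunction_apply_image hr
  · have h1 := hs.map_implicitFunction_eq hr
    have h2 : Tendsto (fun t : ℝ => (momentVec G x, t • w)) (𝓝 0) (𝓝 (momentVec G x, 0)) :=
      tendsto_const_nhds.prodMk_nhds hcont
    filter_upwards [h2.eventually h1] with t ht
    exact mem_levelSet_of_momentVec_eq hx ht
  · have h1 := (hs.to_implicitFunction hr).hasFDerivAt
    have h2 : HasDerivAt (fun t : ℝ => t • w) w 0 := by
      simpa using (hasDerivAt_id (0 : ℝ)).smul_const w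
    rw [show (0 : (momentDeriv G x : Hn n →ₗ[ℝ] (Fin 3 → StrongDual ℝ (LieW G))).ker) = (0 : ℝ) • w by simp] at h1
    exact h1.comp_hasDerivAt 0 h2

/-- The equation ν₁ = c as a pairing with Ix: this is how values of c arise from inner products with
orbit directions. -/
theorem inner_I_act {x : Hn n} (hx : x ∈ levelSet G c) (ξ : LieW G) :
    inner ℝ (quat 0 x) (rep (lam G ξ) x) = -2 * cW c ξ := by
  have h : inner ℝ (quat 0 (rep (lam G ξ) x)) x / 2 = cW c ξ := (hx (lieEquiv G ξ)).1
  rw [inner_quat_left, real_inner_comm] at h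
  linarith

/-- In c([ξ,η]) = ½ω₁([ξ,η]x, x) each of the two terms vanishes by itself: moving one factor to the
other side leaves ω₁ of two orbit directions. -/
theorem map_bracket (hG : IsClosed (G : Set (Matrix.unitaryGroup (Fin n) ℂ)))
    (hc : IsCoadInvariant G c) {x : Hn n} (hx : x ∈ levelSet G c) (ξ η ζ : LieW G)
    (hζ : lam G ζ = lam G ξ * lam G η - lam G η * lam G ξ) : cW c ζ = 0 := by
  have h : inner ℝ (quat 0 (rep (lam G ζ) x)) x / 2 = cW c ζ := (hx (lieEquiv G ζ)).1
  rw [← h, hζ, rep_sub, rep_mul, rep_mul]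
  change inner ℝ (quat 0 (rep (lam G ξ) (rep (lam G η) x) - rep (lam G η) (rep (lam G ξ) x))) x / 2
    = 0
  have key : ∀ ξ η : LieW G, inner ℝ (quat 0 (rep (lam G ξ) (rep (lam G η) x))) x = 0 := by
    intro ξ η
    rw [quat_rep, inner_act_left hG, inner_quat_act_act hG hc hx, neg_zero]
  rw [quat_sub, inner_sub_left, key, key]
  simp

end LevelSet

end

noncomputable section

/-! ### Slices transverse to the orbits. -/

section Slice

attribute [local instance] Matrix.linftyOpNormedRing Matrix.linftyOpNormedAlgebra

open Filter

variable {n : ℕ} {G : Subgroup (Matrix.unitaryGroup (Fin n) ℂ)} {c : lieAlg G →ₗ[ℝ] ℝ}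

/-- The action of matrices on `ℍⁿ` as a continuous bilinear map. -/
def repBil (n : ℕ) : Matrix (Fin n) (Fin n) ℂ →L[ℝ] Hn n →L[ℝ] Hn n :=
  LinearMap.toContinuousBilinearMap
    (LinearMap.mk₂ ℝ (fun (A : Matrix (Fin n) (Fin n) ℂ) (x : Hn n) => rep A x)
      (fun A B x => by simp [rep_add]) (fun r A x => rep_smul_apply r A x)
      (fun A x y => map_add _ _ _)
      (fun r A x => by exact map_smul ((rep A).restrictScalars ℝ) r x))

theorem continuous_rep_uncurry :
    Continuous fun p : Matrix (Fin n) (Fin n) ℂ × Hn n => rep p.1 p.2 :=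
  ((repBil n).continuous.comp continuous_fst).clm_apply continuous_snd

theorem tendsto_rep {ι : Type*} {l : Filter ι} {A : ι → Matrix (Fin n) (Fin n) ℂ} {p : ι → Hn n}
    {B : Matrix (Fin n) (Fin n) ℂ} {x : Hn n} (hA : Tendsto A l (𝓝 B)) (hp : Tendsto p l (𝓝 x)) :
    Tendsto (fun i => rep (A i) (p i)) l (𝓝 (rep B x)) := by
  have h1 := hA.prodMk_nhds hp
  have h2 := Tendsto.comp (continuous_rep_uncurry.tendsto (B, x)) h1
  exact h2

theorem contDiff_rep_exp :
    ContDiff ℝ ∞ fun p : LieW G × Hn n => rep (NormedSpace.exp (lam G p.1)) p.2 :=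
  ((repBil n).contDiff.comp (contDiff_matrix_exp.comp
    ((lam G).contDiff.comp contDiff_fst))).clm_apply contDiff_snd

theorem tendsto_exp_lam :
    Tendsto (fun ξ : LieW G => NormedSpace.exp (lam G ξ)) (𝓝 0) (𝓝 1) := by
  have h : Continuous fun ξ : LieW G => NormedSpace.exp (lam G ξ) :=
    contDiff_matrix_exp.continuous.comp (lam G).continuous
  simpa using h.tendsto 0

theorem rep_exp_rep_exp_neg (A : Matrix (Fin n) (Fin n) ℂ) (x : Hn n) :
    rep (NormedSpace.exp A) (rep (NormedSpace.exp (-A)) x) = x := by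
  rw [← mul_apply_eq_comp, ← rep_mul, exp_mul_exp_neg, rep_one]; rfl

/-- Elements of `G` close to `1` which move a point close to `x` orthogonally to the orbit of `x`
are trivial. -/
theorem eventually_eq_one_of_pairL_eq_zero
    (hG : IsClosed (G : Set (Matrix.unitaryGroup (Fin n) ℂ)))
    (hfree : ActsFreely G c) {x : Hn n} (hx : x ∈ levelSet G c) :
    ∀ᶠ q in 𝓝[matSet G] (1 : Matrix (Fin n) (Fin n) ℂ) ×ˢ 𝓝 x,
      pairL G x (rep q.1 q.2 - q.2) = 0 → q.1 = 1 := by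
  by_contra hcon
  rw [not_eventually] at hcon
  have hmem : ∀ᶠ q in 𝓝[matSet G] (1 : Matrix (Fin n) (Fin n) ℂ) ×ˢ 𝓝 x, q.1 ∈ matSet G :=
    tendsto_fst.eventually self_mem_nhdsWithin
  have : FirstCountableTopology (Matrix (Fin n) (Fin n) ℂ) :=
    inferInstanceAs (FirstCountableTopology (Fin n → Fin n → ℂ))
  obtain ⟨u, hu, hup⟩ := exists_seq_forall_of_frequently (hmem.and_frequently hcon)
  simp only [Classical.not_imp] at hup
  have hk : Tendsto (fun i => (u i).1) atTop (𝓝 1) :=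
    (tendsto_fst.comp hu).mono_right nhdsWithin_le_nhds
  have hp : Tendsto (fun i => (u i).2) atTop (𝓝 x) := tendsto_snd.comp hu
  have hpos : ∀ i, 0 < ‖(u i).1 - 1‖ := fun i => norm_pos_iff.2 (sub_ne_zero.2 (hup i).2.2)
  have hr : Tendsto (fun i => ‖(u i).1 - 1‖⁻¹) atTop atTop := by
    refine Tendsto.inv_tendsto_nhdsGT_zero (tendsto_nhdsWithin_iff.2 ⟨?_, ?_⟩)
    · simpa using (hk.sub_const 1).norm
    · exact Eventually.of_forall hpos
  have : FiniteDimensional ℝ (Matrix (Fin n) (Fin n) ℂ) := inferInstance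
  have : ProperSpace (Matrix (Fin n) (Fin n) ℂ) := FiniteDimensional.proper_real _
  have hsph : ∀ i, ‖(u i).1 - 1‖⁻¹ • ((u i).1 - 1) ∈
      Metric.sphere (0 : Matrix (Fin n) (Fin n) ℂ) 1 := by
    intro i
    rw [mem_sphere_zero_iff_norm, norm_smul, norm_inv, norm_norm, inv_mul_cancel₀ (hpos i).ne']
  -- Blow up at 1: the normalised differences converge to a unit vector ζ, which is in the Lie
  -- algebra by the closed subgroup argument. The hypothesis passes to the limit and makes ζx
  -- orthogonal to the orbit, so ζx = 0 and ζ = 0, a contradiction.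
  obtain ⟨ζ, hζ, φ, hφ, hlim⟩ := (isCompact_sphere (0 : Matrix (Fin n) (Fin n) ℂ) 1).tendsto_subseq hsph
  have hmemζ : ζ ∈ lieAlg G := mem_lieAlg_of_exp_mem fun t =>
    exp_mem_matSet_of_tendsto hG (fun i => (hup (φ i)).1) (hr.comp hφ.tendsto_atTop) hlim t
  obtain ⟨w, rfl⟩ := exists_lam_eq hmemζ
  have h0 : ∀ i, pairL G x (rep (‖(u i).1 - 1‖⁻¹ • ((u i).1 - 1)) (u i).2) = 0 := by
    intro i
    rw [rep_smul_apply, rep_sub, rep_one, map_smul]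
    have := (hup i).2.1
    change _ • pairL G x (rep (u i).1 (u i).2 - (u i).2) = 0
    rw [this, smul_zero]
  have h1 : Tendsto (fun i => pairL G x (rep (‖(u (φ i)).1 - 1‖⁻¹ • ((u (φ i)).1 - 1)) (u (φ i)).2))
      atTop (𝓝 (pairL G x (rep (lam G w) x))) :=
    ((pairL G x).continuous.tendsto _).comp (tendsto_rep hlim (hp.comp hφ.tendsto_atTop))
  simp only [h0] at h1
  have h2 := tendsto_nhds_unique h1 tendsto_const_nhds
  have h3 : rep (lam G w) x = 0 := inner_self_eq_zero (𝕜 := ℝ).1 (DFunLike.congr_fun h2 w)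
  have h4 := act_injective hG hfree hx h3
  rw [h4, map_zero] at hζ
  simp at hζ

theorem hasFDerivAt_rep_exp (x : Hn n) :
    HasFDerivAt (fun p : LieW G × Hn n => rep (NormedSpace.exp (lam G p.1)) p.2)
      (((act G).flip x).comp (ContinuousLinearMap.fst ℝ (LieW G) (Hn n))
        + ContinuousLinearMap.snd ℝ (LieW G) (Hn n)) (0, x) := by
  have h0 : lam G (0 : LieW G) = 0 := map_zero _
  have h1 : HasFDerivAt (fun p : LieW G × Hn n => NormedSpace.exp (lam G p.1))
      ((lam G).comp (ContinuousLinearMap.fst ℝ (LieW G) (Hn n))) (0, x) := by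
    have h2 := ((lam G).comp (ContinuousLinearMap.fst ℝ (LieW G) (Hn n))).hasFDerivAt
      (x := ((0 : LieW G), x))
    have h3 : HasFDerivAt (NormedSpace.exp : Matrix (Fin n) (Fin n) ℂ → _)
        (1 : Matrix (Fin n) (Fin n) ℂ →L[ℝ] Matrix (Fin n) (Fin n) ℂ)
        (((lam G).comp (ContinuousLinearMap.fst ℝ (LieW G) (Hn n))) (0, x)) := by
      rw [ContinuousLinearMap.comp_apply, ContinuousLinearMap.coe_fst', h0]
      exact hasStrictFDerivAt_exp_zero.hasFDerivAt
    exact h3.comp ((0 : LieW G), x) h2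
  have h2 := (repBil n).hasFDerivAt_of_bilinear h1
    (hasFDerivAt_snd (𝕜 := ℝ) (p := ((0 : LieW G), x)))
  refine h2.congr_fderiv ?_
  refine ContinuousLinearMap.ext fun p => ?_
  change rep (NormedSpace.exp (lam G (0 : LieW G))) p.2 + rep (lam G p.1) x
    = rep (lam G p.1) x + p.2
  rw [h0, NormedSpace.exp_zero, rep_one, add_comm]
  rfl

/-- Points near `x` can be moved by small elements of the Lie algebra so that the displacement
from a given point is orthogonal to the orbit, smoothly in both points. -/
theorem exists_slice_function (hG : IsClosed (G : Set (Matrix.unitaryGroup (Fin n) ℂ)))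
    (hfree : ActsFreely G c) {x : Hn n} (hx : x ∈ levelSet G c) :
    ∃ Ξ : Hn n × Hn n → LieW G, ContDiffAt ℝ ∞ Ξ (x, x) ∧ Ξ (x, x) = 0 ∧
      ∀ᶠ q in 𝓝 (x, x), pairL G x (rep (NormedSpace.exp (-(lam G (Ξ q)))) q.1 - q.2) = 0 := by
  obtain ⟨e, he⟩ := exists_gram_equiv hG hfree hx
  have hes : ∀ ξ, e ξ = gram G x ξ := fun ξ => by rw [← he]; rfl
  let P := pairL G x
  -- The inverse function theorem is applied to Ψ, whose derivative at (0, x) is block triangular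
  -- with the Gram form as diagonal block.
  let Ψ : LieW G × Hn n → StrongDual ℝ (LieW G) × Hn n :=
    fun p => (P (rep (NormedSpace.exp (lam G p.1)) p.2), p.2)
  have hΨs : ContDiff ℝ ∞ Ψ :=
    ContDiff.prodMk (P.contDiff.comp (contDiff_rep_exp (G := G))) contDiff_snd
  let f₁ : LieW G × Hn n →L[ℝ] StrongDual ℝ (LieW G) × Hn n :=
    ((e : LieW G →L[ℝ] StrongDual ℝ (LieW G)).comp (ContinuousLinearMap.fst ℝ (LieW G) (Hn n))
      + P.comp (ContinuousLinearMap.snd ℝ (LieW G) (Hn n))).prod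
      (ContinuousLinearMap.snd ℝ (LieW G) (Hn n))
  let f₂ : StrongDual ℝ (LieW G) × Hn n →L[ℝ] LieW G × Hn n :=
    ((e.symm : StrongDual ℝ (LieW G) →L[ℝ] LieW G).comp
      (ContinuousLinearMap.fst ℝ (StrongDual ℝ (LieW G)) (Hn n)
        - P.comp (ContinuousLinearMap.snd ℝ (StrongDual ℝ (LieW G)) (Hn n)))).prod
      (ContinuousLinearMap.snd ℝ (StrongDual ℝ (LieW G)) (Hn n))
  have h12 : Function.LeftInverse f₂ f₁ := fun p => by
    change (e.symm (e p.1 + P p.2 - P p.2), p.2) = p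
    rw [add_sub_cancel_right, e.symm_apply_apply]
  have h21 : Function.RightInverse f₂ f₁ := fun p => by
    change (e (e.symm (p.1 - P p.2)) + P p.2, p.2) = p
    rw [e.apply_symm_apply, sub_add_cancel]
  let E : (LieW G × Hn n) ≃L[ℝ] (StrongDual ℝ (LieW G) × Hn n) :=
    ContinuousLinearEquiv.equivOfInverse f₁ f₂ h12 h21
  have hd : HasFDerivAt Ψ (E : (LieW G × Hn n) →L[ℝ] (StrongDual ℝ (LieW G) × Hn n)) (0, x) := by
    have h3 := (P.hasFDerivAt.comp ((0 : LieW G), x) (hasFDerivAt_rep_exp (G := G) x)).prodMk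
      (hasFDerivAt_snd (𝕜 := ℝ) (p := ((0 : LieW G), x)))
    refine h3.congr_fderiv ?_
    refine ContinuousLinearMap.ext fun p => ?_
    change (P (rep (lam G p.1) x + p.2), p.2) = (e p.1 + P p.2, p.2)
    rw [map_add, hes]
    rfl
  have hs : ContDiffAt ℝ ∞ Ψ (0, x) := hΨs.contDiffAt
  have hn : (∞ : WithTop ℕ∞) ≠ 0 := by simp
  have hΨ0 : Ψ (0, x) = (P x, x) := by
    simp only [Ψ, map_zero, NormedSpace.exp_zero, rep_one]; rfl
  obtain ⟨inv, hinv, hinv0, hright⟩ : ∃ inv : StrongDual ℝ (LieW G) × Hn n → LieW G × Hn n,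
      ContDiffAt ℝ ∞ inv (P x, x) ∧ inv (P x, x) = (0, x) ∧
        ∀ᶠ q in 𝓝 (P x, x), Ψ (inv q) = q := by
    rw [← hΨ0]
    exact ⟨hs.localInverse hd hn, hs.to_localInverse hd hn, hs.localInverse_apply_image hd hn,
      (hs.hasStrictFDerivAt' hd hn).eventually_right_inverse⟩
  have hpair : ContDiff ℝ ∞ fun q : Hn n × Hn n => (P q.2, q.1) :=
    (P.contDiff.comp contDiff_snd).prodMk contDiff_fst
  -- The target (P q₂, q₁) asks for a group element moving q₁ to a point with the same orbit pairing
  -- as q₂. The sign turns this into the form y = exp(Ξ)·(slice point) used later.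
  refine ⟨fun q => -(inv (P q.2, q.1)).1, ?_, ?_, ?_⟩
  · have := ContDiffAt.comp (x, x) (g := inv) (f := fun q : Hn n × Hn n => (P q.2, q.1))
      hinv hpair.contDiffAt
    exact (contDiff_fst.contDiffAt.comp (x, x) this).neg
  · change -(inv (P x, x)).1 = 0
    rw [hinv0, neg_zero]
  · have hc := hpair.continuous.tendsto (x, x)
    filter_upwards [hc.eventually hright] with q hq
    have h1 : P (rep (NormedSpace.exp (lam G (inv (P q.2, q.1)).1)) (inv (P q.2, q.1)).2) = P q.2 :=
      congrArg Prod.fst hq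
    have h2 : (inv (P q.2, q.1)).2 = q.1 := congrArg Prod.snd hq
    rw [h2] at h1
    rw [map_neg, neg_neg, map_sub]
    exact sub_eq_zero.2 h1

end Slice

/-! ### Compactness of the group. -/

section Compactness

open Filter

variable {n : ℕ} {G : Subgroup (Matrix.unitaryGroup (Fin n) ℂ)} {c : lieAlg G →ₗ[ℝ] ℝ}

/-- Elements of `G` carrying points close to `x` to points close to `x` are close to `1`. -/
theorem tendsto_one_of_rep_eq (hG : IsClosed (G : Set (Matrix.unitaryGroup (Fin n) ℂ)))
    (hfree : ActsFreely G c) {x : Hn n} (hx : x ∈ levelSet G c) {ι : Type*} {l : Filter ι}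
    {A : ι → Matrix (Fin n) (Fin n) ℂ} {p q : ι → Hn n} (hA : ∀ᶠ i in l, A i ∈ matSet G)
    (hp : Tendsto p l (𝓝 x)) (hq : Tendsto q l (𝓝 x)) (h : ∀ᶠ i in l, rep (A i) (p i) = q i) :
    Tendsto A l (𝓝 1) := by
  -- Any cluster point B of the A i lies in G and satisfies Bx = x, hence is 1; by compactness,
  -- uniqueness of the cluster point is convergence.
  refine (isCompact_matSet hG).tendsto_nhds_of_unique_mapClusterPt hA fun B hB hcl => ?_
  obtain ⟨U, hU, hUB⟩ := mapClusterPt_iff_ultrafilter.1 hcl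
  have h1 : Tendsto (fun i => rep (A i) (p i)) U (𝓝 (rep B x)) :=
    tendsto_rep hUB (hp.mono_left hU)
  have h2 : Tendsto (fun i => rep (A i) (p i)) U (𝓝 x) :=
    (hq.mono_left hU).congr' ((h.filter_mono hU).mono fun i hi => hi.symm)
  have h3 := tendsto_nhds_unique h1 h2
  obtain ⟨g, hg, hgx⟩ := exists_gact_of_mem hB
  have : g = 1 := hfree x hx g (by rw [hgx, h3])
  rw [← hg, this]; rfl

end Compactness

end

noncomputable section

/-! ### Velocities of curves in manifolds. -/

section Curves

open Filter

variable {d : ℕ} {M : Type} [TopologicalSpace M] [ChartedSpace (EuclideanSpace ℝ (Fin d)) M]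

/-- The curve `γ` passes through `m` at time `0`, with velocity `v` in the chart at `m`. -/
def HasVelocity (d : ℕ) {M : Type} [TopologicalSpace M]
    [ChartedSpace (EuclideanSpace ℝ (Fin d)) M] (γ : ℝ → M) (m : M)
    (v : EuclideanSpace ℝ (Fin d)) : Prop :=
  γ 0 = m ∧ ContinuousAt γ 0 ∧ HasDerivAt (fun t => extChartAt (𝓡 d) m (γ t)) v 0

theorem HasVelocity.unique {γ : ℝ → M} {m : M} {v w : EuclideanSpace ℝ (Fin d)}
    (h : HasVelocity d γ m v) (k : HasVelocity d γ m w) : v = w := h.2.2.unique k.2.2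

theorem HasVelocity.congr {γ δ : ℝ → M} {m : M} {v : EuclideanSpace ℝ (Fin d)}
    (h : HasVelocity d γ m v) (hδ : δ =ᶠ[𝓝 0] γ) : HasVelocity d δ m v :=
  ⟨hδ.self_of_nhds.trans h.1, h.2.1.congr hδ.symm, h.2.2.congr_of_eventuallyEq
    (hδ.mono fun t ht => by simp only [ht])⟩

theorem hasVelocity_const (m : M) : HasVelocity d (fun _ => m) m 0 :=
  ⟨rfl, continuousAt_const, hasDerivAt_const _ _⟩

theorem HasVelocity.hasMFDerivAt {γ : ℝ → M} {m : M} {v : EuclideanSpace ℝ (Fin d)}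
    (h : HasVelocity d γ m v) : HasMFDerivAt 𝓘(ℝ, ℝ) (𝓡 d) γ 0
      ((ContinuousLinearMap.toSpanSingleton ℝ v : ℝ →L[ℝ] EuclideanSpace ℝ (Fin d))) := by
  obtain ⟨rfl, h1, h2⟩ := h
  refine ⟨h1, ?_⟩
  simp only [writtenInExtChartAt, extChartAt_model_space_eq_id, PartialEquiv.refl_symm,
    PartialEquiv.refl_coe, modelWithCornersSelf_coe, Set.range_id,
    Function.comp_id, id]
  exact h2.hasFDerivAt.hasFDerivWithinAt

theorem HasMFDerivAt.hasVelocity {γ : ℝ → M} {L : TangentSpace 𝓘(ℝ, ℝ) (0 : ℝ) →L[ℝ] TangentSpace (𝓡 d) (γ 0)}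
    (h : HasMFDerivAt 𝓘(ℝ, ℝ) (𝓡 d) γ 0 L) : HasVelocity d γ (γ 0) (L (1 : ℝ)) := by
  refine ⟨rfl, h.1, ?_⟩
  have h2 := h.2
  simp only [writtenInExtChartAt, extChartAt_model_space_eq_id, PartialEquiv.refl_symm,
    PartialEquiv.refl_coe, modelWithCornersSelf_coe, Set.range_id,
    Function.comp_id, id] at h2
  have h3 : HasFDerivWithinAt (fun t => extChartAt (𝓡 d) (γ 0) (γ t))
      (show ℝ →L[ℝ] EuclideanSpace ℝ (Fin d) from L) Set.univ 0 := h2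
  exact (h3.hasFDerivAt univ_mem).hasDerivAt

theorem HasVelocity.mfderiv_eq {γ : ℝ → M} {v : EuclideanSpace ℝ (Fin d)}
    (h : HasVelocity d γ (γ 0) v) : mfderiv 𝓘(ℝ, ℝ) (𝓡 d) γ 0 (1 : ℝ) = v := by
  rw [h.hasMFDerivAt.mfderiv]
  exact one_smul ℝ v

theorem HasVelocity.comp {d' : ℕ} {M' : Type} [TopologicalSpace M']
    [ChartedSpace (EuclideanSpace ℝ (Fin d')) M'] {γ : ℝ → M} {m : M}
    {v : EuclideanSpace ℝ (Fin d)} (h : HasVelocity d γ m v) {f : M → M'}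
    (hf : MDifferentiableAt (𝓡 d) (𝓡 d') f m) :
    HasVelocity d' (fun t => f (γ t)) (f m) (mfderiv (𝓡 d) (𝓡 d') f m v) := by
  obtain ⟨rfl, -⟩ := id h
  have h1 := hf.hasMFDerivAt.comp (0 : ℝ) h.hasMFDerivAt
  have h2 := HasMFDerivAt.hasVelocity h1
  refine (congrArg (HasVelocity d' (fun t => f (γ t)) (f (γ 0))) ?_).mp h2
  exact congrArg (mfderiv (𝓡 d) (𝓡 d') f (γ 0)) (one_smul ℝ v)

theorem HasVelocity.hasDerivAt_comp {F : Type*} [NormedAddCommGroup F] [NormedSpace ℝ F]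
    {γ : ℝ → M} {m : M} {v : EuclideanSpace ℝ (Fin d)} (h : HasVelocity d γ m v) {f : M → F}
    (hf : MDifferentiableAt (𝓡 d) 𝓘(ℝ, F) f m) :
    HasDerivAt (fun t => f (γ t)) (mfderiv (𝓡 d) 𝓘(ℝ, F) f m v) 0 := by
  obtain ⟨rfl, -⟩ := id h
  have h1 := hf.hasMFDerivAt.comp (0 : ℝ) h.hasMFDerivAt
  have h2 : HasFDerivAt (fun t => f (γ t))
      ((show EuclideanSpace ℝ (Fin d) →L[ℝ] F from mfderiv (𝓡 d) 𝓘(ℝ, F) f (γ 0)).comp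
        (ContinuousLinearMap.toSpanSingleton ℝ v)) 0 := hasMFDerivAt_iff_hasFDerivAt.1 h1
  have h3 := h2.hasDerivAt
  rw [ContinuousLinearMap.comp_apply, ContinuousLinearMap.toSpanSingleton_apply, one_smul] at h3
  exact h3

/-- A derivative within a thin set is a choice, but its value on the velocity of a curve staying in
the set is forced. This makes the differential of the projection meaningful on tangent vectors of
the level set. -/
theorem hasVelocity_of_mfderivWithin {F : Type*} [NormedAddCommGroup F] [NormedSpace ℝ F]
    {f : F → M} {s : Set F} {y : ℝ → F} {v : F} (hs : ∀ᶠ t in 𝓝 (0 : ℝ), y t ∈ s)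
    (hy : HasDerivAt y v 0) (hf : MDifferentiableWithinAt 𝓘(ℝ, F) (𝓡 d) f s (y 0)) :
    HasVelocity d (fun t => f (y t)) (f (y 0)) (mfderivWithin 𝓘(ℝ, F) (𝓡 d) f s (y 0) v) := by
  have h1 : HasMFDerivWithinAt 𝓘(ℝ, ℝ) 𝓘(ℝ, F) y (y ⁻¹' s) 0 _ :=
    (hy.hasFDerivAt.hasMFDerivAt).hasMFDerivWithinAt
  have h2 := hf.hasMFDerivWithinAt.comp (0 : ℝ) h1 subset_rfl
  have h3 := HasMFDerivAt.hasVelocity (h2.hasMFDerivAt hs)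
  refine (congrArg (HasVelocity d (fun t => f (y t)) (f (y 0))) ?_).mp h3
  exact congrArg (mfderivWithin 𝓘(ℝ, F) (𝓡 d) f s (y 0)) (one_smul ℝ v)

theorem exists_hasVelocity (m : M) (v : EuclideanSpace ℝ (Fin d)) :
    ∃ γ : ℝ → M, HasVelocity d γ m v := by
  have hy : HasDerivAt (fun t : ℝ => extChartAt (𝓡 d) m m + t • v) v 0 := by
    simpa using ((hasDerivAt_id (0 : ℝ)).smul_const v).const_add (extChartAt (𝓡 d) m m)
  have hcont : Tendsto (fun t : ℝ => extChartAt (𝓡 d) m m + t • v) (𝓝 0)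
      (𝓝 (extChartAt (𝓡 d) m m)) := by simpa using hy.continuousAt.tendsto
  have h0 : (extChartAt (𝓡 d) m).symm (extChartAt (𝓡 d) m m + (0 : ℝ) • v) = m := by simp
  refine ⟨fun t => (extChartAt (𝓡 d) m).symm (extChartAt (𝓡 d) m m + t • v), h0, ?_, ?_⟩
  · have h1 := (continuousAt_extChartAt_symm (I := 𝓡 d) m).tendsto.comp hcont
    rw [extChartAt_to_inv] at h1
    change Tendsto _ _ (𝓝 ((extChartAt (𝓡 d) m).symm (extChartAt (𝓡 d) m m + (0 : ℝ) • v)))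
    rw [h0]
    exact h1
  · refine hy.congr_of_eventuallyEq ?_
    filter_upwards [hcont.eventually (extChartAt_target_mem_nhds (I := 𝓡 d) m)] with t ht
    exact (extChartAt (𝓡 d) m).right_inv ht

end Curves

/-! ### Curves in the level set and symmetries of the horizontal spaces. -/

section Quotient

open Filter

variable {n : ℕ} {G : Subgroup (Matrix.unitaryGroup (Fin n) ℂ)} {c : lieAlg G →ₗ[ℝ] ℝ}

theorem projExt_of_mem (x : levelSet G c) {y : Hn n} (hy : y ∈ levelSet G c) :
    projExt G c x y = proj G c ⟨y, hy⟩ := dif_pos hy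

theorem projExt_self (x : levelSet G c) : projExt G c x x = proj G c x := projExt_of_mem x x.2

theorem proj_eq_iff {x y : levelSet G c} :
    proj G c x = proj G c y ↔ ∃ g : G, gact G g x = y :=
  ⟨fun h => Quotient.exact h, fun h => Quotient.sound h⟩

theorem continuous_proj : Continuous (proj G c) := continuous_quotient_mk'

/-- The curve `y` in the level set passes through `x` with velocity `v`. -/
def LevelCurve (c : lieAlg G →ₗ[ℝ] ℝ) (y : ℝ → Hn n) (x v : Hn n) : Prop :=
  y 0 = x ∧ (∀ᶠ t in 𝓝 0, y t ∈ levelSet G c) ∧ HasDerivAt y v 0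

theorem LevelCurve.mem {y : ℝ → Hn n} {x v : Hn n} (h : LevelCurve c y x v) :
    x ∈ levelSet G c := h.1 ▸ h.2.1.self_of_nhds

theorem LevelCurve.mem_tangentSub (hG : IsClosed (G : Set (Matrix.unitaryGroup (Fin n) ℂ)))
    {y : ℝ → Hn n} {x v : Hn n} (h : LevelCurve c y x v) : v ∈ tangentSub G x := by
  rw [← h.1]
  exact mem_tangentSub_of_curve hG h.2.1 h.2.2

theorem hasDerivAt_gact {y : ℝ → Hn n} {v : Hn n} {t : ℝ} (g : G) (h : HasDerivAt y v t) :
    HasDerivAt (fun s => gact G g (y s)) (gact G g v) t :=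
  ((rep ((g : Matrix.unitaryGroup (Fin n) ℂ) : Matrix (Fin n) (Fin n) ℂ)).restrictScalars
    ℝ).hasFDerivAt.comp_hasDerivAt t h

theorem LevelCurve.gact (hG : IsClosed (G : Set (Matrix.unitaryGroup (Fin n) ℂ)))
    (hc : IsCoadInvariant G c) {y : ℝ → Hn n} {x v : Hn n} (h : LevelCurve c y x v) (g : G) :
    LevelCurve c (fun t => gact G g (y t)) (gact G g x) (gact G g v) :=
  ⟨by simp only [h.1], h.2.1.mono fun _ ht => gact_mem_levelSet hG hc g ht,
    hasDerivAt_gact g h.2.2⟩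

theorem LevelCurve.circle_smul {y : ℝ → Hn n} {x v : Hn n} (h : LevelCurve c y x v) (t : Circle) :
    LevelCurve c (fun s => (t : ℂ) • y s) ((t : ℂ) • x) ((t : ℂ) • v) :=
  ⟨by simp only [h.1], h.2.1.mono fun _ ht => smul_mem_levelSet G c t ht, by
    have h1 := ((((t : ℂ) • ContinuousLinearMap.id ℂ (Hn n)).restrictScalars ℝ).hasFDerivAt
      (x := y 0)).comp_hasDerivAt (0 : ℝ) h.2.2
    exact h1⟩

theorem inner_gact (g : G) (x y : Hn n) : inner ℝ (gact G g x) (gact G g y) = inner ℝ x y :=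
  inner_rep_unitary (g : Matrix.unitaryGroup (Fin n) ℂ).2 x y

theorem quat_gact (a : Fin 3) (g : G) (x : Hn n) : quat a (gact G g x) = gact G g (quat a x) :=
  quat_rep a _ x

/-- Conjugation by g permutes the Lie algebra, so g carries orbit directions at x to orbit
directions at gx. -/
theorem gact_mem_horSub (hG : IsClosed (G : Set (Matrix.unitaryGroup (Fin n) ℂ))) (g : G)
    {x v : Hn n} (hv : v ∈ horSub G x) : gact G g v ∈ horSub G (gact G g x) := by
  set A : Matrix (Fin n) (Fin n) ℂ :=
    ((g : Matrix.unitaryGroup (Fin n) ℂ) : Matrix (Fin n) (Fin n) ℂ) with hAdef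
  have hA : A ∈ matSet G := coe_mem_matSet g
  intro ξ
  obtain ⟨η, hη⟩ := exists_lam_eq (conj_mem_lieAlg hG (star_mem_matSet hA) (lam_mem ξ))
  have key : rep (lam G ξ) (gact G g x) = gact G g (rep (lam G η) x) := by
    change rep (lam G ξ) (rep A x) = rep A (rep (lam G η) x)
    rw [← mul_apply_eq_comp, ← mul_apply_eq_comp, ← rep_mul, ← rep_mul, hη, star_star,
      ← mul_assoc, ← mul_assoc, Matrix.mem_unitaryGroup_iff.1 (unitary_of_mem_matSet hA), one_mul]
  rw [key]
  refine ⟨by rw [inner_gact]; exact (hv η).1, fun a => ?_⟩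
  rw [quat_gact, inner_gact]
  exact (hv η).2 a

/-- The rotation mixes ω₂ and ω₃, so their vanishing is transported jointly, through the complex
form ω₂ + iω₃. -/
theorem circle_smul_mem_horSub (t : Circle) {x v : Hn n} (hv : v ∈ horSub G x) :
    (t : ℂ) • v ∈ horSub G ((t : ℂ) • x) := by
  intro ξ
  rw [map_smul]
  refine ⟨by rw [inner_circle_smul]; exact (hv ξ).1, fun a => ?_⟩
  have key : ((flatForm 1 (rep (lam G ξ) x) v : ℝ) : ℂ) + Complex.I * flatForm 2 (rep (lam G ξ) x) v
      = 0 := by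
    have h1 : flatForm 1 (rep (lam G ξ) x) v = 0 := (hv ξ).2 1
    have h2 : flatForm 2 (rep (lam G ξ) x) v = 0 := (hv ξ).2 2
    rw [h1, h2]; simp
  have key2 := flatForm_cplx_smul t (rep (lam G ξ) x) v
  rw [key, mul_zero] at key2
  have h1 := congrArg Complex.re key2
  have h2 := congrArg Complex.im key2
  simp only [Complex.add_re, Complex.mul_re, Complex.I_re, Complex.I_im, Complex.ofReal_re,
    Complex.ofReal_im, Complex.add_im, Complex.mul_im, Complex.zero_re, Complex.zero_im] at h1 h2
  fin_cases a
  · change inner ℝ (quat 0 ((t : ℂ) • rep (lam G ξ) x)) ((t : ℂ) • v) = 0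
    rw [quat_zero_circle_smul, inner_circle_smul]
    exact (hv ξ).2 0
  · change flatForm 1 _ _ = 0
    linarith
  · change flatForm 2 _ _ = 0
    linarith

end Quotient

end

noncomputable section

/-! ### Projection to the quotient and local product structure of the level set. -/

section Reduction

open Filter

variable {n : ℕ} {G : Subgroup (Matrix.unitaryGroup (Fin n) ℂ)} {c : lieAlg G →ₗ[ℝ] ℝ} {d : ℕ}
  [ChartedSpace (EuclideanSpace ℝ (Fin d)) (HKQuotient G c)]

variable (G c d) in
/-- The assumptions under which the hyperkähler quotient is a manifold. -/
structure SmoothReduction : Prop where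
  closed : IsClosed (G : Set (Matrix.unitaryGroup (Fin n) ℂ))
  invariant : IsCoadInvariant G c
  free : ActsFreely G c
  smooth : IsSmoothQuotient G c d

/-- A smooth local section of the projection to the quotient. -/
structure IsLocSec (V : Set (HKQuotient G c)) (σ : HKQuotient G c → Hn n) : Prop where
  isOpen : IsOpen V
  smooth : ContMDiffOn (𝓡 d) 𝓘(ℝ, Hn n) ∞ σ V
  mem : ∀ m ∈ V, σ m ∈ levelSet G c
  proj_eq : ∀ m (h : m ∈ V), proj G c ⟨σ m, mem m h⟩ = m

namespace SmoothReduction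

variable (S : SmoothReduction G c d)

include S

theorem contMDiffOn_projExt (x₀ : levelSet G c) :
    ContMDiffOn 𝓘(ℝ, Hn n) (𝓡 d) ∞ (projExt G c x₀) (levelSet G c) :=
  S.smooth.1 (projExt G c x₀) fun x => projExt_of_mem x₀ x.2

theorem exists_locSec (x : levelSet G c) : ∃ (V : Set (HKQuotient G c)) (σ : HKQuotient G c → Hn n),
    IsLocSec (d := d) V σ ∧ proj G c x ∈ V ∧ σ (proj G c x) = x := by
  obtain ⟨V, σ, hV, hxV, hs, hx, h⟩ := S.smooth.2 x
  exact ⟨V, σ, ⟨hV, hs, fun m hm => (h m hm).1, fun m hm => (h m hm).2⟩, hxV, hx⟩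

theorem exists_levelCurve {x v : Hn n} (hx : x ∈ levelSet G c) (hv : v ∈ tangentSub G x) :
    ∃ y, LevelCurve c y x v :=
  exists_curve S.closed S.invariant S.free hx hv

/-- Identities for the differential of the projection are obtained from this by uniqueness of
velocities: curves in the level set with the same image in the quotient have the same velocity
there. -/
theorem velocity_proj {y : ℝ → Hn n} {x v : Hn n} (hy : LevelCurve c y x v) (x₀ : levelSet G c) :
    HasVelocity d (fun t => projExt G c x₀ (y t)) (proj G c ⟨x, hy.mem⟩)
      (dproj G c d ⟨x, hy.mem⟩ v) := by
  have hx := hy.mem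
  obtain ⟨rfl, h1, h2⟩ := hy
  have h3 := hasVelocity_of_mfderivWithin (d := d) h1 h2
    (f := projExt G c ⟨y 0, hx⟩) ((S.contMDiffOn_projExt _).mdifferentiableOn (by simp) _ hx)
  have h4 : HasVelocity d (fun t => projExt G c ⟨y 0, hx⟩ (y t)) (proj G c ⟨y 0, hx⟩)
      (dproj G c d ⟨y 0, hx⟩ v) := by
    have h5 := projExt_self (⟨y 0, hx⟩ : levelSet G c)
    have h6 := h3
    exact Eq.mp (by rw [← h5]; rfl) h6
  refine h4.congr ?_
  filter_upwards [h1] with t ht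
  rw [projExt_of_mem _ ht, projExt_of_mem _ ht]

end SmoothReduction

theorem dproj_sub (x : levelSet G c) (v w : Hn n) :
    (dproj G c d x (v - w) : EuclideanSpace ℝ (Fin d)) = dproj G c d x v - dproj G c d x w :=
  map_sub (mfderivWithin 𝓘(ℝ, Hn n) (𝓡 d) (projExt G c x) (levelSet G c) x) v w

theorem proj_gact (hG : IsClosed (G : Set (Matrix.unitaryGroup (Fin n) ℂ)))
    (hc : IsCoadInvariant G c) (g : G) {x : Hn n} (hx : x ∈ levelSet G c) :
    proj G c ⟨gact G g x, gact_mem_levelSet hG hc g hx⟩ = proj G c ⟨x, hx⟩ :=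
  (proj_eq_iff.2 ⟨g, rfl⟩).symm

theorem projExt_gact (hG : IsClosed (G : Set (Matrix.unitaryGroup (Fin n) ℂ)))
    (hc : IsCoadInvariant G c) (g : G) {x : Hn n} (hx : x ∈ levelSet G c) (x₀ : levelSet G c) :
    projExt G c x₀ (gact G g x) = projExt G c x₀ x := by
  rw [projExt_of_mem _ hx, projExt_of_mem _ (gact_mem_levelSet hG hc g hx), proj_gact hG hc]

namespace SmoothReduction

variable (S : SmoothReduction G c d)

include S

theorem dproj_gact (g : G) {x v : Hn n} (hx : x ∈ levelSet G c) (hv : v ∈ tangentSub G x) :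
    (dproj G c d ⟨gact G g x, gact_mem_levelSet S.closed S.invariant g hx⟩ (gact G g v) :
      EuclideanSpace ℝ (Fin d)) = dproj G c d ⟨x, hx⟩ v := by
  obtain ⟨y, hy⟩ := S.exists_levelCurve hx hv
  have h1 := S.velocity_proj hy ⟨x, hx⟩
  have h2 := S.velocity_proj (hy.gact S.closed S.invariant g) ⟨x, hx⟩
  rw [proj_gact S.closed S.invariant g hx] at h2
  refine h2.unique (h1.congr ?_)
  filter_upwards [hy.2.1] with t ht
  exact projExt_gact S.closed S.invariant g ht _

theorem levelCurve_exp {x : Hn n} (hx : x ∈ levelSet G c) (ξ : LieW G) :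
    LevelCurve c (fun t : ℝ => rep (NormedSpace.exp (t • lam G ξ)) x) x (rep (lam G ξ) x) := by
  refine ⟨by simp [rep_one], Eventually.of_forall fun t => ?_, hasDerivAt_exp_act_zero _ _⟩
  have := rep_exp_mem_levelSet S.closed S.invariant hx (t • ξ)
  rwa [map_smul] at this

theorem projExt_rep_exp (x₀ : levelSet G c) {x : Hn n} (hx : x ∈ levelSet G c) (ξ : LieW G) :
    projExt G c x₀ (rep (NormedSpace.exp (lam G ξ)) x) = projExt G c x₀ x := by
  obtain ⟨g, -, hg⟩ := exists_gact_of_mem (exp_mem_matSet S.closed (lam_mem ξ))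
  rw [← hg, projExt_gact S.closed S.invariant g hx]

theorem dproj_act {x : Hn n} (hx : x ∈ levelSet G c) (ξ : LieW G) :
    (dproj G c d ⟨x, hx⟩ (rep (lam G ξ) x) : EuclideanSpace ℝ (Fin d)) = 0 := by
  have h1 := S.velocity_proj (S.levelCurve_exp hx ξ) ⟨x, hx⟩
  refine h1.unique ((hasVelocity_const _).congr (Eventually.of_forall fun t => ?_))
  have := S.projExt_rep_exp ⟨x, hx⟩ hx (t • ξ)
  rw [map_smul] at this
  simp only [this]
  exact projExt_self (⟨x, hx⟩ : levelSet G c)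

theorem continuousWithinAt_projExt (x₀ : levelSet G c) {x : Hn n} (hx : x ∈ levelSet G c) :
    ContinuousWithinAt (projExt G c x₀) (levelSet G c) x :=
  (S.contMDiffOn_projExt x₀).continuousOn x hx

/-- Near a point of a local section, the level set is the product of the section with a
neighbourhood of `1` in the group; the group component has a smooth logarithm. -/
theorem exists_gauge {V : Set (HKQuotient G c)} {σ : HKQuotient G c → Hn n}
    (hσ : IsLocSec (d := d) V σ) {m : HKQuotient G c} (hm : m ∈ V) (x₀ : levelSet G c) :
    ∃ ξ : Hn n → LieW G, ContDiffWithinAt ℝ ∞ ξ (levelSet G c) (σ m) ∧ ξ (σ m) = 0 ∧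
      ∀ᶠ y in 𝓝[levelSet G c] (σ m), y ∈ levelSet G c ∧ projExt G c x₀ y ∈ V ∧
        rep (NormedSpace.exp (lam G (ξ y))) (σ (projExt G c x₀ y)) = y := by
  have hx : σ m ∈ levelSet G c := hσ.mem m hm
  set Q := projExt G c x₀ with hQ
  have hQx : Q (σ m) = m := by rw [hQ, projExt_of_mem _ hx, hσ.proj_eq m hm]
  have hQc : Tendsto Q (𝓝[levelSet G c] (σ m)) (𝓝 m) := by
    have := S.continuousWithinAt_projExt x₀ hx
    rwa [ContinuousWithinAt, ← hQ, hQx] at this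
  have hVn : V ∈ 𝓝 m := hσ.isOpen.mem_nhds hm
  have hσm : ContMDiffAt (𝓡 d) 𝓘(ℝ, Hn n) ∞ σ m := hσ.smooth.contMDiffAt hVn
  have hσQ : ContDiffWithinAt ℝ ∞ (fun y => σ (Q y)) (levelSet G c) (σ m) := by
    rw [← contMDiffWithinAt_iff_contDiffWithinAt]
    refine ContMDiffAt.comp_contMDiffWithinAt_of_eq (x := σ m) (y := m) hσm
      (S.contMDiffOn_projExt x₀ _ hx) hQx
  have hσQt : Tendsto (fun y => σ (Q y)) (𝓝[levelSet G c] (σ m)) (𝓝 (σ m)) :=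
    hσm.continuousAt.tendsto.comp hQc
  have hidt : Tendsto (fun y : Hn n => y) (𝓝[levelSet G c] (σ m)) (𝓝 (σ m)) := nhdsWithin_le_nhds
  obtain ⟨Ξ, hΞ, hΞ0, hΞe⟩ := exists_slice_function S.closed S.free hx
  -- A(y) ∈ G carries the section point under y to y. It is chosen with no regularity; smoothness
  -- comes from identifying it with exp ξ(y). The value 0 off the domain is irrelevant.
  have hA : ∀ y : Hn n, ∃ A : Matrix (Fin n) (Fin n) ℂ, y ∈ levelSet G c → Q y ∈ V →
      A ∈ matSet G ∧ rep A (σ (Q y)) = y := by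
    intro y
    by_cases hy : y ∈ levelSet G c ∧ Q y ∈ V
    · have h1 : proj G c ⟨σ (Q y), hσ.mem _ hy.2⟩ = proj G c ⟨y, hy.1⟩ := by
        rw [hσ.proj_eq _ hy.2]
        exact projExt_of_mem _ hy.1
      obtain ⟨g, hg⟩ := proj_eq_iff.1 h1
      exact ⟨_, fun _ _ => ⟨coe_mem_matSet g, hg⟩⟩
    · exact ⟨0, fun h1 h2 => absurd ⟨h1, h2⟩ hy⟩
  choose A hA using hA
  have hev : ∀ᶠ y in 𝓝[levelSet G c] (σ m), y ∈ levelSet G c ∧ Q y ∈ V :=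
    (eventually_mem_nhdsWithin).and (hQc.eventually hVn)
  have hA1 : Tendsto A (𝓝[levelSet G c] (σ m)) (𝓝 1) :=
    tendsto_one_of_rep_eq S.closed S.free hx (hev.mono fun y hy => (hA y hy.1 hy.2).1) hσQt hidt
      (hev.mono fun y hy => (hA y hy.1 hy.2).2)
  set ξ : Hn n → LieW G := fun y => Ξ (y, σ (Q y)) with hξ
  have hpair : Tendsto (fun y => (y, σ (Q y))) (𝓝[levelSet G c] (σ m)) (𝓝 (σ m, σ m)) :=
    hidt.prodMk_nhds hσQt
  have hξs : ContDiffWithinAt ℝ ∞ ξ (levelSet G c) (σ m) := by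
    have h1 : ContDiffAt ℝ ∞ Ξ ((fun y => (y, σ (Q y))) (σ m)) := by
      simpa only [hQx] using hΞ
    exact h1.comp_contDiffWithinAt (σ m) (contDiffWithinAt_id.prodMk hσQ)
  have hξ0 : ξ (σ m) = 0 := by simp only [hξ, hQx, hΞ0]
  have hξt : Tendsto ξ (𝓝[levelSet G c] (σ m)) (𝓝 0) := by
    have := hξs.continuousWithinAt
    rwa [ContinuousWithinAt, hξ0] at this
  have hk : Tendsto (fun y => NormedSpace.exp (lam G (-(ξ y))) * A y) (𝓝[levelSet G c] (σ m))
      (𝓝[matSet G] 1) := by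
    refine tendsto_nhdsWithin_iff.2 ⟨?_, hev.mono fun y hy => ?_⟩
    · have h1 := (tendsto_exp_lam (G := G)).comp (by simpa using hξt.neg)
      have h2 := h1.mul hA1
      rw [mul_one] at h2
      exact h2
    · exact mul_mem_matSet (exp_mem_matSet S.closed (lam_mem _)) (hA y hy.1 hy.2).1
  refine ⟨ξ, hξs, hξ0, ?_⟩
  filter_upwards [hev, hpair.eventually hΞe, (hk.prodMk hσQt).eventually
    (eventually_eq_one_of_pairL_eq_zero S.closed S.free hx)] with y hy h1 h2
  refine ⟨hy.1, hy.2, ?_⟩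
  have h3 : rep (NormedSpace.exp (lam G (-(ξ y))) * A y) (σ (Q y))
      = rep (NormedSpace.exp (-(lam G (ξ y)))) y := by
    rw [rep_mul, map_neg, mul_apply_eq_comp, (hA y hy.1 hy.2).2]
  -- The element exp(−ξ(y)) A(y) is close to 1 and displaces the section point orthogonally to the
  -- orbit of σ m, so it is 1.
  have h4 : NormedSpace.exp (lam G (-(ξ y))) * A y = 1 := by
    refine h2 ?_
    simp only [h3]
    exact h1
  rw [h4, rep_one] at h3
  change σ (Q y) = _ at h3
  rw [h3, rep_exp_rep_exp_neg]

end SmoothReduction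

end Reduction

end

noncomputable section

/-! ### Horizontal lifts and the quotient structure. -/

section Lift

open Filter

variable {n : ℕ} {G : Subgroup (Matrix.unitaryGroup (Fin n) ℂ)} {c : lieAlg G →ₗ[ℝ] ℝ} {d : ℕ}
  [ChartedSpace (EuclideanSpace ℝ (Fin d)) (HKQuotient G c)]

/-- The differential of a map from the quotient to `ℍⁿ`. -/
def dsec (d : ℕ) [ChartedSpace (EuclideanSpace ℝ (Fin d)) (HKQuotient G c)]
    (σ : HKQuotient G c → Hn n) (m : HKQuotient G c) : EuclideanSpace ℝ (Fin d) →L[ℝ] Hn n :=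
  mfderiv (𝓡 d) 𝓘(ℝ, Hn n) σ m

/-- The differential of the projection, with values in the model space. -/
def dpr (d : ℕ) [ChartedSpace (EuclideanSpace ℝ (Fin d)) (HKQuotient G c)] (x : levelSet G c)
    (v : Hn n) : EuclideanSpace ℝ (Fin d) := dproj G c d x v

/-- The horizontal lift of an element of the model space. -/
def hl (d : ℕ) [ChartedSpace (EuclideanSpace ℝ (Fin d)) (HKQuotient G c)] (x : levelSet G c)
    (u : EuclideanSpace ℝ (Fin d)) : Hn n := hlift G c d x u

theorem dpr_sub (x : levelSet G c) (v w : Hn n) : dpr d x (v - w) = dpr d x v - dpr d x w :=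
  dproj_sub x v w

theorem dpr_eq_of_eq {x x' : Hn n} (h : x = x') (hx : x ∈ levelSet G c) (hx' : x' ∈ levelSet G c)
    (v : Hn n) : dpr d ⟨x, hx⟩ v = dpr d ⟨x', hx'⟩ v := by
  subst h; rfl

theorem hl_eq_of_eq {x x' : Hn n} (h : x = x') (hx : x ∈ levelSet G c) (hx' : x' ∈ levelSet G c)
    (u : EuclideanSpace ℝ (Fin d)) : hl d ⟨x, hx⟩ u = hl d ⟨x', hx'⟩ u := by
  subst h; rfl

section LocSec

variable {V : Set (HKQuotient G c)} {σ : HKQuotient G c → Hn n} (hσ : IsLocSec (d := d) V σ)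
  {m : HKQuotient G c} (hm : m ∈ V)

include hσ hm

theorem IsLocSec.contMDiffAt : ContMDiffAt (𝓡 d) 𝓘(ℝ, Hn n) ∞ σ m :=
  hσ.smooth.contMDiffAt (hσ.isOpen.mem_nhds hm)

theorem IsLocSec.levelCurve {γ : ℝ → HKQuotient G c} {u : EuclideanSpace ℝ (Fin d)}
    (hγ : HasVelocity d γ m u) : LevelCurve c (fun t => σ (γ t)) (σ m) (dsec d σ m u) := by
  refine ⟨by simp only [hγ.1], ?_, hγ.hasDerivAt_comp ((hσ.contMDiffAt hm).mdifferentiableAt (by simp))⟩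
  have h1 : ∀ᶠ t in 𝓝 0, γ t ∈ V :=
    hγ.2.1.eventually (hσ.isOpen.mem_nhds (by rwa [hγ.1]))
  exact h1.mono fun t ht => hσ.mem _ ht

theorem IsLocSec.projExt_apply (x₀ : levelSet G c) : projExt G c x₀ (σ m) = m := by
  rw [projExt_of_mem _ (hσ.mem m hm), hσ.proj_eq m hm]

theorem IsLocSec.eventually_mem {γ : ℝ → HKQuotient G c} {u : EuclideanSpace ℝ (Fin d)}
    (hγ : HasVelocity d γ m u) : ∀ᶠ t in 𝓝 0, γ t ∈ V :=
  hγ.2.1.eventually (hσ.isOpen.mem_nhds (by rwa [hγ.1]))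

end LocSec

namespace SmoothReduction

variable (S : SmoothReduction G c d)

include S

theorem dpr_gact (g : G) {x v : Hn n} (hx : x ∈ levelSet G c) (hv : v ∈ tangentSub G x) :
    dpr d ⟨gact G g x, gact_mem_levelSet S.closed S.invariant g hx⟩ (gact G g v)
      = dpr d ⟨x, hx⟩ v := S.dproj_gact g hx hv

theorem dpr_act {x : Hn n} (hx : x ∈ levelSet G c) (ξ : LieW G) :
    dpr d ⟨x, hx⟩ (rep (lam G ξ) x) = 0 := S.dproj_act hx ξ

theorem dsec_mem_tangentSub {V : Set (HKQuotient G c)} {σ : HKQuotient G c → Hn n}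
    (hσ : IsLocSec (d := d) V σ) {m : HKQuotient G c} (hm : m ∈ V)
    (u : EuclideanSpace ℝ (Fin d)) : dsec d σ m u ∈ tangentSub G (σ m) := by
  obtain ⟨γ, hγ⟩ := exists_hasVelocity m u
  exact (hσ.levelCurve hm hγ).mem_tangentSub S.closed

theorem dpr_dsec {V : Set (HKQuotient G c)} {σ : HKQuotient G c → Hn n}
    (hσ : IsLocSec (d := d) V σ) {m : HKQuotient G c} (hm : m ∈ V)
    (u : EuclideanSpace ℝ (Fin d)) :
    dpr d ⟨σ m, hσ.mem m hm⟩ (dsec d σ m u) = u := by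
  obtain ⟨γ, hγ⟩ := exists_hasVelocity m u
  have h1 := S.velocity_proj (hσ.levelCurve hm hγ) ⟨σ m, hσ.mem m hm⟩
  rw [hσ.proj_eq m hm] at h1
  refine h1.unique (hγ.congr ?_)
  filter_upwards [hσ.eventually_mem hm hγ] with t ht
  exact hσ.projExt_apply ht _

/-- A tangent vector of the level set is the sum of an orbit direction and a vector tangent to a
given local section. -/
theorem exists_eq_act_add_dsec {V : Set (HKQuotient G c)} {σ : HKQuotient G c → Hn n}
    (hσ : IsLocSec (d := d) V σ) {m : HKQuotient G c} (hm : m ∈ V) {v : Hn n}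
    (hv : v ∈ tangentSub G (σ m)) :
    ∃ ζ : LieW G, v = rep (lam G ζ) (σ m) + dsec d σ m (dpr d ⟨σ m, hσ.mem m hm⟩ v) := by
  have hx := hσ.mem m hm
  obtain ⟨y, hy⟩ := S.exists_levelCurve hx hv
  obtain ⟨ξ, hξ, hξ0, hev⟩ := S.exists_gauge hσ hm ⟨σ m, hx⟩
  have hyt : Tendsto y (𝓝 0) (𝓝[levelSet G c] (σ m)) :=
    tendsto_nhdsWithin_iff.2 ⟨by simpa [hy.1] using hy.2.2.continuousAt.tendsto, hy.2.1⟩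
  have hvel := S.velocity_proj hy ⟨σ m, hx⟩
  rw [hσ.proj_eq m hm] at hvel
  have h1 : HasDerivAt (fun t => σ (projExt G c ⟨σ m, hx⟩ (y t)))
      (dsec d σ m (dpr d ⟨σ m, hx⟩ v)) 0 :=
    hvel.hasDerivAt_comp ((hσ.contMDiffAt hm).mdifferentiableAt (by simp))
  obtain ⟨D, hD⟩ := hξ.differentiableWithinAt (by simp)
  have h2 : HasDerivAt (fun t => ξ (y t)) (D v) 0 := by
    have h3 : HasFDerivWithinAt ξ D (levelSet G c) (y 0) := by rwa [hy.1]
    exact (h3.comp_hasDerivWithinAt (0 : ℝ) hy.2.2.hasDerivWithinAt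
      (Set.mapsTo_preimage y _)).hasDerivAt hy.2.1
  refine ⟨D v, ?_⟩
  -- Differentiate y(t) = exp(ξ(y(t))) σ(Q(y(t))) at 0, where ξ vanishes.
  have h4 : HasDerivAt (fun t => rep (NormedSpace.exp (lam G (ξ (y t))))
      (σ (projExt G c ⟨σ m, hx⟩ (y t)))) (rep (lam G (D v)) (σ m)
        + dsec d σ m (dpr d ⟨σ m, hx⟩ v)) 0 := by
    have h5 := hasFDerivAt_rep_exp (G := G) (σ m)
    have h6 : ((0 : LieW G), σ m) = (ξ (y 0), σ (projExt G c ⟨σ m, hx⟩ (y 0))) := by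
      rw [hy.1, hξ0, hσ.projExt_apply hm]
    rw [h6] at h5
    exact h5.comp_hasDerivAt (0 : ℝ) (h2.prodMk h1)
  refine hy.2.2.unique (h4.congr_of_eventuallyEq ?_)
  filter_upwards [hyt.eventually hev] with t ht
  exact ht.2.2.symm

/-- When the projection of v is zero, the splitting leaves only an orbit direction, to which the
horizontal vector v is orthogonal. -/
theorem eq_zero_of_dpr_eq_zero {x v : Hn n} (hx : x ∈ levelSet G c) (hv : v ∈ horSub G x)
    (h : dpr d ⟨x, hx⟩ v = 0) : v = 0 := by
  obtain ⟨V, σ, hσ, hm, hσx⟩ := S.exists_locSec ⟨x, hx⟩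
  simp only at hσx
  obtain ⟨ζ, hζ⟩ := S.exists_eq_act_add_dsec hσ hm (v := v)
    (by rw [hσx]; exact horSub_le_tangentSub x hv)
  have h1 : dpr d ⟨σ (proj G c ⟨x, hx⟩), hσ.mem _ hm⟩ v = 0 := by
    rw [dpr_eq_of_eq hσx _ hx, h]
  rw [h1, map_zero, add_zero, hσx] at hζ
  have h2 := DFunLike.congr_fun (mem_horSub_iff.1 hv).2 ζ
  rw [pairL_apply, ← hζ] at h2
  exact inner_self_eq_zero (𝕜 := ℝ).1 h2

theorem dpr_sub_theta {x v : Hn n} (hx : x ∈ levelSet G c) :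
    dpr d ⟨x, hx⟩ (v - rep (lam G (theta G x v)) x)
      = dpr d ⟨x, hx⟩ v := by
  rw [dpr_sub, S.dpr_act hx, sub_zero]

/-- Push u forward by a local section and subtract the orthogonal projection to the orbit, which the
differential of the projection does not see. -/
theorem exists_horizontal {x : Hn n} (hx : x ∈ levelSet G c) (u : EuclideanSpace ℝ (Fin d)) :
    ∃ v ∈ horSub G x, dpr d ⟨x, hx⟩ v = u := by
  obtain ⟨V, σ, hσ, hm, hσx⟩ := S.exists_locSec ⟨x, hx⟩
  simp only at hσx
  have h1 := S.dpr_dsec hσ hm u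
  have h2 := S.dsec_mem_tangentSub hσ hm u
  set w := dsec d σ (proj G c ⟨x, hx⟩) u
  refine ⟨w - rep (lam G (theta G x w)) x, ?_, ?_⟩
  · rw [hσx] at h2
    exact sub_theta_mem_horSub S.closed S.invariant S.free hx h2
  · rw [S.dpr_sub_theta hx, dpr_eq_of_eq hσx.symm hx (hσ.mem _ hm), h1]

theorem hl_mem {x : Hn n} (hx : x ∈ levelSet G c) (u : EuclideanSpace ℝ (Fin d)) :
    hl d ⟨x, hx⟩ u ∈ horSub G x := by
  obtain ⟨v, hv, hvu⟩ := S.exists_horizontal hx u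
  exact mem_horSub.2 (Classical.epsilon_spec (p := fun v => v ∈ horizontal G x ∧
    dpr d ⟨x, hx⟩ v = u) ⟨v, mem_horSub.1 hv, hvu⟩).1

theorem dpr_hl {x : Hn n} (hx : x ∈ levelSet G c) (u : EuclideanSpace ℝ (Fin d)) :
    dpr d ⟨x, hx⟩ (hl d ⟨x, hx⟩ u) = u := by
  obtain ⟨v, hv, hvu⟩ := S.exists_horizontal hx u
  exact (Classical.epsilon_spec (p := fun v => v ∈ horizontal G x ∧
    dpr d ⟨x, hx⟩ v = u) ⟨v, mem_horSub.1 hv, hvu⟩).2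

/-- The lift is defined by choice; this is the device for computing it, by exhibiting a horizontal
vector with the right projection. -/
theorem hl_unique {x v : Hn n} (hx : x ∈ levelSet G c) {u : EuclideanSpace ℝ (Fin d)}
    (hv : v ∈ horSub G x) (h : dpr d ⟨x, hx⟩ v = u) :
    hl d ⟨x, hx⟩ u = v := by
  rw [← sub_eq_zero]
  refine S.eq_zero_of_dpr_eq_zero hx ((horSub G x).sub_mem (S.hl_mem hx u) hv) ?_
  rw [dpr_sub, S.dpr_hl hx, h, sub_self]

theorem hl_dpr {x v : Hn n} (hx : x ∈ levelSet G c) (hv : v ∈ tangentSub G x) :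
    hl d ⟨x, hx⟩ (dpr d ⟨x, hx⟩ v) = v - rep (lam G (theta G x v)) x :=
  S.hl_unique hx (sub_theta_mem_horSub S.closed S.invariant S.free hx hv)
    (S.dpr_sub_theta hx)

theorem hl_gact (g : G) {x : Hn n} (hx : x ∈ levelSet G c) (u : EuclideanSpace ℝ (Fin d)) :
    hl d ⟨gact G g x, gact_mem_levelSet S.closed S.invariant g hx⟩ u
      = gact G g (hl d ⟨x, hx⟩ u) :=
  S.hl_unique _ (gact_mem_horSub S.closed g (S.hl_mem hx u))
    (by rw [S.dpr_gact g hx (horSub_le_tangentSub _ (S.hl_mem hx u)), S.dpr_hl hx])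

theorem hl_sec {V : Set (HKQuotient G c)} {σ : HKQuotient G c → Hn n}
    (hσ : IsLocSec (d := d) V σ) {m : HKQuotient G c} (hm : m ∈ V) (u : EuclideanSpace ℝ (Fin d)) :
    hl d ⟨σ m, hσ.mem m hm⟩ u
      = dsec d σ m u - rep (lam G (theta G (σ m) (dsec d σ m u))) (σ m) := by
  rw [← S.hl_dpr (hσ.mem m hm) (S.dsec_mem_tangentSub hσ hm u), S.dpr_dsec hσ hm]

/-- The chosen point over `m` can be replaced by any other point over `m`, up to the action. -/
theorem exists_gact_pt {x : Hn n} (hx : x ∈ levelSet G c) :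
    ∃ g : G, x = gact G g (pt G c (proj G c ⟨x, hx⟩) : Hn n) := by
  obtain ⟨g, hg⟩ := proj_eq_iff.1 (proj_pt G c (proj G c ⟨x, hx⟩))
  exact ⟨g, hg.symm⟩

/-- The quotient tensors are defined at one arbitrary representative of each orbit; equivariance of
horizontal lifts transfers them to any other representative. -/
theorem exists_hliftPt {x : Hn n} (hx : x ∈ levelSet G c) :
    ∃ g : G, x = gact G g (pt G c (proj G c ⟨x, hx⟩) : Hn n) ∧
      ∀ u : EuclideanSpace ℝ (Fin d), hl d ⟨x, hx⟩ u
        = gact G g (hliftPt G c d (proj G c ⟨x, hx⟩) u) := by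
  obtain ⟨g, hg⟩ := S.exists_gact_pt hx
  refine ⟨g, hg, fun u => ?_⟩
  rw [hl_eq_of_eq hg hx (gact_mem_levelSet S.closed S.invariant g (pt G c _).2) u,
    S.hl_gact g (pt G c _).2]
  rfl

theorem hliftPt_mem (m : HKQuotient G c) (u : EuclideanSpace ℝ (Fin d)) :
    hliftPt G c d m u ∈ horSub G (pt G c m : Hn n) := S.hl_mem (pt G c m).2 u

/-- The horizontal space is quaternionic, so rotating a lift gives a lift; the complex structures
downstairs correspond to the flat ones on horizontal vectors. -/
theorem hliftPt_cplx (a : Fin 3) (m : HKQuotient G c) (u : EuclideanSpace ℝ (Fin d)) :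
    hliftPt G c d m ((quotientStructure G c d).cplx a m u) = quat a (hliftPt G c d m u) :=
  S.hl_unique (pt G c m).2 (quat_mem_horSub a (S.hliftPt_mem m u)) rfl

theorem form_eq (a : Fin 3) (m : HKQuotient G c) (u v : EuclideanSpace ℝ (Fin d)) :
    (quotientStructure G c d).form a m u v = flatForm a (hliftPt G c d m u) (hliftPt G c d m v) := by
  change inner ℝ (hliftPt G c d m _) (hliftPt G c d m v) = _
  rw [S.hliftPt_cplx]
  rfl

theorem inner_hl {x : Hn n} (hx : x ∈ levelSet G c) (u v : EuclideanSpace ℝ (Fin d)) :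
    (quotientStructure G c d).metric (proj G c ⟨x, hx⟩) u v
      = inner ℝ (hl d ⟨x, hx⟩ u) (hl d ⟨x, hx⟩ v) := by
  obtain ⟨g, -, hg⟩ := S.exists_hliftPt hx
  rw [hg, hg, inner_gact]
  rfl

theorem flatForm_hl (a : Fin 3) {x : Hn n} (hx : x ∈ levelSet G c)
    (u v : EuclideanSpace ℝ (Fin d)) :
    (quotientStructure G c d).form a (proj G c ⟨x, hx⟩) u v
      = flatForm a (hl d ⟨x, hx⟩ u) (hl d ⟨x, hx⟩ v) := by
  obtain ⟨g, -, hg⟩ := S.exists_hliftPt hx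
  rw [hg, hg, S.form_eq, flatForm, flatForm, quat_gact, inner_gact]

end SmoothReduction

end Lift

end

noncomputable section

/-! ### The circle action on the quotient and its moment map. -/

section Rotation

open Filter

variable {n : ℕ} {G : Subgroup (Matrix.unitaryGroup (Fin n) ℂ)} {c : lieAlg G →ₗ[ℝ] ℝ} {d : ℕ}
  [ChartedSpace (EuclideanSpace ℝ (Fin d)) (HKQuotient G c)]

theorem exists_proj_eq (m : HKQuotient G c) :
    ∃ (x : Hn n) (hx : x ∈ levelSet G c), proj G c ⟨x, hx⟩ = m :=
  ⟨pt G c m, (pt G c m).2, proj_pt G c m⟩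

theorem circleAct_proj (t : Circle) {x : Hn n} (hx : x ∈ levelSet G c) :
    circleAct G c t (proj G c ⟨x, hx⟩) = proj G c ⟨(t : ℂ) • x, smul_mem_levelSet G c t hx⟩ := rfl

theorem circleAct_one (m : HKQuotient G c) : circleAct G c 1 m = m := by
  obtain ⟨x, hx, rfl⟩ := exists_proj_eq m
  rw [circleAct_proj]
  congr 1
  simp

theorem circleAct_mul (s t : Circle) (m : HKQuotient G c) :
    circleAct G c (s * t) m = circleAct G c s (circleAct G c t m) := by
  obtain ⟨x, hx, rfl⟩ := exists_proj_eq m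
  simp only [circleAct_proj]
  congr 2
  rw [Circle.coe_mul, mul_smul]

theorem circleAct_projExt (t : Circle) (x₀ : levelSet G c) {x : Hn n} (hx : x ∈ levelSet G c) :
    circleAct G c t (projExt G c x₀ x) = projExt G c x₀ ((t : ℂ) • x) := by
  rw [projExt_of_mem _ hx, projExt_of_mem _ (smul_mem_levelSet G c t hx), circleAct_proj]

/-- The differential of the circle action, in the model space. -/
def dact (d : ℕ) [ChartedSpace (EuclideanSpace ℝ (Fin d)) (HKQuotient G c)] (t : Circle)
    (m : HKQuotient G c) (u : EuclideanSpace ℝ (Fin d)) : EuclideanSpace ℝ (Fin d) :=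
  mfderiv (𝓡 d) (𝓡 d) (circleAct G c t) m u

theorem levelCurve_exp_smul {x : Hn n} (hx : x ∈ levelSet G c) :
    LevelCurve c (fun s : ℝ => (Circle.exp s : ℂ) • x) x (quat 0 x) := by
  refine ⟨by simp, Eventually.of_forall fun s => smul_mem_levelSet G c _ hx, ?_⟩
  have h1 : HasDerivAt (fun s : ℝ => Complex.exp (s * Complex.I)) Complex.I 0 := by
    have := ((hasDerivAt_id (0 : ℝ)).ofReal_comp.mul_const Complex.I).cexp
    simpa using this
  have h2 := h1.smul_const x
  simp only [Circle.coe_exp]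
  exact h2

theorem contDiff_exp_smul : ContDiff ℝ ∞ (fun p : ℝ × Hn n => (Circle.exp p.1 : ℂ) • p.2) := by
  simp only [Circle.coe_exp]
  have h1 : ContDiff ℝ ∞ (fun p : ℝ × Hn n => Complex.exp (p.1 * Complex.I)) :=
    ((Complex.ofRealCLM.contDiff.comp (contDiff_fst (𝕜 := ℝ) (E := ℝ) (F := Hn n))).mul
      contDiff_const).cexp
  exact h1.smul (contDiff_snd (𝕜 := ℝ) (E := ℝ) (F := Hn n))

/-- The moment map `-|x|² / 2` of the circle action. -/
def rotationMoment (m : HKQuotient G c) : ℝ := -‖(pt G c m : Hn n)‖ ^ 2 / 2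

theorem rotationMoment_proj {x : Hn n} (hx : x ∈ levelSet G c) :
    rotationMoment (proj G c ⟨x, hx⟩) = -‖x‖ ^ 2 / 2 := by
  obtain ⟨g, hg⟩ := proj_eq_iff.1 (proj_pt G c (proj G c ⟨x, hx⟩))
  simp only at hg
  have : ‖x‖ ^ 2 = ‖(pt G c (proj G c ⟨x, hx⟩) : Hn n)‖ ^ 2 := by
    rw [← real_inner_self_eq_norm_sq, ← real_inner_self_eq_norm_sq]
    conv_lhs => rw [← hg]
    exact inner_gact g _ _
  rw [rotationMoment, this]

namespace SmoothReduction

variable (S : SmoothReduction G c d)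

include S

/-- Locally the action is the composite of a local section, a rotation of ℍⁿ and the projection. -/
theorem contMDiff_circleAct : ContMDiff (𝓘(ℝ, ℝ).prod (𝓡 d)) (𝓡 d) ∞
    (fun p : ℝ × HKQuotient G c => circleAct G c (Circle.exp p.1) p.2) := by
  rintro ⟨s, m⟩
  obtain ⟨x, hx, rfl⟩ := exists_proj_eq m
  obtain ⟨V, σ, hσ, hm, -⟩ := S.exists_locSec ⟨x, hx⟩
  set m := proj G c ⟨x, hx⟩
  have h1 : ContMDiffAt (𝓘(ℝ, ℝ).prod (𝓡 d)) 𝓘(ℝ, Hn n) ∞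
      (fun p : ℝ × HKQuotient G c => (Circle.exp p.1 : ℂ) • σ p.2) (s, m) := by
    have h2 : ContMDiffAt (𝓘(ℝ, ℝ).prod (𝓡 d)) 𝓘(ℝ, ℝ × Hn n) ∞
        (fun p : ℝ × HKQuotient G c => (p.1, σ p.2)) (s, m) := by
      refine ContMDiffAt.prodMk_space contMDiffAt_fst ?_
      exact ContMDiffAt.comp (s, m) (g := σ) (hσ.contMDiffAt hm) contMDiffAt_snd
    exact (contDiff_exp_smul.contMDiff _).comp (s, m) h2
  have h3 := S.contMDiffOn_projExt ⟨x, hx⟩ ((Circle.exp s : ℂ) • σ m)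
    (smul_mem_levelSet G c _ (hσ.mem m hm))
  have hV : Set.univ ×ˢ V ∈ 𝓝 (s, m) := prod_mem_nhds univ_mem (hσ.isOpen.mem_nhds hm)
  have h4 := ContMDiffWithinAt.comp (s, m) (t := levelSet G c) (s := Set.univ ×ˢ V)
    (g := projExt G c ⟨x, hx⟩) (f := fun p : ℝ × HKQuotient G c => (Circle.exp p.1 : ℂ) • σ p.2)
    h3 h1.contMDiffWithinAt (fun p hp => smul_mem_levelSet G c _ (hσ.mem _ hp.2))
  refine (h4.contMDiffAt hV).congr_of_eventuallyEq ?_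
  filter_upwards [hV] with p hp
  rw [Function.comp_apply, ← circleAct_projExt _ _ (hσ.mem _ hp.2), hσ.projExt_apply hp.2]

theorem contMDiff_circleAct_left (t : Circle) :
    ContMDiff (𝓡 d) (𝓡 d) ∞ (circleAct G c t) := by
  obtain ⟨s, rfl⟩ := Circle.exp_surjective t
  exact S.contMDiff_circleAct.comp (contMDiff_const.prodMk contMDiff_id)

theorem dact_dpr (t : Circle) {x v : Hn n} (hx : x ∈ levelSet G c) (hv : v ∈ tangentSub G x) :
    dact d t (proj G c ⟨x, hx⟩) (dpr d ⟨x, hx⟩ v)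
      = dpr d ⟨(t : ℂ) • x, smul_mem_levelSet G c t hx⟩ ((t : ℂ) • v) := by
  obtain ⟨y, hy⟩ := S.exists_levelCurve hx hv
  have h1 := (S.velocity_proj hy ⟨x, hx⟩).comp
    ((S.contMDiff_circleAct_left t).mdifferentiable (by simp) _)
  have h2 := S.velocity_proj (hy.circle_smul t) ⟨x, hx⟩
  rw [circleAct_proj] at h1
  refine h1.unique (h2.congr ?_)
  filter_upwards [hy.2.1] with s hs
  exact circleAct_projExt t _ hs

/-- Rotation preserves horizontality and covers the circle action, which reduces the invariance
properties of the quotient tensors to flat ones. -/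
theorem hl_dact (t : Circle) {x : Hn n} (hx : x ∈ levelSet G c) (u : EuclideanSpace ℝ (Fin d)) :
    hl d ⟨(t : ℂ) • x, smul_mem_levelSet G c t hx⟩ (dact d t (proj G c ⟨x, hx⟩) u)
      = (t : ℂ) • hl d ⟨x, hx⟩ u := by
  refine S.hl_unique _ (circle_smul_mem_horSub t (S.hl_mem hx u)) ?_
  rw [← S.dact_dpr t hx (horSub_le_tangentSub _ (S.hl_mem hx u)), S.dpr_hl hx]

theorem hasVelocity_circleAct {x : Hn n} (hx : x ∈ levelSet G c) :
    HasVelocity d (fun s : ℝ => circleAct G c (Circle.exp s) (proj G c ⟨x, hx⟩))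
      (proj G c ⟨x, hx⟩) (dpr d ⟨x, hx⟩ (quat 0 x)) := by
  refine (S.velocity_proj (levelCurve_exp_smul hx) ⟨x, hx⟩).congr (Eventually.of_forall fun s => ?_)
  simp only
  rw [← circleAct_projExt _ _ hx, projExt_of_mem _ hx]

theorem generator_proj {x : Hn n} (hx : x ∈ levelSet G c) :
    (generator (circleAct G c) (proj G c ⟨x, hx⟩) : EuclideanSpace ℝ (Fin d))
      = dpr d ⟨x, hx⟩ (quat 0 x) := by
  have h := S.hasVelocity_circleAct hx
  have h2 : HasVelocity d (fun s : ℝ => circleAct G c (Circle.exp s) (proj G c ⟨x, hx⟩))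
      (circleAct G c (Circle.exp 0) (proj G c ⟨x, hx⟩)) (dpr d ⟨x, hx⟩ (quat 0 x)) := by
    rw [Circle.exp_zero, circleAct_one]
    exact h
  exact h2.mfderiv_eq

theorem isRotatingAction : IsRotatingAction (quotientStructure G c d) (circleAct G c) 2 where
  one := circleAct_one
  mul := circleAct_mul
  smooth := S.contMDiff_circleAct
  metric t m u v := by
    obtain ⟨x, hx, rfl⟩ := exists_proj_eq m
    refine (S.inner_hl (smul_mem_levelSet G c t hx) _ _).trans ?_
    refine Eq.trans ?_ (S.inner_hl hx u v).symm
    rw [← inner_circle_smul t (hl d ⟨x, hx⟩ u)]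
    exact congrArg₂ (inner ℝ) (S.hl_dact t hx u) (S.hl_dact t hx v)
  form_one t m u v := by
    obtain ⟨x, hx, rfl⟩ := exists_proj_eq m
    refine (S.flatForm_hl 0 (smul_mem_levelSet G c t hx) _ _).trans ?_
    refine Eq.trans ?_ (S.flatForm_hl 0 hx u v).symm
    refine (congrArg₂ (flatForm 0) (S.hl_dact t hx u) (S.hl_dact t hx v)).trans ?_
    exact (flat_smul_aux t _ _).1
  form_cplx t m u v := by
    obtain ⟨x, hx, rfl⟩ := exists_proj_eq m
    have h := fun a => (S.flatForm_hl a (smul_mem_levelSet G c t hx) (dact d t _ u)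
      (dact d t _ v)).trans (congrArg₂ (flatForm a) (S.hl_dact t hx u) (S.hl_dact t hx v))
    refine (congrArg₂ (fun a b : ℝ => (a : ℂ) + Complex.I * b) (h 1) (h 2)).trans ?_
    refine Eq.trans ?_ (congrArg₂ (fun a b : ℝ => (t : ℂ) ^ 2 * ((a : ℂ) + Complex.I * b))
      (S.flatForm_hl 1 hx u v) (S.flatForm_hl 2 hx u v)).symm
    exact flatForm_cplx_smul t _ _

theorem rotationMoment_eventuallyEq {V : Set (HKQuotient G c)} {σ : HKQuotient G c → Hn n}
    (hσ : IsLocSec (d := d) V σ) {m : HKQuotient G c} (hm : m ∈ V) :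
    rotationMoment m = -‖σ m‖ ^ 2 / 2 := by
  rw [← rotationMoment_proj (hσ.mem m hm), hσ.proj_eq m hm]

theorem contMDiff_rotationMoment :
    ContMDiff (𝓡 d) 𝓘(ℝ, ℝ) ∞ (rotationMoment : HKQuotient G c → ℝ) := by
  intro m
  obtain ⟨x, hx, rfl⟩ := exists_proj_eq m
  obtain ⟨V, σ, hσ, hm, -⟩ := S.exists_locSec ⟨x, hx⟩
  have h1 : ContDiff ℝ ∞ (fun x : Hn n => -‖x‖ ^ 2 / 2) := by
    have := (contDiff_norm_sq ℝ (E := Hn n) (n := ∞))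
    exact (this.neg).div_const 2
  refine ((h1.contMDiff _).comp _ (hσ.contMDiffAt hm)).congr_of_eventuallyEq ?_
  filter_upwards [hσ.isOpen.mem_nhds hm] with y hy
  exact S.rotationMoment_eventuallyEq hσ hy

theorem dR_rotationMoment {x : Hn n} (hx : x ∈ levelSet G c) (u : EuclideanSpace ℝ (Fin d)) :
    dR rotationMoment (proj G c ⟨x, hx⟩) u = -inner ℝ x (hl d ⟨x, hx⟩ u) := by
  obtain ⟨y, hy⟩ := S.exists_levelCurve hx (horSub_le_tangentSub _ (S.hl_mem hx u))
  have h1 : HasVelocity d (fun t => projExt G c ⟨x, hx⟩ (y t)) (proj G c ⟨x, hx⟩) u := by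
    have := S.velocity_proj hy ⟨x, hx⟩
    exact (S.dpr_hl hx u) ▸ this
  have h2 := h1.hasDerivAt_comp (f := rotationMoment)
    (S.contMDiff_rotationMoment.mdifferentiable (by simp) _)
  refine h2.unique ?_
  have h3 : HasDerivAt (fun t => -‖y t‖ ^ 2 / 2) (-inner ℝ x (hl d ⟨x, hx⟩ u)) 0 := by
    have := hy.2.2.norm_sq.neg.div_const 2
    rw [hy.1] at this
    exact this.congr_deriv (by ring)
  refine h3.congr_of_eventuallyEq ?_
  filter_upwards [hy.2.1] with t ht
  rw [projExt_of_mem _ ht, rotationMoment_proj]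

/-- The generator lifts to ix minus an orbit direction. The latter pairs to zero under ω₁ with
horizontal vectors, and ω₁(ix,·) = −⟨x,·⟩ is the differential of −|x|²/2. -/
theorem isMomentMap_rotationMoment :
    IsMomentMap (quotientStructure G c d) (circleAct G c) rotationMoment := by
  refine ⟨S.contMDiff_rotationMoment, fun m u => ?_⟩
  obtain ⟨x, hx, rfl⟩ := exists_proj_eq m
  refine Eq.trans ?_ (S.dR_rotationMoment hx u).symm
  refine (S.flatForm_hl 0 hx (generator (circleAct G c) (proj G c ⟨x, hx⟩)) u).trans ?_
  have h1 := (levelCurve_exp_smul hx).mem_tangentSub S.closed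
  have h2 : hl d ⟨x, hx⟩ (generator (circleAct G c) (proj G c ⟨x, hx⟩))
      = quat 0 x - rep (lam G (theta G x (quat 0 x))) x :=
    (congrArg (hl d ⟨x, hx⟩) (S.generator_proj hx)).trans (S.hl_dpr hx h1)
  rw [h2, flatForm, quat_sub, quat_quat, inner_sub_left, inner_neg_left]
  have h3 := ((mem_horSub.1 (S.hl_mem hx u)) ⟨_, lam_mem (theta G x (quat 0 x))⟩).2 0
  rw [h3, sub_zero]

end SmoothReduction

end Rotation

end

noncomputable section

/-! ### The associated line bundle through equivariant functions. -/

section AssociatedBundle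

open Filter

variable {n : ℕ} {G : Subgroup (Matrix.unitaryGroup (Fin n) ℂ)} {c : lieAlg G →ₗ[ℝ] ℝ}
  {χ : G →* Circle} {hfree : ActsFreely G c}

/-- The part of the level set over a subset of the quotient. -/
def levelOver (U : Set (HKQuotient G c)) : Set (Hn n) :=
  {x | ∃ h : x ∈ levelSet G c, proj G c ⟨x, h⟩ ∈ U}

theorem levelOver_subset (U : Set (HKQuotient G c)) : levelOver U ⊆ levelSet G c :=
  fun _ h => h.1

theorem levelOver_mem_nhdsWithin {U : Set (HKQuotient G c)} (hU : IsOpen U) {x : Hn n}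
    (hx : x ∈ levelOver U) : levelOver U ∈ 𝓝[levelSet G c] x := by
  obtain ⟨O, hO, hOU⟩ := isOpen_induced_iff.1 (hU.preimage (continuous_proj (G := G) (c := c)))
  obtain ⟨h, hxU⟩ := hx
  have hxO : x ∈ O := by
    have : (⟨x, h⟩ : levelSet G c) ∈ Subtype.val ⁻¹' O := by rw [hOU]; exact hxU
    exact this
  refine mem_nhdsWithin.2 ⟨O, hO, hxO, ?_⟩
  rintro y ⟨hyO, hyL⟩
  refine ⟨hyL, ?_⟩
  have : (⟨y, hyL⟩ : levelSet G c) ∈ proj G c ⁻¹' U := by rw [← hOU]; exact hyO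
  exact this

/-- The linear coordinate `[x, v] ↦ v` on the fibre over the orbit of `x`. -/
def fibCoord (χ : G →* Circle) (hfree : ActsFreely G c) {m : HKQuotient G c} (x : levelSet G c)
    (hx : proj G c x = m) : (assocBundle G χ hfree).Fib m → ℂ :=
  assocCoord G χ hfree x hx

theorem assocCoord_assocMk {m : HKQuotient G c} (x : levelSet G c) (hx : proj G c x = m) (v : ℂ) :
    assocCoord G χ hfree x hx (assocMk G c χ x hx v) = v :=
  (Equiv.ofBijective _ (assocMk_bijective G χ hfree x hx)).symm_apply_apply v

theorem assocCoord_of_gact {m : HKQuotient G c} {x y : levelSet G c} (hx : proj G c x = m)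
    (hy : proj G c y = m) {g : G} (hg : gact G g x = y) (a : AssocFib G c χ m) :
    assocCoord G χ hfree y hy a = χ g * assocCoord G χ hfree x hx a := by
  obtain ⟨v, rfl⟩ := (assocMk_bijective G χ hfree x hx).2 a
  rw [assocCoord_assocMk]
  have : assocMk G c χ x hx v = assocMk G c χ y hy (χ g * v) :=
    Subtype.ext (Quotient.sound ⟨g, hg, rfl⟩)
  rw [this, assocCoord_assocMk]

theorem fibCoord_of_gact {m : HKQuotient G c} {x y : levelSet G c} (hx : proj G c x = m)
    (hy : proj G c y = m) {g : G} (hg : gact G g x = y) (a : (assocBundle G χ hfree).Fib m) :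
    fibCoord χ hfree y hy a = χ g * fibCoord χ hfree x hx a :=
  assocCoord_of_gact (hfree := hfree) hx hy hg a

theorem fibCoord_pt_add {m : HKQuotient G c} (a b : (assocBundle G χ hfree).Fib m) :
    fibCoord χ hfree (pt G c m) (proj_pt G c m) (a + b)
      = fibCoord χ hfree (pt G c m) (proj_pt G c m) a
        + fibCoord χ hfree (pt G c m) (proj_pt G c m) b :=
  (assocCoord G χ hfree (pt G c m) (proj_pt G c m)).apply_symm_apply _

theorem fibCoord_pt_smul {m : HKQuotient G c} (z : ℂ) (a : (assocBundle G χ hfree).Fib m) :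
    fibCoord χ hfree (pt G c m) (proj_pt G c m) (z • a)
      = z * fibCoord χ hfree (pt G c m) (proj_pt G c m) a :=
  (assocCoord G χ hfree (pt G c m) (proj_pt G c m)).apply_symm_apply _

theorem fibCoord_add {m : HKQuotient G c} (x : levelSet G c) (hx : proj G c x = m)
    (a b : (assocBundle G χ hfree).Fib m) :
    fibCoord χ hfree x hx (a + b) = fibCoord χ hfree x hx a + fibCoord χ hfree x hx b := by
  obtain ⟨g, hg⟩ := proj_eq_iff.1 ((proj_pt G c m).trans hx.symm)
  have h := fibCoord_of_gact (χ := χ) (hfree := hfree) (proj_pt G c m) hx hg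
  rw [h, h, h, ← mul_add, fibCoord_pt_add]

theorem fibCoord_smul {m : HKQuotient G c} (x : levelSet G c) (hx : proj G c x = m)
    (z : ℂ) (a : (assocBundle G χ hfree).Fib m) :
    fibCoord χ hfree x hx (z • a) = z * fibCoord χ hfree x hx a := by
  obtain ⟨g, hg⟩ := proj_eq_iff.1 ((proj_pt G c m).trans hx.symm)
  have h := fibCoord_of_gact (χ := χ) (hfree := hfree) (proj_pt G c m) hx hg
  rw [h, h, mul_left_comm, fibCoord_pt_smul]

/-- The linear coordinate on a fibre of the associated bundle, as a linear equivalence. -/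
def fibEquiv (χ : G →* Circle) (hfree : ActsFreely G c) {m : HKQuotient G c} (x : levelSet G c)
    (hx : proj G c x = m) : (assocBundle G χ hfree).Fib m ≃ₗ[ℂ] ℂ :=
  { assocCoord G χ hfree x hx with
    map_add' := fibCoord_add x hx
    map_smul' := fibCoord_smul x hx }

theorem fibEquiv_assocMk {m : HKQuotient G c} (x : levelSet G c) (hx : proj G c x = m) (v : ℂ) :
    fibEquiv χ hfree x hx (assocMk G c χ x hx v) = v :=
  assocCoord_assocMk (hfree := hfree) x hx v

theorem fibEquiv_of_gact {m : HKQuotient G c} {x y : levelSet G c} (hx : proj G c x = m)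
    (hy : proj G c y = m) {g : G} (hg : gact G g x = y) (a : (assocBundle G χ hfree).Fib m) :
    fibEquiv χ hfree y hy a = χ g * fibEquiv χ hfree x hx a :=
  assocCoord_of_gact (hfree := hfree) hx hy hg a

/-- The equivariant function of a section. -/
def secFun (s : (assocBundle G χ hfree).Sec) (x : Hn n) : ℂ := sectionFun G χ hfree s x

theorem secFun_eq (s : (assocBundle G χ hfree).Sec) {m : HKQuotient G c} {x : Hn n}
    (hx : x ∈ levelSet G c) (h : proj G c ⟨x, hx⟩ = m) :
    secFun s x = fibEquiv χ hfree ⟨x, hx⟩ h (s m) := by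
  subst h
  exact dif_pos hx

theorem secFun_add (s t : (assocBundle G χ hfree).Sec) {x : Hn n} (hx : x ∈ levelSet G c) :
    secFun (fun m => s m + t m) x = secFun s x + secFun t x := by
  rw [secFun_eq _ hx rfl, secFun_eq _ hx rfl, secFun_eq _ hx rfl, map_add]

theorem secFun_smul (f : HKQuotient G c → ℂ) (s : (assocBundle G χ hfree).Sec) {x : Hn n}
    (hx : x ∈ levelSet G c) :
    secFun (fun m => f m • s m) x = f (proj G c ⟨x, hx⟩) * secFun s x := by
  rw [secFun_eq _ hx rfl, secFun_eq _ hx rfl, map_smul, smul_eq_mul]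

theorem secFun_congr {U : Set (HKQuotient G c)} {s t : (assocBundle G χ hfree).Sec}
    (h : ∀ m ∈ U, s m = t m) : Set.EqOn (secFun s) (secFun t) (levelOver U) := by
  rintro x ⟨hx, hxU⟩
  rw [secFun_eq _ hx rfl, secFun_eq _ hx rfl, h _ hxU]

theorem smoothOn_iff {U : Set (HKQuotient G c)} {s : (assocBundle G χ hfree).Sec} :
    (assocBundle G χ hfree).SmoothOn U s ↔ ContDiffOn ℝ ∞ (secFun s) (levelOver U) := Iff.rfl

theorem secFun_gact (hG : IsClosed (G : Set (Matrix.unitaryGroup (Fin n) ℂ)))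
    (hc : IsCoadInvariant G c) (s : (assocBundle G χ hfree).Sec) (g : G) {x : Hn n}
    (hx : x ∈ levelSet G c) : secFun s (gact G g x) = χ g * secFun s x := by
  rw [secFun_eq s (gact_mem_levelSet hG hc g hx) (proj_gact hG hc g hx), secFun_eq s hx rfl]
  exact fibEquiv_of_gact _ _ rfl _

theorem smoothOn_congr {U : Set (HKQuotient G c)} {s t : (assocBundle G χ hfree).Sec}
    (h : ∀ m ∈ U, s m = t m) (hs : (assocBundle G χ hfree).SmoothOn U s) :
    (assocBundle G χ hfree).SmoothOn U t :=
  smoothOn_iff.2 ((smoothOn_iff.1 hs).congr fun _ hx => (secFun_congr h hx).symm)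

theorem contDiffWithinAt_secFun {U : Set (HKQuotient G c)} (hU : IsOpen U)
    {s : (assocBundle G χ hfree).Sec} (hs : (assocBundle G χ hfree).SmoothOn U s) {x : Hn n}
    (hx : x ∈ levelOver U) : ContDiffWithinAt ℝ ∞ (secFun s) (levelSet G c) x :=
  ((smoothOn_iff.1 hs) x hx).mono_of_mem_nhdsWithin (levelOver_mem_nhdsWithin hU hx)

variable {d : ℕ} [ChartedSpace (EuclideanSpace ℝ (Fin d)) (HKQuotient G c)]

theorem IsLocSec.secFun_eq {V : Set (HKQuotient G c)} {σ : HKQuotient G c → Hn n}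
    (hσ : IsLocSec (d := d) V σ) (s : (assocBundle G χ hfree).Sec) {m : HKQuotient G c}
    (hm : m ∈ V) :
    secFun s (σ m) = fibEquiv χ hfree ⟨σ m, hσ.mem m hm⟩ (hσ.proj_eq m hm) (s m) :=
  _root_.secFun_eq s _ _

theorem IsLocSec.mem_levelOver {V : Set (HKQuotient G c)} {σ : HKQuotient G c → Hn n}
    (hσ : IsLocSec (d := d) V σ) {m : HKQuotient G c} (hm : m ∈ V) {U : Set (HKQuotient G c)}
    (hU : m ∈ U) : σ m ∈ levelOver U :=
  ⟨hσ.mem m hm, by rw [hσ.proj_eq m hm]; exact hU⟩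

theorem IsLocSec.contMDiffAt_secFun {V : Set (HKQuotient G c)} {σ : HKQuotient G c → Hn n}
    (hσ : IsLocSec (d := d) V σ) {U : Set (HKQuotient G c)} (hU : IsOpen U)
    {s : (assocBundle G χ hfree).Sec} (hs : (assocBundle G χ hfree).SmoothOn U s)
    {m : HKQuotient G c} (hm : m ∈ V) (hmU : m ∈ U) :
    ContMDiffAt (𝓡 d) 𝓘(ℝ, ℂ) ∞ (fun y => secFun s (σ y)) m := by
  have h1 : ContMDiffWithinAt 𝓘(ℝ, Hn n) 𝓘(ℝ, ℂ) ∞ (secFun s) (levelSet G c) (σ m) :=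
    (contDiffWithinAt_secFun hU hs (hσ.mem_levelOver hm hmU)).contMDiffWithinAt
  have h2 := h1.comp m (hσ.contMDiffAt hm).contMDiffWithinAt (s := V) (fun y hy => hσ.mem y hy)
  exact h2.contMDiffAt (hσ.isOpen.mem_nhds hm)

/-- The local frame of the associated bundle given by a local section of the principal bundle. -/
def IsLocSec.frame (χ : G →* Circle) (hfree : ActsFreely G c) {V : Set (HKQuotient G c)}
    {σ : HKQuotient G c → Hn n} (hσ : IsLocSec (d := d) V σ) : (assocBundle G χ hfree).Sec :=
  open Classical in fun m =>
    if hm : m ∈ V then (fibEquiv χ hfree ⟨σ m, hσ.mem m hm⟩ (hσ.proj_eq m hm)).symm 1 else 0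

theorem IsLocSec.secFun_frame {V : Set (HKQuotient G c)} {σ : HKQuotient G c → Hn n}
    (hσ : IsLocSec (d := d) V σ) {m : HKQuotient G c} (hm : m ∈ V) :
    secFun (hσ.frame χ hfree) (σ m) = 1 := by
  rw [hσ.secFun_eq _ hm, IsLocSec.frame, dif_pos hm, LinearEquiv.apply_symm_apply]

namespace SmoothReduction

variable (S : SmoothReduction G c d) (hdχ : HasDifferential G c χ)

include S hdχ

/-- Equivariance with an explicit exponential in place of χ: along the local product structure, the
group factor acts on f by a function visibly smooth in ξ. -/
theorem secFun_rep_exp (s : (assocBundle G χ hfree).Sec) {x : Hn n} (hx : x ∈ levelSet G c)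
    (ξ : LieW G) : secFun s (rep (NormedSpace.exp (lam G ξ)) x)
      = Complex.exp (Complex.I * cW c ξ) * secFun s x := by
  obtain ⟨g, hg1, hg2⟩ := exists_gact_of_mem (exp_mem_matSet S.closed (lam_mem ξ))
  rw [← hg2, secFun_gact S.closed S.invariant s g hx,
    character_exp S.closed hdχ ⟨lam G ξ, lam_mem ξ⟩ g hg1]
  rfl

/-- A section is smooth if it is smooth in the trivialisations given by local sections of the
principal bundle. -/
theorem smoothOn_of_locSec {U : Set (HKQuotient G c)} {s : (assocBundle G χ hfree).Sec}
    (h : ∀ m ∈ U, ∃ (V : Set (HKQuotient G c)) (σ : HKQuotient G c → Hn n),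
      IsLocSec (d := d) V σ ∧ m ∈ V ∧ ContMDiffAt (𝓡 d) 𝓘(ℝ, ℂ) ∞ (fun y => secFun s (σ y)) m) :
    (assocBundle G χ hfree).SmoothOn U s := by
  rw [smoothOn_iff]
  rintro x ⟨hx, hxU⟩
  obtain ⟨V, σ, hσ, hm, hs⟩ := h _ hxU
  set m := proj G c ⟨x, hx⟩ with hmdef
  obtain ⟨g, hg⟩ := proj_eq_iff.1 ((hσ.proj_eq m hm).trans hmdef)
  simp only at hg
  obtain ⟨ξ, hξ, hξ0, hev⟩ := S.exists_gauge hσ hm ⟨x, hx⟩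
  have hL := hσ.mem m hm
  have hQ := S.contMDiffOn_projExt ⟨x, hx⟩ (σ m) hL
  have hQm : projExt G c ⟨x, hx⟩ (σ m) = m := hσ.projExt_apply hm _
  have h1 : ContDiffWithinAt ℝ ∞ (fun y => secFun s (σ (projExt G c ⟨x, hx⟩ y)))
      (levelSet G c) (σ m) := by
    rw [← hQm] at hs
    exact (hs.comp_contMDiffWithinAt (σ m) hQ).contDiffWithinAt
  have h2 : ContDiffWithinAt ℝ ∞ (fun y => Complex.exp (Complex.I * cW c (ξ y)))
      (levelSet G c) (σ m) := by
    have h3 : ContDiffWithinAt ℝ ∞ (fun y => cW c (ξ y)) (levelSet G c) (σ m) :=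
      (cW c).contDiff.comp_contDiffWithinAt hξ
    have h4 : ContDiffWithinAt ℝ ∞ (fun y => ((cW c (ξ y) : ℝ) : ℂ)) (levelSet G c) (σ m) :=
      Complex.ofRealCLM.contDiff.comp_contDiffWithinAt h3
    exact (contDiffWithinAt_const.mul h4).cexp
  -- Near σ m the function of s is e^{ic(ξ(y))} times its values along the section, both smooth in
  -- y.
  have h5 : ContDiffWithinAt ℝ ∞ (secFun s) (levelSet G c) (σ m) := by
    refine (h2.mul h1).congr_of_eventuallyEq_of_mem ?_ hL
    filter_upwards [hev] with y hy
    have hz := hσ.mem _ hy.2.1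
    conv_lhs => rw [← hy.2.2]
    exact S.secFun_rep_exp hdχ s hz _
  have hginv : gact G g⁻¹ x = σ m := by rw [← hg, gact_inv]
  -- Smoothness is now known at σ m; a group element transports it to the given point x of the same
  -- orbit.
  have h6 : ContDiffWithinAt ℝ ∞ (fun y => secFun s (gact G g⁻¹ y)) (levelSet G c) x := by
    have h7 : ContDiff ℝ ∞ (gact G g⁻¹ : Hn n → Hn n) :=
      ((rep (((g⁻¹ : G) : Matrix.unitaryGroup (Fin n) ℂ) :
        Matrix (Fin n) (Fin n) ℂ)).restrictScalars ℝ).contDiff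
    rw [← hginv] at h5
    exact h5.comp x h7.contDiffWithinAt fun y hy => gact_mem_levelSet S.closed S.invariant _ hy
  have h8 : ContDiffWithinAt ℝ ∞ (secFun s) (levelSet G c) x := by
    refine (contDiffWithinAt_const (c := (χ g : ℂ)).mul h6).congr (fun y hy => ?_) ?_
    · rw [secFun_gact S.closed S.invariant s _ hy, ← mul_assoc, ← Circle.coe_mul, ← map_mul]
      simp
    · rw [secFun_gact S.closed S.invariant s _ hx, ← mul_assoc, ← Circle.coe_mul, ← map_mul]
      simp
  exact h8.mono (levelOver_subset U)

/-- The local frame is the section whose equivariant function is 1 along σ; in it, the coefficient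
of a section is its equivariant function restricted to σ. -/
theorem isLineBundle : IsLineBundle d (assocBundle G χ hfree) where
  rank_one m := by
    rw [(fibEquiv χ hfree (pt G c m) (proj_pt G c m)).finrank_eq, Module.finrank_self]
  congr U _ s t h hs := smoothOn_congr h hs
  mono U V _ _ hVU s hs :=
    smoothOn_iff.2 ((smoothOn_iff.1 hs).mono fun x ⟨hx, hxV⟩ => ⟨hx, hVU hxV⟩)
  glue U hU s h := by
    rw [smoothOn_iff]
    rintro x ⟨hx, hxU⟩
    obtain ⟨V, hV, hmV, -, hs⟩ := h _ hxU
    exact (contDiffWithinAt_secFun hV hs ⟨hx, hmV⟩).mono (levelOver_subset U)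
  frame m := by
    obtain ⟨V, σ, hσ, hm, -⟩ := S.exists_locSec (pt G c m)
    rw [proj_pt] at hm
    refine ⟨V, hσ.isOpen, hm, hσ.frame χ hfree, fun y hy h0 => ?_, fun W hW hWV f => ⟨fun h => ?_,
      fun h => ?_⟩⟩
    · have := hσ.secFun_frame (χ := χ) (hfree := hfree) hy
      rw [hσ.secFun_eq _ hy, h0, map_zero] at this
      exact zero_ne_one this
    · intro y hy
      have h1 := hσ.contMDiffAt_secFun hW h (hWV hy) hy
      refine (h1.congr_of_eventuallyEq ?_).contMDiffWithinAt
      filter_upwards [hW.mem_nhds hy] with z hz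
      rw [secFun_smul _ _ (hσ.mem z (hWV hz)), hσ.proj_eq z (hWV hz), hσ.secFun_frame (hWV hz),
        mul_one]
    · refine S.smoothOn_of_locSec hdχ fun y hy => ⟨V, σ, hσ, hWV hy, ?_⟩
      refine ((h y hy).contMDiffAt (hW.mem_nhds hy)).congr_of_eventuallyEq ?_
      filter_upwards [hW.mem_nhds hy] with z hz
      rw [secFun_smul _ _ (hσ.mem z (hWV hz)), hσ.proj_eq z (hWV hz), hσ.secFun_frame (hWV hz),
        mul_one]

end SmoothReduction

end AssociatedBundle

end

noncomputable section

/-! ### Exterior derivatives of 1-forms in charts. -/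

section ChartCalculus

open Filter

variable {d : ℕ} {M : Type} [TopologicalSpace M] [ChartedSpace (EuclideanSpace ℝ (Fin d)) M]
  {F : Type} [NormedAddCommGroup F] [NormedSpace ℝ F]

/-- The inverse of the chart at `m`. -/
def chartInv (d : ℕ) {M : Type} [TopologicalSpace M] [ChartedSpace (EuclideanSpace ℝ (Fin d)) M]
    (m : M) : EuclideanSpace ℝ (Fin d) → M := (extChartAt (𝓡 d) m).symm

/-- The coordinates of `m` in the chart at `m`. -/
def chartPt (d : ℕ) {M : Type} [TopologicalSpace M] [ChartedSpace (EuclideanSpace ℝ (Fin d)) M]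
    (m : M) : EuclideanSpace ℝ (Fin d) := extChartAt (𝓡 d) m m

/-- The differential of a vector valued function. -/
def mfd (d : ℕ) {M : Type} [TopologicalSpace M] [ChartedSpace (EuclideanSpace ℝ (Fin d)) M]
    {F : Type} [NormedAddCommGroup F] [NormedSpace ℝ F] (f : M → F) (m : M) :
    EuclideanSpace ℝ (Fin d) →L[ℝ] F := mfderiv (𝓡 d) 𝓘(ℝ, F) f m

/-- The coefficients of a 1-form in the chart at `m`. -/
def formCoeff (α : ∀ m : M, TangentSpace (𝓡 d) m → F) (m : M) (w y : EuclideanSpace ℝ (Fin d)) :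
    F :=
  α (chartInv d m y) (mfderiv 𝓘(ℝ, EuclideanSpace ℝ (Fin d)) (𝓡 d) (chartInv d m) y w)

theorem extD_eq (α : ∀ m : M, TangentSpace (𝓡 d) m → F) (m : M) (u v : EuclideanSpace ℝ (Fin d)) :
    extD α m u v = fderiv ℝ (formCoeff α m v) (chartPt d m) u
      - fderiv ℝ (formCoeff α m u) (chartPt d m) v := rfl

theorem chartInv_chartPt (m : M) : chartInv d m (chartPt d m) = m := extChartAt_to_inv m

theorem tendsto_chartInv (m : M) : Tendsto (chartInv d m) (𝓝 (chartPt d m)) (𝓝 m) := by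
  have := (continuousAt_extChartAt_symm (I := 𝓡 d) m).tendsto
  rwa [extChartAt_to_inv] at this

theorem extD_congr {α β : ∀ m : M, TangentSpace (𝓡 d) m → F} {m : M}
    (h : ∀ᶠ y in 𝓝 m, ∀ u : TangentSpace (𝓡 d) y, α y u = β y u)
    (u v : EuclideanSpace ℝ (Fin d)) : extD α m u v = extD β m u v := by
  have key : ∀ w, formCoeff α m w =ᶠ[𝓝 (chartPt d m)] formCoeff β m w := fun w =>
    ((tendsto_chartInv m).eventually h).mono fun y hy => hy _
  rw [extD_eq, extD_eq, (key u).fderiv_eq, (key v).fderiv_eq]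

theorem extD_add {α β : ∀ m : M, TangentSpace (𝓡 d) m → F} {m : M}
    (hα : ∀ w, DifferentiableAt ℝ (formCoeff α m w) (chartPt d m))
    (hβ : ∀ w, DifferentiableAt ℝ (formCoeff β m w) (chartPt d m))
    (u v : EuclideanSpace ℝ (Fin d)) :
    extD (fun y w => α y w + β y w) m u v = extD α m u v + extD β m u v := by
  have key : ∀ w, fderiv ℝ (formCoeff (fun y w => α y w + β y w) m w) (chartPt d m)
      = fderiv ℝ (formCoeff α m w) (chartPt d m) + fderiv ℝ (formCoeff β m w) (chartPt d m) :=
    fun w => fderiv_add (hα w) (hβ w)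
  simp only [extD_eq, key, add_apply]
  abel

theorem extD_clm {F' : Type} [NormedAddCommGroup F'] [NormedSpace ℝ F'] (T : F →L[ℝ] F')
    {α : ∀ m : M, TangentSpace (𝓡 d) m → F} {m : M}
    (hα : ∀ w, DifferentiableAt ℝ (formCoeff α m w) (chartPt d m))
    (u v : EuclideanSpace ℝ (Fin d)) :
    extD (fun y w => T (α y w)) m u v = T (extD α m u v) := by
  have key : ∀ w, fderiv ℝ (formCoeff (fun y w => T (α y w)) m w) (chartPt d m)
      = T ∘L fderiv ℝ (formCoeff α m w) (chartPt d m) :=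
    fun w => (T.hasFDerivAt.comp _ (hα w).hasFDerivAt).fderiv
  simp only [extD_eq, key, ContinuousLinearMap.comp_apply, map_sub]

variable [IsManifold (𝓡 d) ∞ M]

theorem eventually_contMDiffAt_chartInv (m : M) : ∀ᶠ y in 𝓝 (chartPt d m),
    ContMDiffAt 𝓘(ℝ, EuclideanSpace ℝ (Fin d)) (𝓡 d) ∞ (chartInv d m) y := by
  have h1 : (extChartAt (𝓡 d) m).target ∈ 𝓝 (chartPt d m) := extChartAt_target_mem_nhds m
  filter_upwards [eventually_mem_nhds_iff.2 h1] with y hy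
  exact (contMDiffOn_extChartAt_symm m).contMDiffAt hy

theorem contDiffAt_comp_chartInv {f : M → F} {m : M} (hf : ContMDiffAt (𝓡 d) 𝓘(ℝ, F) ∞ f m) :
    ContDiffAt ℝ ∞ (fun y => f (chartInv d m y)) (chartPt d m) := by
  rw [← chartInv_chartPt (d := d) m] at hf
  exact (hf.comp _ (eventually_contMDiffAt_chartInv m).self_of_nhds).contDiffAt

theorem fderiv_comp_chartInv {f : M → F} {m : M} {y : EuclideanSpace ℝ (Fin d)}
    (hy : ContMDiffAt 𝓘(ℝ, EuclideanSpace ℝ (Fin d)) (𝓡 d) ∞ (chartInv d m) y)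
    (hf : MDifferentiableAt (𝓡 d) 𝓘(ℝ, F) f (chartInv d m y)) (w : EuclideanSpace ℝ (Fin d)) :
    fderiv ℝ (fun y => f (chartInv d m y)) y w = mfd d f (chartInv d m y)
      (mfderiv 𝓘(ℝ, EuclideanSpace ℝ (Fin d)) (𝓡 d) (chartInv d m) y w) := by
  have h1 := mfderiv_comp y hf (hy.mdifferentiableAt (by simp))
  rw [← mfderiv_eq_fderiv]
  exact DFunLike.congr_fun h1 w

omit [IsManifold (𝓡 d) ∞ M] in
theorem fderiv_comp_chartInv_chartPt {f : M → F} {m : M}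
    (hf : MDifferentiableAt (𝓡 d) 𝓘(ℝ, F) f m) (w : EuclideanSpace ℝ (Fin d)) :
    fderiv ℝ (fun y => f (chartInv d m y)) (chartPt d m) w = mfd d f m w := by
  have h : mfd d f m = fderivWithin ℝ (writtenInExtChartAt (𝓡 d) 𝓘(ℝ, F) m f)
      (Set.range (𝓡 d)) (extChartAt (𝓡 d) m m) := if_pos hf
  rw [h]
  simp only [writtenInExtChartAt, extChartAt_model_space_eq_id, PartialEquiv.refl_coe,
    modelWithCornersSelf_coe, Set.range_id, fderivWithin_univ]
  rfl

/-- By the chain rule, the coefficients of df in the chart at m are ordinary partial derivatives.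
This holds on a neighbourhood, so it can be differentiated once more. -/
theorem eventually_formCoeff_mfderiv {f : M → F} {m : M}
    (hf : ∀ᶠ y in 𝓝 m, MDifferentiableAt (𝓡 d) 𝓘(ℝ, F) f y) :
    ∀ᶠ y in 𝓝 (chartPt d m), ∀ w : EuclideanSpace ℝ (Fin d),
      formCoeff (fun y u => mfd d f y u) m w y
        = fderiv ℝ (fun y => f (chartInv d m y)) y w := by
  filter_upwards [(tendsto_chartInv m).eventually hf, eventually_contMDiffAt_chartInv m]
    with y h1 h2 w
  exact (fderiv_comp_chartInv h2 h1 w).symm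

theorem hasFDerivAt_fderiv_apply {f : EuclideanSpace ℝ (Fin d) → F} {y : EuclideanSpace ℝ (Fin d)}
    (hf : ContDiffAt ℝ ∞ f y) (w : EuclideanSpace ℝ (Fin d)) :
    HasFDerivAt (fun y => fderiv ℝ f y w) ((fderiv ℝ (fderiv ℝ f) y).flip w) y := by
  have h1 : DifferentiableAt ℝ (fderiv ℝ f) y :=
    (hf.fderiv_right (m := ∞) le_rfl).differentiableAt (by simp)
  have h2 := h1.hasFDerivAt.clm_apply (hasFDerivAt_const w y)
  refine h2.congr_fderiv ?_
  ext v
  simp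

theorem fderiv_fderiv_comm {f : EuclideanSpace ℝ (Fin d) → F} {y : EuclideanSpace ℝ (Fin d)}
    (hf : ContDiffAt ℝ ∞ f y) (u v : EuclideanSpace ℝ (Fin d)) :
    fderiv ℝ (fderiv ℝ f) y u v = fderiv ℝ (fderiv ℝ f) y v u :=
  (hf.isSymmSndFDerivAt (by simpa using WithTop.coe_le_coe.2 (le_top (a := (2 : ℕ∞))))).eq u v

theorem differentiableAt_formCoeff_mfderiv {f : M → F} {m : M}
    (hf : ∀ᶠ y in 𝓝 m, ContMDiffAt (𝓡 d) 𝓘(ℝ, F) ∞ f y) (w : EuclideanSpace ℝ (Fin d)) :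
    DifferentiableAt ℝ (formCoeff (fun y u => mfd d f y u) m w)
      (chartPt d m) := by
  have h1 := eventually_formCoeff_mfderiv (hf.mono fun y hy => hy.mdifferentiableAt (by simp))
  exact (hasFDerivAt_fderiv_apply (contDiffAt_comp_chartInv hf.self_of_nhds)
    w).differentiableAt.congr_of_eventuallyEq (h1.mono fun y hy => hy w)

/-- d² = 0, by symmetry of the second derivative in the chart. -/
theorem extD_mfderiv {f : M → F} {m : M} (hf : ∀ᶠ y in 𝓝 m, ContMDiffAt (𝓡 d) 𝓘(ℝ, F) ∞ f y)
    (u v : EuclideanSpace ℝ (Fin d)) :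
    extD (fun y u => mfd d f y u) m u v = 0 := by
  have h1 := eventually_formCoeff_mfderiv (hf.mono fun y hy => hy.mdifferentiableAt (by simp))
  have h0 := contDiffAt_comp_chartInv hf.self_of_nhds
  have h2 : ∀ w, fderiv ℝ (formCoeff (fun y u => mfd d f y u) m w)
      (chartPt d m) = _ := fun w => (EventuallyEq.fderiv_eq (h1.mono fun y hy => hy w)).trans
        (hasFDerivAt_fderiv_apply h0 w).fderiv
  rw [extD_eq, h2, h2]
  simp only [ContinuousLinearMap.flip_apply]
  rw [fderiv_fderiv_comm h0, sub_self]

/-- The derivative of a smooth function along a smooth vector field is smooth. -/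
theorem contMDiffOn_mfderiv_apply {f : M → F} {U : Set M} (hU : IsOpen U)
    (hf : ContMDiffOn (𝓡 d) 𝓘(ℝ, F) ∞ f U) {X : ∀ m : M, TangentSpace (𝓡 d) m}
    (hX : ContMDiffOn (𝓡 d) (𝓡 d).tangent ∞ (fun m => (⟨m, X m⟩ : TangentBundle (𝓡 d) M)) U) :
    ContMDiffOn (𝓡 d) 𝓘(ℝ, F) ∞ (fun y => mfd d f y (X y)) U := by
  have h1 := hf.contMDiffOn_tangentMapWithin (m := ∞) le_rfl hU.uniqueMDiffOn
  have h2 := h1.comp hX (fun y hy => hy)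
  have h3 := (contMDiff_snd_tangentBundle_modelSpace F 𝓘(ℝ, F) (n := ∞)).comp_contMDiffOn h2
  refine h3.congr fun y hy => ?_
  have h4 := tangentMapWithin_eq_tangentMap (p := (⟨y, X y⟩ : TangentBundle (𝓡 d) M))
    (hU.uniqueMDiffOn y hy) ((hf.contMDiffAt (hU.mem_nhds hy)).mdifferentiableAt (by simp))
  exact (congrArg (fun p : TangentBundle 𝓘(ℝ, F) F => (p.2 : F)) h4).symm

/-- The coordinate vector field of the chart at `m` with constant coefficients `w`. -/
def coordField (m : M) (w : EuclideanSpace ℝ (Fin d)) (y : M) : TangentSpace (𝓡 d) y :=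
  mfderiv 𝓘(ℝ, EuclideanSpace ℝ (Fin d)) (𝓡 d) (chartInv d m) (extChartAt (𝓡 d) m y) w

theorem contMDiffOn_coordField (m : M) (w : EuclideanSpace ℝ (Fin d)) :
    ContMDiffOn (𝓡 d) (𝓡 d).tangent ∞
      (fun y => (⟨y, coordField m w y⟩ : TangentBundle (𝓡 d) M))
      (chartAt (EuclideanSpace ℝ (Fin d)) m).source := by
  have hT : IsOpen (extChartAt (𝓡 d) m).target := isOpen_extChartAt_target m
  have h0 := contMDiffOn_extChartAt_symm (I := 𝓡 d) (n := ∞) m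
  have h1 := h0.contMDiffOn_tangentMapWithin (m := ∞) le_rfl hT.uniqueMDiffOn
  have h2 : ContMDiff 𝓘(ℝ, EuclideanSpace ℝ (Fin d)) 𝓘(ℝ, EuclideanSpace ℝ (Fin d)).tangent ∞
      (fun y : EuclideanSpace ℝ (Fin d) => (⟨y, w⟩ : TangentBundle
        𝓘(ℝ, EuclideanSpace ℝ (Fin d)) (EuclideanSpace ℝ (Fin d)))) := fun y =>
    contMDiffAt_vectorSpace_iff_contDiffAt.2 contDiffAt_const
  have h3 := h2.comp_contMDiffOn (contMDiffOn_extChartAt (I := 𝓡 d) (n := ∞) (x := m))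
  have hmaps : ∀ y ∈ (chartAt (EuclideanSpace ℝ (Fin d)) m).source,
      extChartAt (𝓡 d) m y ∈ (extChartAt (𝓡 d) m).target := fun y hy =>
    (extChartAt (𝓡 d) m).map_source (by rwa [extChartAt_source])
  have h4 := h1.comp h3 hmaps
  refine h4.congr fun y hy => ?_
  have hinv : (extChartAt (𝓡 d) m).symm (extChartAt (𝓡 d) m y) = y :=
    (extChartAt (𝓡 d) m).left_inv (by rwa [extChartAt_source])
  simp only [Function.comp_apply]
  rw [tangentMapWithin_eq_tangentMap (hT.uniqueMDiffOn _ (hmaps y hy))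
    ((h0.contMDiffAt (hT.mem_nhds (hmaps y hy))).mdifferentiableAt (by simp))]
  simp only [tangentMap]
  refine Bundle.TotalSpace.ext hinv.symm ?_
  exact HEq.rfl

/-- Converts smoothness of a form on vector fields, which the axioms of a connection provide, into
differentiability of its chart coefficients, which `extD` needs. -/
theorem differentiableAt_formCoeff_of_coordField {α : ∀ m : M, TangentSpace (𝓡 d) m → F} {m : M}
    {w : EuclideanSpace ℝ (Fin d)}
    (h : ContMDiffAt (𝓡 d) 𝓘(ℝ, F) ∞ (fun y => α y (coordField m w y)) m) :
    DifferentiableAt ℝ (formCoeff α m w) (chartPt d m) := by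
  have h1 := (contDiffAt_comp_chartInv h).differentiableAt (by simp)
  refine h1.congr_of_eventuallyEq ?_
  have h2 : (extChartAt (𝓡 d) m).target ∈ 𝓝 (chartPt d m) := extChartAt_target_mem_nhds m
  filter_upwards [h2] with y hy
  have : extChartAt (𝓡 d) m (chartInv d m y) = y := (extChartAt (𝓡 d) m).right_inv hy
  rw [formCoeff, coordField, this]

end ChartCalculus

end

noncomputable section

/-! ### The family of metrics and connections between ∇ and ∇⁰. -/

section ScaledConnection

open Filter

variable {n : ℕ} {G : Subgroup (Matrix.unitaryGroup (Fin n) ℂ)} {c : lieAlg G →ₗ[ℝ] ℝ}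
  {χ : G →* Circle} {hfree : ActsFreely G c} {d : ℕ}
  [ChartedSpace (EuclideanSpace ℝ (Fin d)) (HKQuotient G c)]

/-- The metric `|[x, v]|² = e^{κ |x|² / 2} |v|²` on the associated bundle. -/
def scaledMetric (χ : G →* Circle) (hfree : ActsFreely G c) (κ : ℝ) (m : HKQuotient G c)
    (a b : (assocBundle G χ hfree).Fib m) : ℂ :=
  (Real.exp (κ * ‖(pt G c m : Hn n)‖ ^ 2 / 2) : ℂ) *
    (conj (fibEquiv χ hfree (pt G c m) (proj_pt G c m) a) *
      fibEquiv χ hfree (pt G c m) (proj_pt G c m) b)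

/-- The canonical connection, plus `κ` times the 1-form induced by `½ ∑ x̄ dx`. -/
def scaledConn (χ : G →* Circle) (hfree : ActsFreely G c) (d : ℕ)
    [ChartedSpace (EuclideanSpace ℝ (Fin d)) (HKQuotient G c)] (κ : ℝ) :
    CovDer d (assocBundle G χ hfree) :=
  fun s m u => assocMk G c χ (pt G c m) (proj_pt G c m)
    (fderivWithin ℝ (secFun s) (levelSet G c) (pt G c m : Hn n) (hl d (pt G c m) u)
      + κ * (inner ℂ (pt G c m : Hn n) (hl d (pt G c m) u) / 2) * secFun s (pt G c m : Hn n))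

theorem scaledMetric_zero : scaledMetric χ hfree 0 = assocMetric G χ hfree := by
  funext m a b
  simp only [scaledMetric, zero_mul, zero_div, Real.exp_zero, Complex.ofReal_one, one_mul]
  rfl

theorem scaledConn_zero : scaledConn χ hfree d 0 = canonicalConnection G χ hfree d := by
  funext s m u
  simp only [scaledConn, Complex.ofReal_zero, zero_mul, add_zero]
  rfl

/-- Independence of the representative: |χ(g)| = 1 and |gx| = |x|. -/
theorem scaledMetric_eq (κ : ℝ) {m : HKQuotient G c} {x : Hn n} (hx : x ∈ levelSet G c)
    (h : proj G c ⟨x, hx⟩ = m) (a b : (assocBundle G χ hfree).Fib m) :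
    scaledMetric χ hfree κ m a b = (Real.exp (κ * ‖x‖ ^ 2 / 2) : ℂ) *
      (conj (fibEquiv χ hfree ⟨x, hx⟩ h a) * fibEquiv χ hfree ⟨x, hx⟩ h b) := by
  obtain ⟨g, hg⟩ := proj_eq_iff.1 ((proj_pt G c m).trans h.symm)
  rw [fibEquiv_of_gact (proj_pt G c m) h hg a, fibEquiv_of_gact (proj_pt G c m) h hg b,
    scaledMetric]
  have h1 : ‖(pt G c m : Hn n)‖ ^ 2 = ‖x‖ ^ 2 := by
    rw [← real_inner_self_eq_norm_sq, ← real_inner_self_eq_norm_sq, ← inner_gact g]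
    exact congrArg₂ (inner ℝ) hg hg
  have h2 : conj (χ g : ℂ) * (χ g : ℂ) = 1 := by
    rw [mul_comm, Complex.mul_conj, Circle.normSq_coe]; simp
  rw [h1, map_mul]
  linear_combination (-(Real.exp (κ * ‖x‖ ^ 2 / 2) : ℂ) *
    (conj (fibEquiv χ hfree (pt G c m) (proj_pt G c m) a) *
      fibEquiv χ hfree (pt G c m) (proj_pt G c m) b)) * h2

theorem inner_complex_gact (g : G) (x y : Hn n) :
    inner ℂ (gact G g x) (gact G g y) = inner ℂ x y := by
  refine Complex.ext ?_ ?_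
  · rw [← real_inner_eq_re, ← real_inner_eq_re, inner_gact]
  · have h : ∀ x y : Hn n, (inner ℂ x y).im = inner ℝ (quat 0 x) y := fun x y => by
      change _ = inner ℝ (Complex.I • x) y
      rw [real_inner_eq_re, inner_smul_left]
      simp
    rw [h, h, quat_gact, inner_gact]

theorem inner_complex_eq (x y : Hn n) :
    inner ℂ x y = (inner ℝ x y : ℝ) + Complex.I * (inner ℝ (quat 0 x) y : ℝ) := by
  have h : inner ℝ (quat 0 x) y = (inner ℂ x y).im := by
    change inner ℝ (Complex.I • x) y = _
    rw [real_inner_eq_re, inner_smul_left]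
    simp
  rw [h, real_inner_eq_re]
  refine Complex.ext ?_ ?_ <;> simp

theorem hasDerivAt_secFun_curve {s : (assocBundle G χ hfree).Sec} {x v : Hn n}
    (hs : DifferentiableWithinAt ℝ (secFun s) (levelSet G c) x) {y : ℝ → Hn n}
    (hy : LevelCurve c y x v) :
    HasDerivAt (fun t => secFun s (y t)) (fderivWithin ℝ (secFun s) (levelSet G c) x v) 0 := by
  have h3 := hs.hasFDerivWithinAt
  rw [← hy.1] at h3
  have := (h3.comp_hasDerivWithinAt (0 : ℝ) hy.2.2.hasDerivWithinAt
      (Set.mapsTo_preimage y _)).hasDerivAt hy.2.1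
  rwa [hy.1] at this

theorem differentiableWithinAt_secFun {U : Set (HKQuotient G c)} (hU : IsOpen U)
    {s : (assocBundle G χ hfree).Sec} (hs : (assocBundle G χ hfree).SmoothOn U s) {x : Hn n}
    (hx : x ∈ levelOver U) : DifferentiableWithinAt ℝ (secFun s) (levelSet G c) x :=
  (contDiffWithinAt_secFun hU hs hx).differentiableWithinAt (by simp)

theorem fibEquiv_symm_eq {m : HKQuotient G c} {x : levelSet G c} {hx : proj G c x = m}
    {a b : (assocBundle G χ hfree).Fib m}
    (h : fibEquiv χ hfree x hx a = fibEquiv χ hfree x hx b) : a = b :=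
  (fibEquiv χ hfree x hx).injective h

theorem hasDerivAt_mfd {F : Type} [NormedAddCommGroup F] [NormedSpace ℝ F] {f : HKQuotient G c → F}
    {m : HKQuotient G c} (hf : ContMDiffAt (𝓡 d) 𝓘(ℝ, F) ∞ f m) {γ : ℝ → HKQuotient G c}
    {u : EuclideanSpace ℝ (Fin d)} (hγ : HasVelocity d γ m u) :
    HasDerivAt (fun t => f (γ t)) (mfd d f m u) 0 :=
  hγ.hasDerivAt_comp (hf.mdifferentiableAt (by simp))

theorem contMDiffAt_complex_mul {f g : HKQuotient G c → ℂ} {m : HKQuotient G c}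
    (hf : ContMDiffAt (𝓡 d) 𝓘(ℝ, ℂ) ∞ f m) (hg : ContMDiffAt (𝓡 d) 𝓘(ℝ, ℂ) ∞ g m) :
    ContMDiffAt (𝓡 d) 𝓘(ℝ, ℂ) ∞ (fun y => f y * g y) m := by
  have h : ContDiff ℝ ∞ (fun p : ℂ × ℂ => p.1 * p.2) := contDiff_fst.mul contDiff_snd
  exact (h.contMDiff _).comp m (hf.prodMk_space hg)

/-- The connection form of `scaledConn` in the trivialisation given by a local section. -/
def connForm (σ : HKQuotient G c → Hn n) (d : ℕ)
    [ChartedSpace (EuclideanSpace ℝ (Fin d)) (HKQuotient G c)] (κ : ℝ) (m : HKQuotient G c)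
    (u : EuclideanSpace ℝ (Fin d)) : ℂ :=
  κ * (inner ℂ (σ m) (dsec d σ m u) / 2)
    - Complex.I * ((1 - κ) * cW c (theta G (σ m) (dsec d σ m u)) : ℝ)

theorem fibEquiv_scaledConn_pt (κ : ℝ) (s : (assocBundle G χ hfree).Sec) (m : HKQuotient G c)
    (u : EuclideanSpace ℝ (Fin d)) :
    fibEquiv χ hfree (pt G c m) (proj_pt G c m) (scaledConn χ hfree d κ s m u)
      = fderivWithin ℝ (secFun s) (levelSet G c) (pt G c m : Hn n) (hl d (pt G c m) u)
      + κ * (inner ℂ (pt G c m : Hn n) (hl d (pt G c m) u) / 2) * secFun s (pt G c m : Hn n) :=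
  fibEquiv_assocMk _ _ _

namespace SmoothReduction

variable (S : SmoothReduction G c d) (hdχ : HasDifferential G c χ)

include S

/-- The real part vanishes because ξ is skew, and the imaginary part is the moment map equation.
This links the term ⟨x,·⟩ of the connection to the character. -/
theorem inner_complex_act {x : Hn n} (hx : x ∈ levelSet G c) (ξ : LieW G) :
    inner ℂ x (rep (lam G ξ) x) = -2 * Complex.I * cW c ξ := by
  rw [inner_complex_eq, inner_act_self S.closed, inner_I_act hx]
  push_cast
  ring

theorem fderivWithin_gact {U : Set (HKQuotient G c)} (hU : IsOpen U)
    {s : (assocBundle G χ hfree).Sec} (hs : (assocBundle G χ hfree).SmoothOn U s) {x : Hn n}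
    (hx : x ∈ levelOver U) (g : G) {v : Hn n} (hv : v ∈ tangentSub G x) :
    fderivWithin ℝ (secFun s) (levelSet G c) (gact G g x) (gact G g v)
      = χ g * fderivWithin ℝ (secFun s) (levelSet G c) x v := by
  obtain ⟨hxL, hxU⟩ := id hx
  obtain ⟨y, hy⟩ := S.exists_levelCurve hxL hv
  have h1 := hasDerivAt_secFun_curve (differentiableWithinAt_secFun hU hs hx) hy
  have hgx : gact G g x ∈ levelOver U :=
    ⟨gact_mem_levelSet S.closed S.invariant g hxL, by
      rw [proj_gact S.closed S.invariant g hxL]; exact hxU⟩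
  have h2 := hasDerivAt_secFun_curve (differentiableWithinAt_secFun hU hs hgx)
    (hy.gact S.closed S.invariant g)
  refine h2.unique ((h1.const_mul (χ g : ℂ)).congr_of_eventuallyEq ?_)
  filter_upwards [hy.2.1] with t ht
  exact secFun_gact S.closed S.invariant s g ht

/-- The connection is defined at one representative of each orbit; since f, its derivative and ⟨x,
u^H⟩ are equivariant, the same formula holds at every representative. -/
theorem fibEquiv_scaledConn (κ : ℝ) {U : Set (HKQuotient G c)} (hU : IsOpen U)
    {s : (assocBundle G χ hfree).Sec} (hs : (assocBundle G χ hfree).SmoothOn U s)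
    {m : HKQuotient G c} (hm : m ∈ U) {x : Hn n} (hx : x ∈ levelSet G c)
    (h : proj G c ⟨x, hx⟩ = m) (u : EuclideanSpace ℝ (Fin d)) :
    fibEquiv χ hfree ⟨x, hx⟩ h (scaledConn χ hfree d κ s m u)
      = fderivWithin ℝ (secFun s) (levelSet G c) x (hl d ⟨x, hx⟩ u)
        + κ * (inner ℂ x (hl d ⟨x, hx⟩ u) / 2) * secFun s x := by
  obtain ⟨g, hg⟩ := proj_eq_iff.1 ((proj_pt G c m).trans h.symm)
  simp only at hg
  subst hg
  have hp : (pt G c m : Hn n) ∈ levelOver U := ⟨(pt G c m).2, by rw [Subtype.coe_eta, proj_pt]; exact hm⟩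
  have h1 : hl d ⟨gact G g (pt G c m), hx⟩ u = gact G g (hl d (pt G c m) u) :=
    S.hl_gact g (pt G c m).2 u
  rw [fibEquiv_of_gact (proj_pt G c m) h rfl, fibEquiv_scaledConn_pt, h1,
    S.fderivWithin_gact hU hs hp g (horSub_le_tangentSub _ (S.hl_mem (pt G c m).2 u)),
    inner_complex_gact, secFun_gact S.closed S.invariant s g (pt G c m).2]
  ring

include hdχ

/-- The infinitesimal form of f(gx) = χ(g)f(x), with dχ = ic. -/
theorem fderivWithin_act {s : (assocBundle G χ hfree).Sec} {x : Hn n} (hx : x ∈ levelSet G c)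
    (hs : DifferentiableWithinAt ℝ (secFun s) (levelSet G c) x) (ξ : LieW G) :
    fderivWithin ℝ (secFun s) (levelSet G c) x (rep (lam G ξ) x)
      = Complex.I * cW c ξ * secFun s x := by
  have h1 := hasDerivAt_secFun_curve hs (S.levelCurve_exp hx ξ)
  have h2 : HasDerivAt (fun t : ℝ => Complex.exp (Complex.I * (t * cW c ξ : ℝ)) * secFun s x)
      (Complex.I * cW c ξ * secFun s x) 0 := by
    have h3 : HasDerivAt (fun t : ℝ => Complex.I * ((t * cW c ξ : ℝ) : ℂ))
        (Complex.I * cW c ξ) 0 := by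
      have := (((hasDerivAt_id (0 : ℝ)).mul_const (cW c ξ)).ofReal_comp).const_mul Complex.I
      simpa using this
    have h4 := h3.cexp.mul_const (secFun s x)
    simpa using h4
  refine h1.unique (h2.congr_of_eventuallyEq (Eventually.of_forall fun t => ?_))
  have h5 := S.secFun_rep_exp hdχ s hx (t • ξ)
  rw [map_smul, map_smul, smul_eq_mul] at h5
  exact h5

/-- With u^H = dσ(u) − θx, the vertical part contributes −ic(θ) through the equivariance of f, and
+iκc(θ) through ½κ⟨x, −θx⟩; hence the factor 1 − κ in `connForm`. -/
theorem fibEquiv_scaledConn_sec (κ : ℝ) {U : Set (HKQuotient G c)} (hU : IsOpen U)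
    {s : (assocBundle G χ hfree).Sec} (hs : (assocBundle G χ hfree).SmoothOn U s)
    {V : Set (HKQuotient G c)} {σ : HKQuotient G c → Hn n} (hσ : IsLocSec (d := d) V σ)
    {m : HKQuotient G c} (hm : m ∈ U) (hmV : m ∈ V) (u : EuclideanSpace ℝ (Fin d)) :
    fibEquiv χ hfree ⟨σ m, hσ.mem m hmV⟩ (hσ.proj_eq m hmV) (scaledConn χ hfree d κ s m u)
      = mfd d (fun y => secFun s (σ y)) m u + connForm σ d κ m u * secFun s (σ m) := by
  have hx := hσ.mem m hmV
  have hd := differentiableWithinAt_secFun hU hs (hσ.mem_levelOver hmV hm)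
  have h1 : fderivWithin ℝ (secFun s) (levelSet G c) (σ m) (dsec d σ m u)
      = mfd d (fun y => secFun s (σ y)) m u := by
    obtain ⟨γ, hγ⟩ := exists_hasVelocity m u
    exact (hasDerivAt_secFun_curve hd (hσ.levelCurve hmV hγ)).unique
      (hγ.hasDerivAt_comp ((hσ.contMDiffAt_secFun hU hs hmV hm).mdifferentiableAt (by simp)))
  rw [S.fibEquiv_scaledConn κ hU hs hm hx, S.hl_sec hσ hmV, map_sub, h1,
    S.fderivWithin_act hdχ hx hd, inner_sub_right, S.inner_complex_act hx, connForm]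
  push_cast
  ring

omit hdχ in
theorem contMDiffAt_connForm (κ : ℝ) [IsManifold (𝓡 d) ∞ (HKQuotient G c)]
    {V : Set (HKQuotient G c)} {σ : HKQuotient G c → Hn n}
    (hσ : IsLocSec (d := d) V σ) {U : Set (HKQuotient G c)} (hU : IsOpen U)
    {X : ∀ m : HKQuotient G c, TangentSpace (𝓡 d) m}
    (hX : ContMDiffOn (𝓡 d) (𝓡 d).tangent ∞
      (fun m => (⟨m, X m⟩ : TangentBundle (𝓡 d) (HKQuotient G c))) U)
    {m : HKQuotient G c} (hm : m ∈ U) (hmV : m ∈ V) :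
    ContMDiffAt (𝓡 d) 𝓘(ℝ, ℂ) ∞ (fun y => connForm σ d κ y (X y)) m := by
  have hUV := hU.inter hσ.isOpen
  have h1 : ContMDiffAt (𝓡 d) 𝓘(ℝ, Hn n) ∞ (fun y => dsec d σ y (X y)) m :=
    (contMDiffOn_mfderiv_apply hUV (hσ.smooth.mono Set.inter_subset_right)
      (hX.mono Set.inter_subset_left)).contMDiffAt (hUV.mem_nhds ⟨hm, hmV⟩)
  have h2 : ContMDiffAt (𝓡 d) 𝓘(ℝ, Hn n × Hn n) ∞ (fun y => (σ y, dsec d σ y (X y))) m :=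
    (hσ.contMDiffAt hmV).prodMk_space h1
  have h3 : ContDiffAt ℝ ∞ (fun p : Hn n × Hn n => (κ : ℂ) * (inner ℂ p.1 p.2 / 2)
      - Complex.I * ((1 - κ) * cW c (theta G p.1 p.2) : ℝ)) (σ m, dsec d σ m (X m)) := by
    have h4 : ContDiff ℝ ∞ (fun p : Hn n × Hn n => inner ℂ p.1 p.2) :=
      contDiff_fst.inner ℂ contDiff_snd
    have h5 := (cW c).contDiff.comp_contDiffAt (σ m, dsec d σ m (X m))
      (contDiffAt_theta_uncurry S.closed S.free (hσ.mem m hmV) (dsec d σ m (X m)))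
    have h6 := Complex.ofRealCLM.contDiff.comp_contDiffAt (σ m, dsec d σ m (X m))
      ((contDiffAt_const (c := 1 - κ)).mul h5)
    exact (contDiffAt_const.mul (h4.contDiffAt.div_const 2)).sub (contDiffAt_const.mul h6)
  exact h3.contMDiffAt.comp m h2

omit hdχ in
theorem isHermitianMetric_scaledMetric (κ : ℝ) :
    IsHermitianMetric d (assocBundle G χ hfree) (scaledMetric χ hfree κ) where
  add_right m a b b' := by simp only [scaledMetric, map_add]; ring
  smul_right m z a b := by simp only [scaledMetric, map_smul, smul_eq_mul]; ring
  symm m a b := by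
    simp only [scaledMetric, map_mul, Complex.conj_ofReal, Complex.conj_conj]
    ring
  pos m a ha := by
    have h : fibEquiv χ hfree (pt G c m) (proj_pt G c m) a ≠ 0 := by
      rwa [Ne, LinearEquiv.map_eq_zero_iff]
    rw [scaledMetric, mul_comm (conj _), Complex.mul_conj, ← Complex.ofReal_mul,
      Complex.ofReal_re]
    exact mul_pos (Real.exp_pos _) (Complex.normSq_pos.2 h)
  smooth U hU s t hs ht := by
    intro m hm
    obtain ⟨V, σ, hσ, hmV, -⟩ := S.exists_locSec (pt G c m)
    rw [proj_pt] at hmV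
    have h1 := hσ.contMDiffAt_secFun hU hs hmV hm
    have h2 := hσ.contMDiffAt_secFun hU ht hmV hm
    have h3 : ContDiff ℝ ∞ (fun p : Hn n × ℂ × ℂ => (Real.exp (κ * ‖p.1‖ ^ 2 / 2) : ℂ) *
        (conj p.2.1 * p.2.2)) := by
      have h4 : ContDiff ℝ ∞ (fun p : Hn n × ℂ × ℂ => Real.exp (κ * ‖p.1‖ ^ 2 / 2)) :=
        ((contDiff_const.mul (contDiff_fst.norm_sq ℝ)).div_const 2).exp
      have h5 : ContDiff ℝ ∞ (fun p : Hn n × ℂ × ℂ => conj p.2.1) :=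
        Complex.conjCLE.contDiff.comp (contDiff_fst.comp contDiff_snd)
      exact (Complex.ofRealCLM.contDiff.comp h4).mul (h5.mul (contDiff_snd.comp contDiff_snd))
    have h6 := (h3.contMDiff _).comp m
      ((hσ.contMDiffAt hmV).prodMk_space (h1.prodMk_space h2))
    refine (h6.congr_of_eventuallyEq ?_).contMDiffWithinAt
    filter_upwards [hσ.isOpen.mem_nhds hmV] with y hy
    rw [scaledMetric_eq κ (hσ.mem y hy) (hσ.proj_eq y hy), Function.comp_apply,
      hσ.secFun_eq s hy, hσ.secFun_eq t hy]

omit S hdχ in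
-- Only the real part of ½κ⟨σ,dσ⟩ survives, and it is half the logarithmic derivative of
-- e^{κ|σ|²/2}: the connection preserves the scaled metric.
theorem re_connForm (κ : ℝ) (σ : HKQuotient G c → Hn n) (m : HKQuotient G c) (u : EuclideanSpace ℝ (Fin d)) :
    connForm (c := c) σ d κ m u + conj (connForm σ d κ m u)
      = ((κ * inner ℝ (σ m) (dsec d σ m u) : ℝ) : ℂ) := by
  rw [Complex.add_conj, connForm, inner_complex_eq]
  congr 1
  simp
  ring

/-- Each axiom is checked in a trivialisation σ, where the connection is d plus `connForm`. -/
theorem isUnitaryConnection_scaledConn (κ : ℝ) [IsManifold (𝓡 d) ∞ (HKQuotient G c)] :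
    IsUnitaryConnection (assocBundle G χ hfree) (scaledMetric χ hfree κ)
      (scaledConn χ hfree d κ) := by
  have key : ∀ m : HKQuotient G c, ∃ (V : Set (HKQuotient G c)) (σ : HKQuotient G c → Hn n)
      (_ : IsLocSec (d := d) V σ), m ∈ V := fun m => by
    obtain ⟨V, σ, hσ, hmV, -⟩ := S.exists_locSec (pt G c m)
    exact ⟨V, σ, hσ, by rwa [proj_pt] at hmV⟩
  have conn_add : ∀ σ m (u v : EuclideanSpace ℝ (Fin d)),
      connForm σ d κ m (u + v) = connForm (c := c) σ d κ m u + connForm σ d κ m v := by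
    intro σ m u v
    simp only [connForm, map_add, inner_add_right, theta_add]
    push_cast
    ring
  have conn_smul : ∀ σ m (r : ℝ) (u : EuclideanSpace ℝ (Fin d)),
      connForm σ d κ m (r • u) = r * connForm (c := c) σ d κ m u := by
    intro σ m r u
    simp only [connForm, map_smul, theta_smul, inner_complex_eq, inner_smul_right, smul_eq_mul]
    push_cast
    ring
  refine ⟨?_, ?_, ?_, ?_, ?_, ?_, ?_⟩
  · intro U hU s t hs hst m hm (u : EuclideanSpace ℝ (Fin d))
    obtain ⟨V, σ, hσ, hmV⟩ := key m
    have ht := smoothOn_congr hst hs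
    refine fibEquiv_symm_eq (hx := hσ.proj_eq m hmV) ?_
    have h1 : (fun y => secFun s (σ y)) =ᶠ[𝓝 m] fun y => secFun t (σ y) := by
      filter_upwards [(hU.inter hσ.isOpen).mem_nhds ⟨hm, hmV⟩] with y hy
      exact secFun_congr hst (hσ.mem_levelOver hy.2 hy.1)
    have h2 : mfd d (fun y => secFun s (σ y)) m = mfd d (fun y => secFun t (σ y)) m :=
      h1.mfderiv_eq
    have h3 : secFun s (σ m) = secFun t (σ m) := h1.self_of_nhds
    rw [S.fibEquiv_scaledConn_sec hdχ κ hU hs hσ hm hmV,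
      S.fibEquiv_scaledConn_sec hdχ κ hU ht hσ hm hmV, h2, h3]
  · intro U hU s hs m hm (u : EuclideanSpace ℝ (Fin d)) (v : EuclideanSpace ℝ (Fin d))
    obtain ⟨V, σ, hσ, hmV⟩ := key m
    refine fibEquiv_symm_eq (hx := hσ.proj_eq m hmV) ?_
    refine (S.fibEquiv_scaledConn_sec hdχ κ hU hs hσ hm hmV (u + v)).trans ?_
    rw [map_add, map_add, conn_add, S.fibEquiv_scaledConn_sec hdχ κ hU hs hσ hm hmV,
      S.fibEquiv_scaledConn_sec hdχ κ hU hs hσ hm hmV]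
    ring
  · intro U hU s hs m hm r (u : EuclideanSpace ℝ (Fin d))
    obtain ⟨V, σ, hσ, hmV⟩ := key m
    refine fibEquiv_symm_eq (hx := hσ.proj_eq m hmV) ?_
    refine (S.fibEquiv_scaledConn_sec hdχ κ hU hs hσ hm hmV (r • u)).trans ?_
    rw [map_smul, map_smul, conn_smul, S.fibEquiv_scaledConn_sec hdχ κ hU hs hσ hm hmV,
      smul_eq_mul, Complex.real_smul]
    ring
  · intro U hU s t hs ht m hm (u : EuclideanSpace ℝ (Fin d))
    obtain ⟨V, σ, hσ, hmV⟩ := key m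
    obtain ⟨γ, hγ⟩ := exists_hasVelocity m u
    refine fibEquiv_symm_eq (hx := hσ.proj_eq m hmV) ?_
    have hst : (assocBundle G χ hfree).SmoothOn U (fun y => s y + t y) := by
      rw [smoothOn_iff] at hs ht ⊢
      exact (hs.add ht).congr fun x hx => secFun_add s t hx.1
    have h1 := hasDerivAt_mfd (hσ.contMDiffAt_secFun hU hs hmV hm) hγ
    have h2 := hasDerivAt_mfd (hσ.contMDiffAt_secFun hU ht hmV hm) hγ
    have h3 := hasDerivAt_mfd (hσ.contMDiffAt_secFun hU hst hmV hm) hγ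
    have h4 : mfd d (fun y => secFun (fun z => s z + t z) (σ y)) m u
        = mfd d (fun y => secFun s (σ y)) m u + mfd d (fun y => secFun t (σ y)) m u := by
      refine h3.unique ((h1.add h2).congr_of_eventuallyEq ?_)
      filter_upwards [hσ.eventually_mem hmV hγ] with y hy
      exact secFun_add s t (hσ.mem _ hy)
    rw [map_add, S.fibEquiv_scaledConn_sec hdχ κ hU hs hσ hm hmV,
      S.fibEquiv_scaledConn_sec hdχ κ hU ht hσ hm hmV,
      S.fibEquiv_scaledConn_sec hdχ κ hU hst hσ hm hmV, h4, secFun_add s t (hσ.mem m hmV)]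
    ring
  · intro U hU f s hf hs m hm (u : EuclideanSpace ℝ (Fin d))
    obtain ⟨V, σ, hσ, hmV⟩ := key m
    obtain ⟨γ, hγ⟩ := exists_hasVelocity m u
    refine fibEquiv_symm_eq (hx := hσ.proj_eq m hmV) ?_
    have hfs : (assocBundle G χ hfree).SmoothOn U (fun y => f y • s y) := by
      refine S.smoothOn_of_locSec hdχ fun y hy => ?_
      obtain ⟨V', σ', hσ', hyV⟩ := key y
      refine ⟨V', σ', hσ', hyV, ?_⟩
      have h1 := contMDiffAt_complex_mul (hf.contMDiffAt (hU.mem_nhds hy))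
        (hσ'.contMDiffAt_secFun hU hs hyV hy)
      refine h1.congr_of_eventuallyEq ?_
      filter_upwards [hσ'.isOpen.mem_nhds hyV] with z hz
      rw [secFun_smul _ _ (hσ'.mem z hz), hσ'.proj_eq z hz]
    have h1 := hasDerivAt_mfd (hσ.contMDiffAt_secFun hU hs hmV hm) hγ
    have h2 := hasDerivAt_mfd (hf.contMDiffAt (hU.mem_nhds hm)) hγ
    have h3 := hasDerivAt_mfd (hσ.contMDiffAt_secFun hU hfs hmV hm) hγ
    have h4 : mfd d (fun y => secFun (fun z => f z • s z) (σ y)) m u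
        = mfd d f m u * secFun s (σ m) + f m * mfd d (fun y => secFun s (σ y)) m u := by
      have h5 := h2.mul h1
      simp only [hγ.1] at h5
      refine h3.unique (h5.congr_of_eventuallyEq ?_)
      filter_upwards [hσ.eventually_mem hmV hγ] with y hy
      simp only [Pi.mul_apply]
      rw [secFun_smul f s (hσ.mem _ hy), hσ.proj_eq _ hy]
    have h6 : dC f m u = mfd d f m u := rfl
    rw [map_add, map_smul, map_smul, S.fibEquiv_scaledConn_sec hdχ κ hU hs hσ hm hmV,
      S.fibEquiv_scaledConn_sec hdχ κ hU hfs hσ hm hmV, h4, secFun_smul f s (hσ.mem m hmV),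
      hσ.proj_eq m hmV, ← hσ.secFun_eq s hmV, h6, smul_eq_mul, smul_eq_mul]
    ring
  · intro U hU s X hs hX
    refine S.smoothOn_of_locSec hdχ fun m hm => ?_
    obtain ⟨V, σ, hσ, hmV⟩ := key m
    refine ⟨V, σ, hσ, hmV, ?_⟩
    have hUV := hU.inter hσ.isOpen
    have h1 : ContMDiffAt (𝓡 d) 𝓘(ℝ, ℂ) ∞ (fun y => mfd d (fun y => secFun s (σ y)) y (X y)) m :=
      (contMDiffOn_mfderiv_apply hUV (fun y hy =>
        (hσ.contMDiffAt_secFun hU hs hy.2 hy.1).contMDiffWithinAt)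
        (hX.mono Set.inter_subset_left)).contMDiffAt (hUV.mem_nhds ⟨hm, hmV⟩)
    have h2 := h1.add (contMDiffAt_complex_mul (S.contMDiffAt_connForm κ hσ hU hX hm hmV)
      (hσ.contMDiffAt_secFun hU hs hmV hm))
    refine h2.congr_of_eventuallyEq ?_
    filter_upwards [hUV.mem_nhds ⟨hm, hmV⟩] with y hy
    rw [hσ.secFun_eq _ hy.2]
    exact S.fibEquiv_scaledConn_sec hdχ κ hU hs hσ hy.1 hy.2 (X y)
  · intro U hU s t hs ht m hm (u : EuclideanSpace ℝ (Fin d))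
    obtain ⟨V, σ, hσ, hmV⟩ := key m
    obtain ⟨γ, hγ⟩ := exists_hasVelocity m u
    have h0 := hasDerivAt_mfd (((S.isHermitianMetric_scaledMetric κ).smooth U hU s t hs
      ht).contMDiffAt (hU.mem_nhds hm)) hγ
    have h1 := hasDerivAt_mfd (hσ.contMDiffAt_secFun hU hs hmV hm) hγ
    have h2 := hasDerivAt_mfd (hσ.contMDiffAt_secFun hU ht hmV hm) hγ
    have h3 : HasDerivAt (fun τ => conj (secFun s (σ (γ τ))))
        (conj (mfd d (fun y => secFun s (σ y)) m u)) 0 := h1.star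
    have h4 : HasDerivAt (fun τ => ((Real.exp (κ * ‖σ (γ τ)‖ ^ 2 / 2) : ℝ) : ℂ))
        ((Real.exp (κ * ‖σ m‖ ^ 2 / 2) * (κ * inner ℝ (σ m) (dsec d σ m u)) : ℝ) : ℂ) 0 := by
      have h5 := (((hσ.levelCurve hmV hγ).2.2.norm_sq.const_mul κ).div_const 2).exp.ofReal_comp
      simp only [hγ.1] at h5
      refine h5.congr_deriv ?_
      congr 2
      ring
    have h6 := h4.mul (h3.mul h2)
    -- Along σ the hermitian product of two sections is the explicit e^{κ|σ|²/2} f̄g, with f and g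
    -- the functions of s and t.
    have h7 := h0.unique (h6.congr_of_eventuallyEq (by
      filter_upwards [hσ.eventually_mem hmV hγ] with y hy
      simp only [Pi.mul_apply]
      rw [scaledMetric_eq κ (hσ.mem _ hy) (hσ.proj_eq _ hy), hσ.secFun_eq s hy,
        hσ.secFun_eq t hy]))
    simp only [Pi.mul_apply, hγ.1] at h7
    refine h7.trans ?_
    rw [scaledMetric_eq κ (hσ.mem m hmV) (hσ.proj_eq m hmV),
      scaledMetric_eq κ (hσ.mem m hmV) (hσ.proj_eq m hmV),
      S.fibEquiv_scaledConn_sec hdχ κ hU hs hσ hm hmV,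
      S.fibEquiv_scaledConn_sec hdχ κ hU ht hσ hm hmV, ← hσ.secFun_eq s hmV,
      ← hσ.secFun_eq t hmV, map_add, map_mul, Complex.ofReal_mul, ← re_connForm (c := c)]
    ring

end SmoothReduction

end ScaledConnection

end

noncomputable section

/-! ### The lift of the circle action. -/

section Lift

open Filter

variable {n : ℕ} {G : Subgroup (Matrix.unitaryGroup (Fin n) ℂ)} {c : lieAlg G →ₗ[ℝ] ℝ}
  {χ : G →* Circle} {hfree : ActsFreely G c} {d : ℕ}
  [ChartedSpace (EuclideanSpace ℝ (Fin d)) (HKQuotient G c)]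

theorem proj_circle_smul_pt (t : Circle) (m : HKQuotient G c) :
    proj G c ⟨(t : ℂ) • (pt G c m : Hn n), smul_mem_levelSet G c t (pt G c m).2⟩
      = circleAct G c t m :=
  congrArg (circleAct G c t) (proj_pt G c m)

/-- The lift `[x, v] ↦ [e^{iθ} x, v]` of the circle action to the associated bundle. -/
def liftAct (χ : G →* Circle) (hfree : ActsFreely G c) (t : Circle)
    (a : (assocBundle G χ hfree).Tot) : (assocBundle G χ hfree).Tot :=
  ⟨circleAct G c t a.1, (fibEquiv χ hfree _ (proj_circle_smul_pt t a.1)).symm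
    (fibEquiv χ hfree (pt G c a.1) (proj_pt G c a.1) a.2)⟩

theorem tot_ext {a b : (assocBundle G χ hfree).Tot} {x : levelSet G c} (ha : proj G c x = a.1)
    (hb : proj G c x = b.1) (h : fibEquiv χ hfree x ha a.2 = fibEquiv χ hfree x hb b.2) :
    a = b := by
  obtain ⟨m, a⟩ := a
  obtain ⟨m', b⟩ := b
  obtain rfl : m = m' := ha.symm.trans hb
  exact congrArg (Sigma.mk m) (fibEquiv_symm_eq h)

/-- In the coordinates at x and e^{iθ}x the lift is the identity of ℂ, for any representative x: the
actions of G and of the circle commute. -/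
theorem fibEquiv_liftAct {t : Circle} {a b : (assocBundle G χ hfree).Tot}
    (hab : liftAct χ hfree t a = b) {x y : levelSet G c} (hxy : (y : Hn n) = (t : ℂ) • (x : Hn n))
    (hx : proj G c x = a.1) (hy : proj G c y = b.1) :
    fibEquiv χ hfree y hy b.2 = fibEquiv χ hfree x hx a.2 := by
  subst hab
  obtain ⟨g, hg⟩ := proj_eq_iff.1 ((proj_pt G c a.1).trans hx.symm)
  have h1 : gact G g ((t : ℂ) • (pt G c a.1 : Hn n)) = y := by rw [gact_smul, hg, hxy]
  refine (fibEquiv_of_gact (proj_circle_smul_pt t a.1) hy h1 _).trans ?_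
  rw [fibEquiv_of_gact (proj_pt G c a.1) hx hg]
  congr 1
  exact LinearEquiv.apply_symm_apply _ _

theorem circle_inv_smul_smul (t : Circle) (x : Hn n) :
    ((t⁻¹ : Circle) : ℂ) • (t : ℂ) • x = x := by
  rw [smul_smul, ← Circle.coe_mul, inv_mul_cancel, Circle.coe_one, one_smul]

theorem circle_smul_inv_smul (t : Circle) (x : Hn n) :
    (t : ℂ) • ((t⁻¹ : Circle) : ℂ) • x = x := by
  rw [smul_smul, ← Circle.coe_mul, mul_inv_cancel, Circle.coe_one, one_smul]

theorem norm_circle_smul (t : Circle) (x : Hn n) : ‖(t : ℂ) • x‖ = ‖x‖ := by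
  rw [norm_smul, Circle.norm_coe, one_mul]

theorem inner_complex_circle_smul (t : Circle) (x y : Hn n) :
    inner ℂ ((t : ℂ) • x) ((t : ℂ) • y) = inner ℂ x y := by
  rw [inner_smul_left, inner_smul_right, ← mul_assoc, mul_comm (conj _), Complex.mul_conj,
    Circle.normSq_coe]
  simp

theorem secFun_circle_smul {t : Circle} {U : Set (HKQuotient G c)}
    {s s' : (assocBundle G χ hfree).Sec}
    (h : ∀ m ∈ U, liftAct χ hfree t ⟨m, s m⟩ = ⟨circleAct G c t m, s' (circleAct G c t m)⟩)
    {x : Hn n} (hx : x ∈ levelOver U) : secFun s' ((t : ℂ) • x) = secFun s x := by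
  obtain ⟨hxL, hxU⟩ := hx
  rw [secFun_eq s' (smul_mem_levelSet G c t hxL) (circleAct_proj t hxL).symm, secFun_eq s hxL rfl]
  exact fibEquiv_liftAct (h _ hxU) rfl rfl _

theorem circleAct_image_eq (t : Circle) (U : Set (HKQuotient G c)) :
    circleAct G c t '' U = circleAct G c t⁻¹ ⁻¹' U := by
  ext m
  refine ⟨?_, fun h => ⟨_, h, ?_⟩⟩
  · rintro ⟨y, hy, rfl⟩
    rwa [Set.mem_preimage, ← circleAct_mul, inv_mul_cancel, circleAct_one]
  · rw [← circleAct_mul, mul_inv_cancel, circleAct_one]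

theorem inv_smul_mem_levelOver {t : Circle} {U : Set (HKQuotient G c)} {y : Hn n}
    (hy : y ∈ levelOver (circleAct G c t '' U)) : ((t⁻¹ : Circle) : ℂ) • y ∈ levelOver U := by
  obtain ⟨hyL, hyU⟩ := hy
  rw [circleAct_image_eq] at hyU
  exact ⟨smul_mem_levelSet G c _ hyL, hyU⟩

theorem smul_mem_levelOver (t : Circle) {U : Set (HKQuotient G c)} {x : Hn n}
    (hx : x ∈ levelOver U) : (t : ℂ) • x ∈ levelOver (circleAct G c t '' U) :=
  ⟨smul_mem_levelSet G c t hx.1, _, hx.2, rfl⟩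

theorem smoothOn_circle {t : Circle} {U : Set (HKQuotient G c)}
    {s s' : (assocBundle G χ hfree).Sec} (hs : (assocBundle G χ hfree).SmoothOn U s)
    (h : ∀ m ∈ U, liftAct χ hfree t ⟨m, s m⟩ = ⟨circleAct G c t m, s' (circleAct G c t m)⟩) :
    (assocBundle G χ hfree).SmoothOn (circleAct G c t '' U) s' := by
  rw [smoothOn_iff] at hs ⊢
  have h1 : ContDiff ℝ ∞ (fun y : Hn n => ((t⁻¹ : Circle) : ℂ) • y) :=
    ((((t⁻¹ : Circle) : ℂ) • ContinuousLinearMap.id ℂ (Hn n)).restrictScalars ℝ).contDiff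
  refine (hs.comp h1.contDiffOn fun y hy => inv_smul_mem_levelOver hy).congr fun y hy => ?_
  rw [Function.comp_apply, ← secFun_circle_smul h (inv_smul_mem_levelOver hy),
    circle_smul_inv_smul]

namespace SmoothReduction

variable (S : SmoothReduction G c d)

include S

/-- All the connections `scaledConn` have the same `(0,1)`-part relative to `I`. -/
theorem scaledConn_zero_one (κ κ' : ℝ) (s : (assocBundle G χ hfree).Sec) (m : HKQuotient G c)
    (u : EuclideanSpace ℝ (Fin d)) :
    scaledConn χ hfree d κ s m u
        + Complex.I • scaledConn χ hfree d κ s m ((quotientStructure G c d).cplx 0 m u)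
      = scaledConn χ hfree d κ' s m u
        + Complex.I • scaledConn χ hfree d κ' s m ((quotientStructure G c d).cplx 0 m u) := by
  have h1 : hl d (pt G c m) ((quotientStructure G c d).cplx 0 m u)
      = Complex.I • hl d (pt G c m) u := S.hliftPt_cplx 0 m u
  have key : ∀ κ : ℝ, fibEquiv χ hfree (pt G c m) (proj_pt G c m) (scaledConn χ hfree d κ s m u
        + Complex.I • scaledConn χ hfree d κ s m ((quotientStructure G c d).cplx 0 m u))
      = fderivWithin ℝ (secFun s) (levelSet G c) (pt G c m : Hn n) (hl d (pt G c m) u)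
        + Complex.I * fderivWithin ℝ (secFun s) (levelSet G c) (pt G c m : Hn n)
          (Complex.I • hl d (pt G c m) u) := fun κ => by
    have h2 := fibEquiv_scaledConn_pt κ s m ((quotientStructure G c d).cplx 0 m u)
    rw [h1, inner_smul_right] at h2
    rw [map_add, map_smul, h2, fibEquiv_scaledConn_pt, smul_eq_mul]
    -- The κ-term is complex linear in u, so it contributes a multiple of 1 + i² = 0.
    linear_combination κ * (inner ℂ (pt G c m : Hn n) (hl d (pt G c m) u) / 2) *
      secFun s (pt G c m : Hn n) * Complex.I_mul_I
  exact fibEquiv_symm_eq ((key κ).trans (key κ').symm)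

theorem isOpen_circleAct_image (t : Circle) {U : Set (HKQuotient G c)} (hU : IsOpen U) :
    IsOpen (circleAct G c t '' U) := by
  rw [circleAct_image_eq]
  exact hU.preimage (S.contMDiff_circleAct_left t⁻¹).continuous

variable (hdχ : HasDifferential G c χ)

include hdχ

/-- The lift acts on equivariant functions by rotating the argument. Rotation preserves |x|,
horizontal lifts and ⟨x, u^H⟩, hence the metric and the connection for κ = 1. -/
theorem isLift_liftAct : IsLift (assocBundle G χ hfree) (scaledMetric χ hfree 1)
    (scaledConn χ hfree d 1) (circleAct G c) rotationMoment (liftAct χ hfree) where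
  base t a := rfl
  one a := by
    have h1 : proj G c (pt G c a.1) = (liftAct χ hfree 1 a).1 :=
      (proj_pt G c a.1).trans (circleAct_one a.1).symm
    exact tot_ext h1 (proj_pt G c a.1) (fibEquiv_liftAct rfl (by simp) _ _)
  mul s t a := by
    have h0 : ((s * t : Circle) : ℂ) • (pt G c a.1 : Hn n) ∈ levelSet G c :=
      smul_mem_levelSet G c _ (pt G c a.1).2
    have h1 : proj G c ⟨_, h0⟩ = (liftAct χ hfree (s * t) a).1 := proj_circle_smul_pt _ _
    have h2 : proj G c ⟨_, h0⟩ = (liftAct χ hfree s (liftAct χ hfree t a)).1 :=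
      h1.trans (circleAct_mul s t a.1)
    refine tot_ext h1 h2 ?_
    have h3 : proj G c ⟨(t : ℂ) • (pt G c a.1 : Hn n), smul_mem_levelSet G c t (pt G c a.1).2⟩
        = (liftAct χ hfree t a).1 := proj_circle_smul_pt t a.1
    have h4 := fibEquiv_liftAct (χ := χ) (hfree := hfree) (a := a) rfl (y := ⟨_, h0⟩) rfl
      (proj_pt G c a.1) h1
    have hmul : ((s * t : Circle) : ℂ) • (pt G c a.1 : Hn n)
        = (s : ℂ) • (t : ℂ) • (pt G c a.1 : Hn n) := by rw [Circle.coe_mul, mul_smul]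
    have h5 := fibEquiv_liftAct (χ := χ) (hfree := hfree) (a := liftAct χ hfree t a) rfl
      (y := ⟨_, h0⟩) hmul h3 h2
    have h6 := fibEquiv_liftAct (χ := χ) (hfree := hfree) (a := a) rfl rfl (proj_pt G c a.1) h3
    exact h4.trans (h5.trans h6).symm
  smul t m z a := by
    refine congrArg (Sigma.mk _) ?_
    rw [map_smul, map_smul]
    rfl
  metric t a := by
    have h0 : (t : ℂ) • (pt G c a.1 : Hn n) ∈ levelSet G c := smul_mem_levelSet G c _ (pt G c a.1).2
    have h1 : proj G c ⟨_, h0⟩ = (liftAct χ hfree t a).1 := proj_circle_smul_pt t a.1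
    have h2 := fibEquiv_liftAct (χ := χ) (hfree := hfree) (a := a) rfl (y := ⟨_, h0⟩) rfl
      (proj_pt G c a.1) h1
    rw [scaledMetric_eq 1 h0 h1, scaledMetric_eq 1 (pt G c a.1).2 (proj_pt G c a.1), h2,
      norm_circle_smul]
  connection t U hU s s' hs h := by
    have hs' := smoothOn_circle hs h
    refine ⟨hs', fun m hm (u : EuclideanSpace ℝ (Fin d)) => ?_⟩
    obtain ⟨x, hx, hxm⟩ := exists_proj_eq m
    have htx := smul_mem_levelSet G c t hx
    have htm : proj G c ⟨(t : ℂ) • x, htx⟩ = circleAct G c t m := by rw [← hxm, circleAct_proj]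
    have hU' := S.isOpen_circleAct_image t hU
    have hxU : x ∈ levelOver U := ⟨hx, by rwa [hxm]⟩
    refine tot_ext (x := ⟨(t : ℂ) • x, htx⟩) htm htm ?_
    refine (fibEquiv_liftAct rfl (x := ⟨x, hx⟩) rfl hxm htm).trans ?_
    have h1 := S.fibEquiv_scaledConn 1 hU hs hm hx hxm u
    have h2 := S.fibEquiv_scaledConn 1 hU' hs' (Set.mem_image_of_mem _ hm) htx htm (dact d t m u)
    have h3 : fderivWithin ℝ (secFun s') (levelSet G c) ((t : ℂ) • x) ((t : ℂ) • hl d ⟨x, hx⟩ u)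
        = fderivWithin ℝ (secFun s) (levelSet G c) x (hl d ⟨x, hx⟩ u) := by
      obtain ⟨y, hy⟩ := S.exists_levelCurve hx (horSub_le_tangentSub _ (S.hl_mem hx u))
      have h4 := hasDerivAt_secFun_curve (differentiableWithinAt_secFun hU hs hxU) hy
      have h5 := hasDerivAt_secFun_curve (differentiableWithinAt_secFun hU' hs'
        (smul_mem_levelOver t hxU)) (hy.circle_smul t)
      refine h5.unique (h4.congr_of_eventuallyEq ?_)
      have h6 : Tendsto y (𝓝 0) (𝓝[levelSet G c] x) :=
        tendsto_nhdsWithin_iff.2 ⟨by simpa [hy.1] using hy.2.2.continuousAt.tendsto, hy.2.1⟩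
      filter_upwards [h6.eventually (levelOver_mem_nhdsWithin hU hxU)] with τ hτ
      exact secFun_circle_smul h hτ
    have h7 : hl d ⟨(t : ℂ) • x, htx⟩ (dact d t m u) = (t : ℂ) • hl d ⟨x, hx⟩ u := by
      subst hxm
      exact S.hl_dact t hx u
    rw [h7, h3, inner_complex_circle_smul, secFun_circle_smul h hxU] at h2
    exact h1.trans h2.symm
  infinitesimal U hU s hs m hm e he z w hz hw := by
    obtain ⟨x, hx, hxm⟩ := exists_proj_eq m
    set ε : ℂ := fibEquiv χ hfree ⟨x, hx⟩ hxm e with hε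
    have hε0 : ε ≠ 0 := by rwa [hε, Ne, LinearEquiv.map_eq_zero_iff]
    have hxU : x ∈ levelOver U := ⟨hx, by rwa [hxm]⟩
    have hd := differentiableWithinAt_secFun hU hs hxU
    have h1 := hasDerivAt_secFun_curve hd (levelCurve_exp_smul hx)
    -- Moving s(e^{it}m) back to the fibre over m just evaluates f at e^{it}x, so the derivative
    -- sought is df(ix)/ε.
    have h2 : ∀ᶠ t in 𝓝 (0 : ℝ), z t = secFun s ((Circle.exp t : ℂ) • x) / ε := by
      filter_upwards [hz] with t ht
      have htm : proj G c ⟨(Circle.exp t : ℂ) • x, smul_mem_levelSet G c _ hx⟩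
          = circleAct G c (Circle.exp t) m := by rw [← hxm, circleAct_proj]
      have h3 := fibEquiv_liftAct ht (x := ⟨(Circle.exp t : ℂ) • x, smul_mem_levelSet G c _ hx⟩)
        (y := ⟨x, hx⟩) (by rw [Circle.exp_neg, circle_inv_smul_smul]) htm hxm
      have h4 := secFun_eq s (smul_mem_levelSet G c _ hx) htm
      rw [eq_div_iff hε0, h4]
      refine Eq.trans ?_ h3
      exact (map_smul (fibEquiv χ hfree ⟨x, hx⟩ hxm) (z t) e).symm
    have h4 := h1.div_const ε
    refine (h4.congr_of_eventuallyEq h2).congr_deriv ?_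
    rw [div_eq_iff hε0]
    have h5 := congrArg (fibEquiv χ hfree ⟨x, hx⟩ hxm) hw
    have h6 := S.fibEquiv_scaledConn 1 hU hs hm hx hxm (generator (circleAct G c) m)
    have h7 : hl d ⟨x, hx⟩ (generator (circleAct G c) m)
        = quat 0 x - rep (lam G (theta G x (quat 0 x))) x := by
      subst hxm
      exact (congrArg (hl d ⟨x, hx⟩) (S.generator_proj hx)).trans
        (S.hl_dpr hx ((levelCurve_exp_smul hx).mem_tangentSub S.closed))
    have h8 : inner ℂ x (quat 0 x) = Complex.I * (‖x‖ : ℂ) ^ 2 := by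
      change inner ℂ x (Complex.I • x) = _
      rw [inner_smul_right, inner_self_eq_norm_sq_to_K]
      rfl
    have h9 : rotationMoment m = -‖x‖ ^ 2 / 2 := by rw [← hxm, rotationMoment_proj]
    -- Here ∇_X s = df(ix) + (i/2)|x|² f: the orbit correction enters once through χ and once
    -- through ½⟨x,·⟩, with opposite signs. The remaining term is cancelled by iμ, which fixes μ =
    -- −|x|²/2.
    rw [h7, map_sub, S.fderivWithin_act hdχ hx hd, inner_sub_right, S.inner_complex_act hx, h8] at h6
    rw [map_add, map_smul, map_smul, ← secFun_eq s hx hxm, smul_eq_mul, smul_eq_mul, ← hε,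
      h9] at h5
    rw [← h5]
    refine Eq.trans ?_ (congrArg (· + Complex.I * ((-‖x‖ ^ 2 / 2 : ℝ) : ℂ) * secFun s x) h6.symm)
    push_cast
    ring

end SmoothReduction

end Lift

end

noncomputable section

/-! ### Curvature of the connections and its type. -/

section Curvature

open Filter

variable {n : ℕ} {G : Subgroup (Matrix.unitaryGroup (Fin n) ℂ)} {c : lieAlg G →ₗ[ℝ] ℝ}
  {χ : G →* Circle} {hfree : ActsFreely G c} {d : ℕ}
  [ChartedSpace (EuclideanSpace ℝ (Fin d)) (HKQuotient G c)]

section Log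

variable {M : Type} [TopologicalSpace M] [ChartedSpace (EuclideanSpace ℝ (Fin d)) M]

theorem differentiableAt_formCoeff_clm {F F' : Type} [NormedAddCommGroup F] [NormedSpace ℝ F]
    [NormedAddCommGroup F'] [NormedSpace ℝ F'] (T : F →L[ℝ] F')
    {α : ∀ m : M, TangentSpace (𝓡 d) m → F} {m : M} {w : EuclideanSpace ℝ (Fin d)}
    (hα : DifferentiableAt ℝ (formCoeff α m w) (chartPt d m)) :
    DifferentiableAt ℝ (formCoeff (fun y w => T (α y w)) m w) (chartPt d m) :=
  T.differentiableAt.comp _ hα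

variable [IsManifold (𝓡 d) ∞ M]

theorem hasFDerivAt_formCoeff_log {f : M → ℂ} {m : M}
    (hf : ∀ᶠ y in 𝓝 m, ContMDiffAt (𝓡 d) 𝓘(ℝ, ℂ) ∞ f y) (h0 : f m ≠ 0)
    (w : EuclideanSpace ℝ (Fin d)) :
    ∃ T : EuclideanSpace ℝ (Fin d) →L[ℝ] ℂ,
      HasFDerivAt (formCoeff (fun y w => (f y)⁻¹ * mfd d f y w) m w) T (chartPt d m) ∧
      ∀ u, T u = (f m)⁻¹ * fderiv ℝ (fderiv ℝ (fun y => f (chartInv d m y))) (chartPt d m) u w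
        - mfd d f m w * mfd d f m u / f m ^ 2 := by
  have hc := contDiffAt_comp_chartInv hf.self_of_nhds
  have hcf : f (chartInv d m (chartPt d m)) ≠ 0 := by rwa [chartInv_chartPt]
  have h1 := (hc.differentiableAt (by simp)).hasFDerivAt
  have h2 := ((hasDerivAt_inv hcf).comp_hasFDerivAt (chartPt d m) h1).mul
    (hasFDerivAt_fderiv_apply hc w)
  refine ⟨_, h2.congr_of_eventuallyEq ?_, fun u => ?_⟩
  · filter_upwards [eventually_formCoeff_mfderiv (hf.mono fun y hy =>
      hy.mdifferentiableAt (by simp))] with y hy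
    rw [Pi.mul_apply, ← hy w]
    rfl
  · have h3 := fun w => fderiv_comp_chartInv_chartPt (hf.self_of_nhds.mdifferentiableAt (by simp)) w
    simp only [add_apply, smul_apply, Function.comp_apply,
      ContinuousLinearMap.flip_apply, h3, chartInv_chartPt, smul_eq_mul]
    ring

/-- d(f⁻¹df) = 0 by direct computation: both the second derivative of f and the product df(u)df(v)
are symmetric, so no branch of the logarithm is chosen. -/
theorem extD_log {f : M → ℂ} {m : M} (hf : ∀ᶠ y in 𝓝 m, ContMDiffAt (𝓡 d) 𝓘(ℝ, ℂ) ∞ f y)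
    (h0 : f m ≠ 0) (u v : EuclideanSpace ℝ (Fin d)) :
    extD (fun y w => (f y)⁻¹ * mfd d f y w) m u v = 0 := by
  obtain ⟨T, hT, hTv⟩ := hasFDerivAt_formCoeff_log hf h0 v
  obtain ⟨T', hT', hTu⟩ := hasFDerivAt_formCoeff_log hf h0 u
  rw [extD_eq, hT.fderiv, hT'.fderiv, hTv, hTu,
    fderiv_fderiv_comm (contDiffAt_comp_chartInv hf.self_of_nhds) v u]
  ring

end Log

theorem inner_complex_sub_inner_complex (x y : Hn n) :
    inner ℂ x y - inner ℂ y x = 2 * Complex.I * (flatForm 0 x y : ℂ) := by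
  have h := flatForm_antisymm 0 y x
  rw [flatForm, flatForm] at h
  rw [inner_complex_eq, inner_complex_eq, flatForm, real_inner_comm y x, h]
  push_cast
  ring

theorem im_inner_complex (x y : Hn n) : (inner ℂ x y).im = inner ℝ (quat 0 x) y := by
  rw [inner_complex_eq]
  simp

section Section

variable {V : Set (HKQuotient G c)} {σ : HKQuotient G c → Hn n} (hσ : IsLocSec (d := d) V σ)
  {m : HKQuotient G c} (hm : m ∈ V)

include hσ hm

theorem IsLocSec.eventually_contMDiffAt :
    ∀ᶠ y in 𝓝 m, ContMDiffAt (𝓡 d) 𝓘(ℝ, Hn n) ∞ σ y :=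
  mem_of_superset (hσ.isOpen.mem_nhds hm) fun _ hy => hσ.contMDiffAt hy

variable [IsManifold (𝓡 d) ∞ (HKQuotient G c)]

theorem IsLocSec.contDiffAt_chart :
    ContDiffAt ℝ ∞ (fun y => σ (chartInv d m y)) (chartPt d m) :=
  contDiffAt_comp_chartInv (hσ.contMDiffAt hm)

omit [IsManifold (𝓡 d) ∞ (HKQuotient G c)] in
theorem IsLocSec.fderiv_chart (w : EuclideanSpace ℝ (Fin d)) :
    fderiv ℝ (fun y => σ (chartInv d m y)) (chartPt d m) w = dsec d σ m w :=
  fderiv_comp_chartInv_chartPt ((hσ.contMDiffAt hm).mdifferentiableAt (by simp)) w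

theorem IsLocSec.eventually_dsec : ∀ᶠ y in 𝓝 (chartPt d m), ∀ w : EuclideanSpace ℝ (Fin d),
    dsec d σ (chartInv d m y)
      (mfderiv 𝓘(ℝ, EuclideanSpace ℝ (Fin d)) (𝓡 d) (chartInv d m) y w)
      = fderiv ℝ (fun y => σ (chartInv d m y)) y w :=
  eventually_formCoeff_mfderiv ((hσ.eventually_contMDiffAt hm).mono fun _ hy =>
    hy.mdifferentiableAt (by simp))

theorem IsLocSec.hasFDerivAt_formCoeff_inner (w : EuclideanSpace ℝ (Fin d)) :
    ∃ T : EuclideanSpace ℝ (Fin d) →L[ℝ] ℂ,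
      HasFDerivAt (formCoeff (fun y u => inner ℂ (σ y) (dsec d σ y u)) m w) T (chartPt d m) ∧
      ∀ u, T u = inner ℂ (σ m) (fderiv ℝ (fderiv ℝ (fun y => σ (chartInv d m y)))
        (chartPt d m) u w) + inner ℂ (dsec d σ m u) (dsec d σ m w) := by
  have h0 := hσ.contDiffAt_chart hm
  have h1 := (h0.differentiableAt (by simp)).hasFDerivAt.inner ℂ (hasFDerivAt_fderiv_apply h0 w)
  refine ⟨_, h1.congr_of_eventuallyEq ?_, fun u => ?_⟩
  · filter_upwards [hσ.eventually_dsec hm] with y hy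
    rw [← hy]
    rfl
  · simp only [ContinuousLinearMap.comp_apply, ContinuousLinearMap.prod_apply,
      fderivInnerCLM_apply, ContinuousLinearMap.flip_apply, chartInv_chartPt, hσ.fderiv_chart hm]

theorem IsLocSec.differentiableAt_formCoeff_inner (w : EuclideanSpace ℝ (Fin d)) :
    DifferentiableAt ℝ (formCoeff (fun y u => inner ℂ (σ y) (dsec d σ y u)) m w)
      (chartPt d m) := by
  obtain ⟨T, hT, -⟩ := hσ.hasFDerivAt_formCoeff_inner hm w
  exact hT.differentiableAt

/-- The second derivatives of σ cancel, leaving ⟨a,b⟩ − ⟨b,a⟩ = 2i ω₁(a,b) for a = dσ(u), b = dσ(v).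
-/
theorem IsLocSec.extD_inner (u v : EuclideanSpace ℝ (Fin d)) :
    extD (fun y u => inner ℂ (σ y) (dsec d σ y u)) m u v
      = 2 * Complex.I * (flatForm 0 (dsec d σ m u) (dsec d σ m v) : ℂ) := by
  obtain ⟨T, hT, hTv⟩ := hσ.hasFDerivAt_formCoeff_inner hm v
  obtain ⟨T', hT', hTu⟩ := hσ.hasFDerivAt_formCoeff_inner hm u
  rw [extD_eq, hT.fderiv, hT'.fderiv, hTv, hTu, fderiv_fderiv_comm (hσ.contDiffAt_chart hm) v u,
    ← inner_complex_sub_inner_complex]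
  ring

end Section

/-- The connection form, in a local trivialisation, of the principal bundle whose horizontal spaces
are the orthogonal complements of the orbit directions. -/
def gaugeForm (σ : HKQuotient G c → Hn n) (m : HKQuotient G c) (u : EuclideanSpace ℝ (Fin d)) :
    LieW G := theta G (σ m) (dsec d σ m u)

namespace SmoothReduction

variable (S : SmoothReduction G c d)

include S

/-- dσ differs from the horizontal lift by orbit directions, which ω₁ pairs to zero with tangent
vectors of the level set; so the pullback by any local section gives the quotient form. -/
theorem flatForm_dsec {V : Set (HKQuotient G c)} {σ : HKQuotient G c → Hn n}
    (hσ : IsLocSec (d := d) V σ) {m : HKQuotient G c} (hm : m ∈ V)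
    (u v : EuclideanSpace ℝ (Fin d)) :
    (quotientStructure G c d).form 0 m u v = flatForm 0 (dsec d σ m u) (dsec d σ m v) := by
  have hx := hσ.mem m hm
  have h1 : (quotientStructure G c d).form 0 m u v
      = flatForm 0 (hl d ⟨σ m, hx⟩ u) (hl d ⟨σ m, hx⟩ v) := by
    have h2 := S.flatForm_hl 0 hx u v
    rwa [hσ.proj_eq m hm] at h2
  have h3 : ∀ (w : EuclideanSpace ℝ (Fin d)) (ξ : LieW G),
      flatForm 0 (rep (lam G ξ) (σ m)) (dsec d σ m w) = 0 := fun w ξ =>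
    S.dsec_mem_tangentSub hσ hm w ξ 0
  have h4 : ∀ (ξ η : LieW G), flatForm 0 (rep (lam G ξ) (σ m)) (rep (lam G η) (σ m)) = 0 :=
    fun ξ η => inner_quat_act_act S.closed S.invariant hx 0 ξ η
  have h5 : ∀ (w : EuclideanSpace ℝ (Fin d)) (ξ : LieW G),
      flatForm 0 (dsec d σ m w) (rep (lam G ξ) (σ m)) = 0 := fun w ξ => by
    rw [flatForm_antisymm, h3, neg_zero]
  have h6 : ∀ x y z w : Hn n, flatForm 0 (x - y) (z - w)
      = flatForm 0 x z - flatForm 0 x w - flatForm 0 y z + flatForm 0 y w := fun x y z w => by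
    simp only [flatForm, quat_sub, inner_sub_left, inner_sub_right]
    ring
  rw [h1, S.hl_sec hσ hm, S.hl_sec hσ hm, h6, h3, h4, h5]
  ring

variable [IsManifold (𝓡 d) ∞ (HKQuotient G c)]

theorem hasFDerivAt_formCoeff_gaugeForm {V : Set (HKQuotient G c)} {σ : HKQuotient G c → Hn n}
    (hσ : IsLocSec (d := d) V σ) {m : HKQuotient G c} (hm : m ∈ V)
    (w : EuclideanSpace ℝ (Fin d)) :
    DifferentiableAt ℝ (formCoeff (gaugeForm σ) m w) (chartPt d m) := by
  have h0 := hσ.contDiffAt_chart hm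
  have h1 : ContDiffAt ℝ ∞ (fun p : Hn n × Hn n => theta G p.1 p.2)
      (σ (chartInv d m (chartPt d m)), fderiv ℝ (fun y => σ (chartInv d m y)) (chartPt d m) w) := by
    rw [chartInv_chartPt]
    exact contDiffAt_theta_uncurry S.closed S.free (hσ.mem m hm) _
  have h2 := (h1.differentiableAt (by simp)).comp (chartPt d m)
    ((h0.differentiableAt (by simp)).prodMk (hasFDerivAt_fderiv_apply h0 w).differentiableAt)
  refine h2.congr_of_eventuallyEq ?_
  filter_upwards [hσ.eventually_dsec hm] with y hy
  rw [Function.comp_apply, ← hy]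
  rfl

/-- The derivative of the relation that the horizontal part is orthogonal to the orbit. -/
theorem inner_fderiv_gaugeForm {V : Set (HKQuotient G c)} {σ : HKQuotient G c → Hn n}
    (hσ : IsLocSec (d := d) V σ) {m : HKQuotient G c} (hm : m ∈ V)
    (u w : EuclideanSpace ℝ (Fin d)) (η : LieW G) :
    inner ℝ (fderiv ℝ (fderiv ℝ (fun y => σ (chartInv d m y))) (chartPt d m) u w
        - (rep (lam G (gaugeForm σ m w)) (dsec d σ m u)
          + rep (lam G (fderiv ℝ (formCoeff (gaugeForm σ) m w) (chartPt d m) u)) (σ m)))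
      (rep (lam G η) (σ m))
    + inner ℝ (dsec d σ m w - rep (lam G (gaugeForm σ m w)) (σ m))
      (rep (lam G η) (dsec d σ m u)) = 0 := by
  set s : EuclideanSpace ℝ (Fin d) → Hn n := fun y => σ (chartInv d m y) with hs
  set y₀ := chartPt d m with hy₀
  have h0 : ContDiffAt ℝ ∞ s y₀ := hσ.contDiffAt_chart hm
  have hs0 : s y₀ = σ m := by rw [hs, hy₀]; simp only [chartInv_chartPt]
  have hds : fderiv ℝ s y₀ u = dsec d σ m u := hσ.fderiv_chart hm u
  have hdsw : fderiv ℝ s y₀ w = dsec d σ m w := hσ.fderiv_chart hm w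
  have hev := hσ.eventually_dsec hm
  have hcoeff : ∀ᶠ y in 𝓝 y₀, formCoeff (gaugeForm σ) m w y = theta G (s y) (fderiv ℝ s y w) := by
    filter_upwards [hev] with y hy
    rw [← hy]
    rfl
  have hS : HasDerivAt (fun t : ℝ => s (y₀ + t • u)) (dsec d σ m u) 0 :=
    hds ▸ ((h0.differentiableAt (by simp)).hasFDerivAt.hasLineDerivAt u)
  have hW : HasDerivAt (fun t : ℝ => fderiv ℝ s (y₀ + t • u) w) (fderiv ℝ (fderiv ℝ s) y₀ u w) 0 :=
    (hasFDerivAt_fderiv_apply h0 w).hasLineDerivAt u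
  have hT : HasDerivAt (fun t : ℝ => formCoeff (gaugeForm σ) m w (y₀ + t • u))
      (fderiv ℝ (formCoeff (gaugeForm σ) m w) y₀ u) 0 :=
    (S.hasFDerivAt_formCoeff_gaugeForm hσ hm w).hasFDerivAt.hasLineDerivAt u
  have hA : HasDerivAt (fun t : ℝ => act G (formCoeff (gaugeForm σ) m w (y₀ + t • u)))
      (act G (fderiv ℝ (formCoeff (gaugeForm σ) m w) y₀ u)) 0 :=
    (act G).hasFDerivAt.comp_hasDerivAt (0 : ℝ) hT
  have hη : HasDerivAt (fun t : ℝ => act G η (s (y₀ + t • u))) (act G η (dsec d σ m u)) 0 :=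
    (act G η).hasFDerivAt.comp_hasDerivAt (0 : ℝ) hS
  have hX := (hW.sub (hA.clm_apply hS)).inner ℝ hη
  -- The function whose derivative was just taken vanishes identically, since dσ(w) − θ_σ(dσ(w))σ is
  -- orthogonal to the orbit at every point of the section.
  have hzero : (fun t : ℝ => inner ℝ (fderiv ℝ s (y₀ + t • u) w
      - act G (formCoeff (gaugeForm σ) m w (y₀ + t • u)) (s (y₀ + t • u)))
      (act G η (s (y₀ + t • u)))) =ᶠ[𝓝 0] fun _ => 0 := by
    have hline : Tendsto (fun t : ℝ => y₀ + t • u) (𝓝 0) (𝓝 y₀) := by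
      have : Continuous (fun t : ℝ => y₀ + t • u) := by fun_prop
      simpa using this.tendsto 0
    filter_upwards [hline.eventually hcoeff, hline.eventually
      ((tendsto_chartInv m).eventually (hσ.isOpen.mem_nhds hm))] with t h1 h2
    have h3 := pairL_sub_theta S.closed S.free (hσ.mem _ h2) (fderiv ℝ s (y₀ + t • u) w)
    have h4 := DFunLike.congr_fun h3 η
    rw [pairL_apply] at h4
    rw [h1]
    exact h4
  have hfin := hX.unique ((hasDerivAt_const (0 : ℝ) (0 : ℝ)).congr_of_eventuallyEq hzero)
  have hc0 : formCoeff (gaugeForm σ) m w y₀ = gaugeForm σ m w := by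
    rw [hcoeff.self_of_nhds, hs0, hdsw]
    rfl
  simp only [zero_smul, add_zero, hs0, hc0, hdsw, Pi.sub_apply] at hfin
  rw [← hfin, add_comm]
  congr 3
  rw [add_comm]
  rfl

/-- The curvature of the canonical connection of the principal bundle. -/
theorem exists_curvature {V : Set (HKQuotient G c)} {σ : HKQuotient G c → Hn n}
    (hσ : IsLocSec (d := d) V σ) {m : HKQuotient G c} (hm : m ∈ V)
    (u v : EuclideanSpace ℝ (Fin d)) :
    ∃ Ω : LieW G, cW c Ω = cW c (extD (gaugeForm (c := c) (d := d) σ) m u v) ∧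
      ∀ η : LieW G, inner ℝ (rep (lam G Ω) (σ m)) (rep (lam G η) (σ m))
        = 2 * inner ℝ (hl d ⟨σ m, hσ.mem m hm⟩ v)
          (rep (lam G η) (hl d ⟨σ m, hσ.mem m hm⟩ u)) := by
  have hx := hσ.mem m hm
  set x := σ m with hxdef
  set a := gaugeForm (c := c) σ m u with ha
  set b := gaugeForm (c := c) σ m v with hb
  obtain ⟨ζ, hζ⟩ := exists_lam_eq (bracket_mem_lieAlg S.closed (lam_mem a) (lam_mem b))
  -- Structure equation: Ω = dΘ − [Θ(u), Θ(v)], and c does not see the bracket.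
  refine ⟨extD (gaugeForm (c := c) (d := d) σ) m u v - ζ, ?_, fun η => ?_⟩
  · rw [map_sub, map_bracket S.closed S.invariant hx a b ζ hζ, sub_zero]
  have hu := S.hl_sec hσ hm u
  have hv := S.hl_sec hσ hm v
  have hu' : dsec d σ m u = hl d ⟨x, hx⟩ u + rep (lam G a) x := by rw [hu]; exact (sub_add_cancel _ _).symm
  have hv' : dsec d σ m v = hl d ⟨x, hx⟩ v + rep (lam G b) x := by rw [hv]; exact (sub_add_cancel _ _).symm
  have huh := (mem_horSub_iff.1 (S.hl_mem hx u)).2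
  have hvh := (mem_horSub_iff.1 (S.hl_mem hx v)).2
  -- Subtracting the relation with u and v exchanged eliminates the second derivative of σ, by
  -- symmetry.
  have h1 := S.inner_fderiv_gaugeForm hσ hm u v η
  have h2 := S.inner_fderiv_gaugeForm hσ hm v u η
  rw [fderiv_fderiv_comm (hσ.contDiffAt_chart hm) v u] at h2
  rw [← hb, ← hxdef, hu', hv'] at h1
  rw [← ha, ← hxdef, hu', hv'] at h2
  set p := hl d ⟨x, hx⟩ u with hp
  set q := hl d ⟨x, hx⟩ v with hq
  set X := fderiv ℝ (fderiv ℝ (fun y => σ (chartInv d m y))) (chartPt d m) u v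
  set A := fderiv ℝ (formCoeff (gaugeForm (c := c) σ) m v) (chartPt d m) u with hA
  set B := fderiv ℝ (formCoeff (gaugeForm (c := c) σ) m u) (chartPt d m) v with hB
  have hext : extD (gaugeForm (c := c) (d := d) σ) m u v = A - B := rfl
  -- Horizontal vectors are orthogonal to [η,a]x and [η,b]x, which allows η to be interchanged with
  -- a and b in the remaining terms.
  obtain ⟨β, hβ⟩ := exists_lam_eq (bracket_mem_lieAlg S.closed (lam_mem η) (lam_mem a))
  obtain ⟨γ, hγ⟩ := exists_lam_eq (bracket_mem_lieAlg S.closed (lam_mem η) (lam_mem b))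
  have h3 : inner ℝ q (rep (lam G β) x) = 0 := DFunLike.congr_fun hvh β
  have h4 : inner ℝ p (rep (lam G γ) x) = 0 := DFunLike.congr_fun huh γ
  rw [hβ, rep_sub, rep_mul, rep_mul] at h3
  rw [hγ, rep_sub, rep_mul, rep_mul] at h4
  have h5 : inner ℝ (rep (lam G a) q) (rep (lam G η) x)
      = -inner ℝ q (rep (lam G a) (rep (lam G η) x)) := inner_act_left S.closed a q _
  have h6 : inner ℝ (rep (lam G b) p) (rep (lam G η) x)
      = -inner ℝ p (rep (lam G b) (rep (lam G η) x)) := inner_act_left S.closed b p _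
  have h7 : inner ℝ p (rep (lam G η) q) = -inner ℝ q (rep (lam G η) p) := by
    rw [real_inner_comm, inner_act_left S.closed]
  rw [hext, map_sub, map_sub, hζ, rep_sub, rep_sub, rep_sub, rep_mul, rep_mul]
  have h3' : inner ℝ q (rep (lam G η) (rep (lam G a) x))
      - inner ℝ q (rep (lam G a) (rep (lam G η) x)) = 0 := by rw [← inner_sub_right]; exact h3
  have h4' : inner ℝ p (rep (lam G η) (rep (lam G b) x))
      - inner ℝ p (rep (lam G b) (rep (lam G η) x)) = 0 := by rw [← inner_sub_right]; exact h4
  have h8 : (rep (lam G A) - rep (lam G B) - (rep (lam G a) * rep (lam G b)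
      - rep (lam G b) * rep (lam G a))) x = rep (lam G A) x - rep (lam G B) x
        - (rep (lam G a) (rep (lam G b) x) - rep (lam G b) (rep (lam G a) x)) := rfl
  rw [h8]
  simp only [map_add, inner_sub_left, inner_add_left, inner_add_right, add_sub_cancel_right]
    at h1 h2 ⊢
  linarith

omit [IsManifold (𝓡 d) ∞ (HKQuotient G c)] in
theorem hl_cplx_sec {V : Set (HKQuotient G c)} {σ : HKQuotient G c → Hn n}
    (hσ : IsLocSec (d := d) V σ) {m : HKQuotient G c} (hm : m ∈ V) (a : Fin 3)
    (w : EuclideanSpace ℝ (Fin d)) :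
    hl d ⟨σ m, hσ.mem m hm⟩ ((quotientStructure G c d).cplx a m w)
      = quat a (hl d ⟨σ m, hσ.mem m hm⟩ w) := by
  obtain ⟨g, -, hg⟩ := S.exists_hliftPt (hσ.mem m hm)
  have h1 := hg w
  have h2 := hg ((quotientStructure G c d).cplx a (proj G c ⟨σ m, hσ.mem m hm⟩) w)
  rw [S.hliftPt_cplx, ← quat_gact, ← h1] at h2
  rwa [hσ.proj_eq m hm] at h2

/-- The pairings ⟨Ωx, ηx⟩ = 2⟨v^H, ηu^H⟩ do not change when u and v are rotated, and by freeness
they determine Ω. -/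
theorem cW_extD_gaugeForm_cplx {V : Set (HKQuotient G c)} {σ : HKQuotient G c → Hn n}
    (hσ : IsLocSec (d := d) V σ) {m : HKQuotient G c} (hm : m ∈ V) (a : Fin 3)
    (u v : EuclideanSpace ℝ (Fin d)) :
    cW c (extD (gaugeForm (c := c) (d := d) σ) m ((quotientStructure G c d).cplx a m u)
      ((quotientStructure G c d).cplx a m v)) = cW c (extD (gaugeForm (c := c) (d := d) σ) m u v) := by
  have hx := hσ.mem m hm
  obtain ⟨Ω, hΩ, h1⟩ := S.exists_curvature hσ hm u v
  obtain ⟨Ω', hΩ', h2⟩ := S.exists_curvature hσ hm ((quotientStructure G c d).cplx a m u)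
      ((quotientStructure G c d).cplx a m v)
  rw [← hΩ, ← hΩ']
  congr 1
  rw [← sub_eq_zero]
  refine act_injective S.closed S.free hx ?_
  rw [← inner_self_eq_zero (𝕜 := ℝ)]
  have h3 : rep (lam G (Ω' - Ω)) (σ m) = rep (lam G Ω') (σ m) - rep (lam G Ω) (σ m) := by
    rw [map_sub, rep_sub]
    rfl
  conv_lhs => arg 2; rw [h3]
  rw [inner_sub_left, h1, h2, S.hl_cplx_sec hσ hm, S.hl_cplx_sec hσ hm, ← quat_rep, inner_quat_quat, sub_self]

omit [IsManifold (𝓡 d) ∞ (HKQuotient G c)] in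
-- d^cμ(u) = ⟨x, Iu^H⟩ = −⟨Ix, u^H⟩; inserting u^H = dσ(u) − θx, the orbit term gives −2c(θ) by the
-- moment map equation.
theorem neg_dR_cplx {V : Set (HKQuotient G c)} {σ : HKQuotient G c → Hn n}
    (hσ : IsLocSec (d := d) V σ) {m : HKQuotient G c} (hm : m ∈ V)
    (u : EuclideanSpace ℝ (Fin d)) :
    -dR rotationMoment m ((quotientStructure G c d).cplx 0 m u)
      = -(inner ℂ (σ m) (dsec d σ m u)).im + -2 * cW c (gaugeForm σ m u) := by
  have hx := hσ.mem m hm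
  have h1 := S.dR_rotationMoment hx ((quotientStructure G c d).cplx 0 m u)
  rw [hσ.proj_eq m hm, S.hl_cplx_sec hσ hm] at h1
  rw [h1, neg_neg, im_inner_complex, gaugeForm]
  have h2 := inner_quat_left 0 (σ m) (hl d ⟨σ m, hx⟩ u)
  rw [← neg_eq_iff_eq_neg] at h2
  rw [← h2, S.hl_sec hσ hm, inner_sub_right, inner_I_act hx]
  ring

theorem differentiableAt_formCoeff_dR_cplx (m : HKQuotient G c) (w : EuclideanSpace ℝ (Fin d)) :
    DifferentiableAt ℝ (formCoeff (fun y u =>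
      -dR rotationMoment y ((quotientStructure G c d).cplx 0 y u)) m w) (chartPt d m) := by
  obtain ⟨V, σ, hσ, hm, -⟩ := S.exists_locSec (pt G c m)
  rw [proj_pt] at hm
  have h1 : DifferentiableAt ℝ (fun y => -(formCoeff (fun y u => inner ℂ (σ y) (dsec d σ y u))
      m w y).im + -2 * cW c (formCoeff (gaugeForm σ) m w y)) (chartPt d m) :=
    (Complex.imCLM.differentiableAt.comp _ (hσ.differentiableAt_formCoeff_inner hm w)).neg.add
      (((cW c).differentiableAt.comp _ (S.hasFDerivAt_formCoeff_gaugeForm hσ hm w)).const_mul (-2))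
  refine h1.congr_of_eventuallyEq ?_
  filter_upwards [(tendsto_chartInv m).eventually (hσ.isOpen.mem_nhds hm)] with y hy
  exact S.neg_dR_cplx hσ hy _

/-- Half of dd^cμ is −ω₁ − c(dΘ), so ω₁ cancels and only the curvature of the principal connection
paired with −c is left. -/
theorem twistedForm_eq {V : Set (HKQuotient G c)} {σ : HKQuotient G c → Hn n}
    (hσ : IsLocSec (d := d) V σ) {m : HKQuotient G c} (hm : m ∈ V)
    (u v : EuclideanSpace ℝ (Fin d)) :
    twistedForm (quotientStructure G c d) 2 rotationMoment m u v
      = -cW c (extD (gaugeForm (c := c) (d := d) σ) m u v) := by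
  have h1 : extD (fun y w => -dR rotationMoment y ((quotientStructure G c d).cplx 0 y w)) m u v
      = extD (fun y w => (-Complex.imCLM) (inner ℂ (σ y) (dsec d σ y w))
        + ((-2 : ℝ) • cW c) (gaugeForm σ y w)) m u v := by
    refine extD_congr ?_ u v
    filter_upwards [hσ.isOpen.mem_nhds hm] with y hy w
    exact S.neg_dR_cplx hσ hy w
  have h2 := fun w => hσ.differentiableAt_formCoeff_inner hm w
  have h3 := fun w => S.hasFDerivAt_formCoeff_gaugeForm hσ hm w
  rw [extD_add (fun w => differentiableAt_formCoeff_clm (-Complex.imCLM) (h2 w))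
    (fun w => differentiableAt_formCoeff_clm ((-2 : ℝ) • cW c) (h3 w)), extD_clm _ h2, extD_clm _ h3,
    hσ.extD_inner hm] at h1
  have h4 : twistedForm (quotientStructure G c d) 2 rotationMoment m u v
      = (quotientStructure G c d).form 0 m u v + (1 / (2 : ℕ) : ℝ) *
        extD (fun y w => -dR rotationMoment y ((quotientStructure G c d).cplx 0 y w)) m u v := rfl
  rw [h4, h1, S.flatForm_dsec hσ hm]
  simp
  ring

theorem twistedForm_cplx (a : Fin 3) (m : HKQuotient G c) (u v : EuclideanSpace ℝ (Fin d)) :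
    twistedForm (quotientStructure G c d) 2 rotationMoment m
        ((quotientStructure G c d).cplx a m u) ((quotientStructure G c d).cplx a m v)
      = twistedForm (quotientStructure G c d) 2 rotationMoment m u v := by
  obtain ⟨V, σ, hσ, hm, -⟩ := S.exists_locSec (pt G c m)
  rw [proj_pt] at hm
  refine (S.twistedForm_eq hσ hm _ _).trans ?_
  rw [S.twistedForm_eq hσ hm, S.cW_extD_gaugeForm_cplx hσ hm]

/-- The curvature of `scaledConn 1` is the first Kähler form. -/
theorem hasCurvature_scaledConn (hdχ : HasDifferential G c χ) :
    HasCurvature (assocBundle G χ hfree) (scaledConn χ hfree d 1)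
      ((quotientStructure G c d).form 0) := by
  intro U hU e he he0 A hA m hmU (u : EuclideanSpace ℝ (Fin d)) (v : EuclideanSpace ℝ (Fin d))
  obtain ⟨V, σ, hσ, hm, -⟩ := S.exists_locSec (pt G c m)
  rw [proj_pt] at hm
  set f : HKQuotient G c → ℂ := fun y => secFun e (σ y) with hf
  have hUV := (hU.inter hσ.isOpen).mem_nhds ⟨hmU, hm⟩
  have hfs : ∀ᶠ y in 𝓝 m, ContMDiffAt (𝓡 d) 𝓘(ℝ, ℂ) ∞ f y := by
    filter_upwards [hUV] with y hy
    exact hσ.contMDiffAt_secFun hU he hy.2 hy.1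
  have hf0 : ∀ y ∈ U ∩ V, f y ≠ 0 := fun y hy => by
    rw [hf]
    simp only
    rw [hσ.secFun_eq e hy.2, Ne, LinearEquiv.map_eq_zero_iff]
    exact he0 y hy.1
  -- For a frame with function f along σ, the connection form is the sum of f⁻¹df, which is closed,
  -- and ½⟨σ,dσ⟩.
  have h1 : extD A m u v = extD (fun y w => (f y)⁻¹ * mfd d f y w
      + ((1 / 2 : ℝ) • ContinuousLinearMap.id ℝ ℂ) (inner ℂ (σ y) (dsec d σ y w))) m u v := by
    refine extD_congr ?_ u v
    filter_upwards [hUV] with y hy (w : EuclideanSpace ℝ (Fin d))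
    have h2 := S.fibEquiv_scaledConn_sec hdχ 1 hU he hσ hy.1 hy.2 w
    have h3 := congrArg (fibEquiv χ hfree _ (hσ.proj_eq y hy.2)) (hA y hy.1 w)
    rw [map_smul, ← hσ.secFun_eq e hy.2, smul_eq_mul] at h3
    have h4 := h3.symm.trans h2
    have h5 := hf0 y hy
    simp only [hf] at h5
    simp only [hf, smul_apply, ContinuousLinearMap.id_apply,
      Complex.real_smul]
    have h6 : connForm (c := c) σ d 1 y w
        = ((1 / 2 : ℝ) : ℂ) * inner ℂ (σ y) (dsec d σ y w) := by
      rw [connForm, sub_self, zero_mul]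
      push_cast
      ring
    rw [← h6]
    field_simp
    linear_combination h4
  have h2 := fun w => hσ.differentiableAt_formCoeff_inner hm w
  have h3 := fun w => (hasFDerivAt_formCoeff_log hfs (hf0 m ⟨hmU, hm⟩) w).choose_spec.1.differentiableAt
  rw [h1, extD_add h3 (fun w => differentiableAt_formCoeff_clm
    ((1 / 2 : ℝ) • ContinuousLinearMap.id ℝ ℂ) (h2 w)), extD_clm _ h2, hσ.extD_inner hm,
    extD_log hfs (hf0 m ⟨hmU, hm⟩), S.flatForm_dsec hσ hm]
  simp only [smul_apply, ContinuousLinearMap.id_apply, Complex.real_smul]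
  push_cast
  ring

end SmoothReduction

end Curvature

end

noncomputable section

/-! ### Curvature of an arbitrary hyperholomorphic line bundle. -/

section Hyperholomorphic

open Filter

variable {d : ℕ} {M : Type} [TopologicalSpace M] [ChartedSpace (EuclideanSpace ℝ (Fin d)) M]
  {L : LineBundle M}

theorem IsLineBundle.exists_eq_smul (hL : IsLineBundle d L) {m : M} {a : L.Fib m} (ha : a ≠ 0)
    (b : L.Fib m) : ∃ z : ℂ, b = z • a := by
  obtain ⟨z, hz⟩ := exists_smul_eq_of_finrank_eq_one (hL.rank_one m) ha b
  exact ⟨z, hz.symm⟩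

/-- The ratio of a smooth section and a nowhere vanishing smooth section is smooth. -/
theorem IsLineBundle.contMDiffAt_ratio (hL : IsLineBundle d L) {U : Set M} (hU : IsOpen U)
    {s t : L.Sec} (hs : L.SmoothOn U s) (ht : L.SmoothOn U t) (hs0 : ∀ y ∈ U, s y ≠ 0) {r : M → ℂ}
    (hr : ∀ y ∈ U, t y = r y • s y) {m : M} (hm : m ∈ U) :
    ContMDiffAt (𝓡 d) 𝓘(ℝ, ℂ) ∞ r m := by
  classical
  obtain ⟨W, hW, hmW, e, he0, he⟩ := hL.frame m
  have hUW := hU.inter hW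
  -- Both sections are smooth multiples of the local frame e; the ratio is the quotient of the
  -- coefficients.
  have key : ∀ q : L.Sec, L.SmoothOn U q → ∃ f : M → ℂ, (∀ y ∈ U ∩ W, q y = f y • e y) ∧
      ContMDiffOn (𝓡 d) 𝓘(ℝ, ℂ) ∞ f (U ∩ W) := by
    intro q hq
    have h1 : ∀ y, ∃ z : ℂ, y ∈ U ∩ W → q y = z • e y := fun y => by
      by_cases hy : y ∈ U ∩ W
      · obtain ⟨z, hz⟩ := hL.exists_eq_smul (he0 y hy.2) (q y)
        exact ⟨z, fun _ => hz⟩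
      · exact ⟨0, fun h => absurd h hy⟩
    choose f hf using h1
    refine ⟨f, hf, (he _ hUW Set.inter_subset_right f).1 ?_⟩
    exact hL.congr _ hUW q _ hf (hL.mono U _ hU hUW Set.inter_subset_left q hq)
  obtain ⟨f, hf, hfs⟩ := key s hs
  obtain ⟨g, hg, hgs⟩ := key t ht
  have hf0 : ∀ y ∈ U ∩ W, f y ≠ 0 := fun y hy h0 => by
    have := hf y hy
    rw [h0, zero_smul] at this
    exact hs0 y hy.1 this
  have hrat : ∀ y ∈ U ∩ W, r y = g y / f y := fun y hy => by
    have h1 := hr y hy.1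
    rw [hf y hy, hg y hy, smul_smul, ← sub_eq_zero, ← sub_smul] at h1
    rw [eq_div_iff (hf0 y hy)]
    exact (sub_eq_zero.1 ((smul_eq_zero.1 h1).resolve_right (he0 y hy.2))).symm
  have hnhds := hUW.mem_nhds ⟨hm, hmW⟩
  have h2 : ContDiffAt ℝ ∞ (fun p : ℂ × ℂ => p.1 * p.2⁻¹) (g m, f m) :=
    contDiffAt_fst.mul (contDiffAt_snd.inv (hf0 m ⟨hm, hmW⟩))
  refine (h2.contMDiffAt.comp m ((hgs.contMDiffAt hnhds).prodMk_space
    (hfs.contMDiffAt hnhds))).congr_of_eventuallyEq ?_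
  filter_upwards [hnhds] with y hy
  rw [hrat y hy, div_eq_mul_inv]
  rfl

theorem IsHermitianMetric.smul_left {h : ∀ m, L.Fib m → L.Fib m → ℂ} (hh : IsHermitianMetric d L h)
    (m : M) (z : ℂ) (a b : L.Fib m) : h m (z • a) b = conj z * h m a b := by
  rw [hh.symm m b (z • a), hh.smul_right, map_mul, ← hh.symm m b a]

theorem IsHermitianMetric.self_ne_zero {h : ∀ m, L.Fib m → L.Fib m → ℂ}
    (hh : IsHermitianMetric d L h) (m : M) {a : L.Fib m} (ha : a ≠ 0) : h m a a ≠ 0 := fun h0 => by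
  have := hh.pos m a ha
  rw [h0] at this
  exact lt_irrefl _ this

variable [IsManifold (𝓡 d) ∞ M]

/-- The connection form of a unitary connection relative to a nowhere vanishing section has
differentiable coefficients. -/
theorem IsUnitaryConnection.differentiableAt_formCoeff {h : ∀ m, L.Fib m → L.Fib m → ℂ}
    {D : CovDer d L} (hL : IsLineBundle d L) (hD : IsUnitaryConnection L h D) {U : Set M}
    (hU : IsOpen U) {e : L.Sec} (he : L.SmoothOn U e) (he0 : ∀ y ∈ U, e y ≠ 0)
    {A : ∀ m : M, TangentSpace (𝓡 d) m → ℂ} (hA : ∀ m ∈ U, ∀ u, D e m u = A m u • e m) {m : M}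
    (hm : m ∈ U) (w : EuclideanSpace ℝ (Fin d)) :
    DifferentiableAt ℝ (formCoeff A m w) (chartPt d m) := by
  refine differentiableAt_formCoeff_of_coordField ?_
  have hW : IsOpen (chartAt (EuclideanSpace ℝ (Fin d)) m).source :=
    (chartAt (EuclideanSpace ℝ (Fin d)) m).open_source
  have hUW := hU.inter hW
  have he' := hL.mono U _ hU hUW Set.inter_subset_left e he
  -- The value of the connection form on a coordinate field X is the ratio of ∇_X e to e.
  exact hL.contMDiffAt_ratio hUW he'
    (hD.smooth _ hUW e (coordField m w) he'
      ((contMDiffOn_coordField m w).mono Set.inter_subset_right))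
    (fun y hy => he0 y hy.1) (fun y hy => hA y hy.1 _)
    ⟨hm, mem_chart_source (EuclideanSpace ℝ (Fin d)) m⟩

/-- The real part of the connection form of a unitary connection. -/
theorem IsUnitaryConnection.dC_metric {h : ∀ m, L.Fib m → L.Fib m → ℂ} {D : CovDer d L}
    (hh : IsHermitianMetric d L h) (hD : IsUnitaryConnection L h D) {U : Set M} (hU : IsOpen U)
    {e : L.Sec} (he : L.SmoothOn U e) {m : M} (hm : m ∈ U) {u : TangentSpace (𝓡 d) m} {A : ℂ}
    (hA : D e m u = A • e m) :
    dC (fun y => h y (e y) (e y)) m u = ((2 * A.re : ℝ) : ℂ) * h m (e m) (e m) := by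
  rw [hD.metric U hU e e he he m hm u, hA, hh.smul_left, hh.smul_right, ← add_mul, add_comm,
    Complex.add_conj]

/-- The connection form of the hyperholomorphic connection, in terms of that of the connection
with curvature `ω₁`. -/
theorem connection_form_eq {S : HyperStructure d M} {k : ℕ} {μ : M → ℝ}
    (hμ : ContMDiff (𝓡 d) 𝓘(ℝ, ℝ) ∞ μ)
    {h h₀ : ∀ m, L.Fib m → L.Fib m → ℂ} {D D₀ : CovDer d L}
    (hh : IsHermitianMetric d L h) (hD : IsUnitaryConnection L h D)
    (hh₀ : IsHermitianMetric d L h₀) (hD₀ : IsUnitaryConnection L h₀ D₀)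
    (hscale : ∀ m a b, h m a b = (Real.exp (2 * (μ m / k)) : ℂ) * h₀ m a b)
    (h01 : ∀ U, IsOpen U → ∀ s : L.Sec, L.SmoothOn U s → ∀ m ∈ U, ∀ u,
      D s m u + Complex.I • D s m (S.cplx 0 m u)
        = D₀ s m u + Complex.I • D₀ s m (S.cplx 0 m u))
    {U : Set M} (hU : IsOpen U) {e : L.Sec} (he : L.SmoothOn U e) (he0 : ∀ y ∈ U, e y ≠ 0)
    {A A₀ : ∀ m : M, TangentSpace (𝓡 d) m → ℂ} (hA : ∀ m ∈ U, ∀ u, D e m u = A m u • e m)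
    (hA₀ : ∀ m ∈ U, ∀ u, D₀ e m u = A₀ m u • e m) {m : M} (hm : m ∈ U)
    (u : TangentSpace (𝓡 d) m) :
    A m u = A₀ m u + ((1 / k : ℝ) * dR μ m u : ℝ)
      + Complex.I * ((1 / k : ℝ) * -dR μ m (S.cplx 0 m u) : ℝ) := by
  -- For a unitary connection 2 Re A = d log|e|², so rescaling the metric by e^{2μ/k} adds dμ/k to
  -- the real part.
  have hre : ∀ u : TangentSpace (𝓡 d) m, (A m u).re = (A₀ m u).re + (1 / k : ℝ) * dR μ m u := by
    intro u
    obtain ⟨γ, hγ⟩ := exists_hasVelocity m u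
    have h1 := hγ.hasDerivAt_comp (((hh.smooth U hU e e he he).contMDiffAt
      (hU.mem_nhds hm)).mdifferentiableAt (by simp))
    have h2 := hγ.hasDerivAt_comp (((hh₀.smooth U hU e e he he).contMDiffAt
      (hU.mem_nhds hm)).mdifferentiableAt (by simp))
    have h3 := hγ.hasDerivAt_comp (hμ.mdifferentiable (by simp) m)
    have h4 : HasDerivAt (fun t => ((Real.exp (2 * (μ (γ t) / k)) : ℝ) : ℂ))
        ((Real.exp (2 * (μ m / k)) * (2 * (dR μ m u / k)) : ℝ) : ℂ) 0 := by
      have h5 := ((h3.div_const (k : ℝ)).const_mul 2).exp.ofReal_comp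
      rw [hγ.1] at h5
      exact h5
    have h6 := h4.mul h2
    have h7 := h1.unique (h6.congr_of_eventuallyEq (Eventually.of_forall fun t =>
      hscale (γ t) (e (γ t)) (e (γ t))))
    have h8 := hD.dC_metric hh hU he hm (hA m hm u)
    have h9 := hD₀.dC_metric hh₀ hU he hm (hA₀ m hm u)
    have h10 : dC (fun y => h y (e y) (e y)) m u
        = ((Real.exp (2 * (μ m / k)) * (2 * (dR μ m u / k)) : ℝ) : ℂ) * h₀ m (e m) (e m)
          + (Real.exp (2 * (μ m / k)) : ℂ) * dC (fun y => h₀ y (e y) (e y)) m u := by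
      rw [hγ.1] at h7
      exact h7
    rw [h8, h9, hscale m (e m) (e m)] at h10
    have hH := hh₀.self_ne_zero m (he0 m hm)
    have hE : ((Real.exp (2 * (μ m / k)) : ℝ) : ℂ) ≠ 0 :=
      Complex.ofReal_ne_zero.2 (Real.exp_pos _).ne'
    have h11 : ((2 * (A m u).re : ℝ) : ℂ) = ((2 * (dR μ m u / k) + 2 * (A₀ m u).re : ℝ) : ℂ) := by
      apply mul_right_cancel₀ (mul_ne_zero hE hH)
      rw [h10]
      push_cast
      ring
    have h12 := Complex.ofReal_injective h11
    rw [one_div, inv_mul_eq_div]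
    linarith
  -- Equality of the (0,1)-parts. Its imaginary part relates Im A(u) to Re A(Iu), which is already
  -- known.
  have him : A m u + Complex.I * A m (S.cplx 0 m u)
      = A₀ m u + Complex.I * A₀ m (S.cplx 0 m u) := by
    have h1 := h01 U hU e he m hm u
    rw [hA m hm, hA m hm, hA₀ m hm, hA₀ m hm, smul_smul, smul_smul, ← add_smul, ← add_smul,
      ← sub_eq_zero, ← sub_smul] at h1
    exact sub_eq_zero.1 ((smul_eq_zero.1 h1).resolve_right (he0 m hm))
  have h1 := hre u
  have h2 := hre (S.cplx 0 m u)
  have h3 := congrArg Complex.im him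
  simp only [Complex.add_im, Complex.mul_im, Complex.I_re, Complex.I_im, zero_mul, one_mul,
    zero_add] at h3
  refine Complex.ext ?_ ?_
  · simp only [Complex.add_re, Complex.mul_re, Complex.ofReal_re, Complex.ofReal_im, Complex.I_re,
      Complex.I_im]
    linarith
  · simp only [Complex.add_im, Complex.mul_im, Complex.ofReal_re, Complex.ofReal_im, Complex.I_re,
      Complex.I_im]
    linarith

theorem IsMomentMap.dR_eq {S : HyperStructure d M} {ρ : Circle → M → M} {μ ν : M → ℝ}
    (hμ : IsMomentMap S ρ μ) (hν : IsMomentMap S ρ ν) : dR (d := d) μ = dR ν := by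
  funext m u
  exact (hμ.2 m u).symm.trans (hν.2 m u)

/-- The curvature of a hyperholomorphic line bundle. -/
theorem IsHyperholomorphicLineBundle.hasCurvature {S : HyperStructure d M} {ρ : Circle → M → M}
    {k : ℕ} {h : ∀ m, L.Fib m → L.Fib m → ℂ} {D : CovDer d L}
    (H : IsHyperholomorphicLineBundle S ρ k L h D) {ν : M → ℝ} (hν : IsMomentMap S ρ ν)
    (hd : ∀ m w, DifferentiableAt ℝ (formCoeff (fun y u => -dR ν y (S.cplx 0 y u)) m w)
      (chartPt d m)) :
    HasCurvature L D (twistedForm S k ν) := by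
  obtain ⟨hL, hh, hD, h₀, D₀, μ, τ, hh₀, hD₀, hcurv, hμ, -, hscale, h01⟩ := H
  -- The moment map of the bundle need not be ν, but both differentials equal i_Xω₁, and only the
  -- differential matters.
  have hμν := hμ.dR_eq hν
  intro U hU e he he0 A hA m hm (u : EuclideanSpace ℝ (Fin d)) (v : EuclideanSpace ℝ (Fin d))
  have hex : ∀ y (w : TangentSpace (𝓡 d) y), ∃ z : ℂ, y ∈ U → D₀ e y w = z • e y := fun y w => by
    by_cases hy : y ∈ U
    · obtain ⟨z, hz⟩ := hL.exists_eq_smul (he0 y hy) (D₀ e y w)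
      exact ⟨z, fun _ => hz⟩
    · exact ⟨0, fun h => absurd h hy⟩
  choose A₀ hA₀' using hex
  have hA₀ : ∀ m ∈ U, ∀ u, D₀ e m u = A₀ m u • e m := fun m hm u => hA₀' m u hm
  have hA₀d := fun w => hD₀.differentiableAt_formCoeff hL hU he he0 hA₀ hm w
  set T₁ : ℝ →L[ℝ] ℂ := (1 / k : ℝ) • Complex.ofRealCLM with hT₁
  set T₂ : ℝ →L[ℝ] ℂ := (1 / k : ℝ) • ContinuousLinearMap.toSpanSingleton ℝ Complex.I with hT₂
  have hνs : ∀ᶠ y in 𝓝 m, ContMDiffAt (𝓡 d) 𝓘(ℝ, ℝ) ∞ ν y := Eventually.of_forall fun y => hν.1 y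
  have hνd := fun w => differentiableAt_formCoeff_mfderiv hνs w
  -- ∇ = ∇⁰ + (1/k)dν + (i/k)d^cν near m. The second term is closed, so only the curvature of ∇⁰ and
  -- the dd^c-term remain.
  have h1 : extD A m u v = extD (fun y w => (A₀ y w + T₁ (mfd d ν y w))
      + T₂ (-dR ν y (S.cplx 0 y w))) m u v := by
    refine extD_congr ?_ u v
    filter_upwards [hU.mem_nhds hm] with y hy (w : EuclideanSpace ℝ (Fin d))
    refine (connection_form_eq hμ.1 hh hD hh₀ hD₀ hscale h01 hU he he0 hA hA₀ hy w).trans ?_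
    rw [hμν]
    have h2 : T₁ (mfd d ν y w) = ((1 / k : ℝ) * dR ν y w : ℝ) := by
      rw [hT₁, smul_apply, Complex.ofRealCLM_apply, Complex.real_smul,
        ← Complex.ofReal_mul]
      rfl
    have h3 : ∀ r : ℝ, T₂ r = Complex.I * ((1 / k : ℝ) * r : ℝ) := fun r => by
      rw [hT₂, smul_apply, ContinuousLinearMap.toSpanSingleton_apply,
        Complex.real_smul, Complex.real_smul]
      push_cast
      ring
    rw [h2, h3]
  have h4 := fun w => differentiableAt_formCoeff_clm T₁ (hνd w)
  have h5 := fun w => differentiableAt_formCoeff_clm T₂ (hd m w)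
  have h6 : ∀ w, DifferentiableAt ℝ (formCoeff (fun y w => A₀ y w + T₁ (mfd d ν y w)) m w)
      (chartPt d m) := fun w => (hA₀d w).add (h4 w)
  have h7 : extD A₀ m u v = Complex.I * (S.form 0 m u v : ℂ) :=
    hcurv U hU e he he0 A₀ hA₀ m hm u v
  have h8 : (twistedForm S k ν m u v : ℝ) = S.form 0 m u v
      + (1 / k : ℝ) * extD (fun y w => -dR ν y (S.cplx 0 y w)) m u v := rfl
  rw [h1, extD_add h6 h5, extD_add hA₀d h4, extD_clm _ hνd, extD_clm _ (hd m), extD_mfderiv hνs,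
    h7, h8, map_zero, hT₂, smul_apply,
    ContinuousLinearMap.toSpanSingleton_apply, Complex.real_smul, Complex.real_smul]
  push_cast
  ring

end Hyperholomorphic

/-! ### Assembly. -/

section Main

variable {n : ℕ} {G : Subgroup (Matrix.unitaryGroup (Fin n) ℂ)} {c : lieAlg G →ₗ[ℝ] ℝ}
  {χ : G →* Circle} {hfree : ActsFreely G c} {d : ℕ}
  [ChartedSpace (EuclideanSpace ℝ (Fin d)) (HKQuotient G c)]
  [IsManifold (𝓡 d) ∞ (HKQuotient G c)]

/-- The member κ = 0 of the family is the pair in the statement, and the member κ = 1 is the witness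
for (h₀, ∇⁰). -/
theorem SmoothReduction.isHyperholomorphicLineBundle (S : SmoothReduction G c d)
    (hdχ : HasDifferential G c χ) :
    IsHyperholomorphicLineBundle (quotientStructure G c d) (circleAct G c) 2
      (assocBundle G χ hfree) (assocMetric G χ hfree) (canonicalConnection G χ hfree d) := by
  rw [← scaledMetric_zero, ← scaledConn_zero]
  refine ⟨S.isLineBundle hdχ, S.isHermitianMetric_scaledMetric 0,
    S.isUnitaryConnection_scaledConn hdχ 0, scaledMetric χ hfree 1, scaledConn χ hfree d 1,
    rotationMoment, liftAct χ hfree, S.isHermitianMetric_scaledMetric 1,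
    S.isUnitaryConnection_scaledConn hdχ 1, S.hasCurvature_scaledConn hdχ,
    S.isMomentMap_rotationMoment, S.isLift_liftAct hdχ, fun m a b => ?_,
    fun U _ s _ m _ u => S.scaledConn_zero_one 0 1 s m u⟩
  -- With k = 2 the rescaling factor is e^μ = e^{−|x|²/2}, exactly the inverse of the weight of the
  -- metric for κ = 1.
  have h : Real.exp (0 * ‖(pt G c m : Hn n)‖ ^ 2 / 2)
      = Real.exp (2 * (rotationMoment m / (2 : ℕ)))
        * Real.exp (1 * ‖(pt G c m : Hn n)‖ ^ 2 / 2) := by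
    rw [← Real.exp_add, rotationMoment]
    congr 1
    push_cast
    ring
  simp only [scaledMetric]
  rw [h, Complex.ofReal_mul, mul_assoc]

end Main

end

theorem theorem4 (n : ℕ) (G : Subgroup (Matrix.unitaryGroup (Fin n) ℂ))
    (hG : IsClosed (G : Set (Matrix.unitaryGroup (Fin n) ℂ)))
    (c : lieAlg G →ₗ[ℝ] ℝ) (hc : IsCoadInvariant G c)
    (χ : G →* Circle) (hχ : Continuous χ) (hdχ : HasDifferential G c χ)
    (hfree : ActsFreely G c)
    (d : ℕ) [ChartedSpace (EuclideanSpace ℝ (Fin d)) (HKQuotient G c)]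
    [IsManifold (𝓡 d) ∞ (HKQuotient G c)] (hsmooth : IsSmoothQuotient G c d) :
    IsRotatingAction (quotientStructure G c d) (circleAct G c) 2 ∧
    IsHyperholomorphicLineBundle (quotientStructure G c d) (circleAct G c) 2
      (assocBundle G χ hfree) (assocMetric G χ hfree) (canonicalConnection G χ hfree d) ∧
    ∃ μ : HKQuotient G c → ℝ, IsMomentMap (quotientStructure G c d) (circleAct G c) μ ∧
      (∀ a m u v, twistedForm (quotientStructure G c d) 2 μ m
          ((quotientStructure G c d).cplx a m u) ((quotientStructure G c d).cplx a m v)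
        = twistedForm (quotientStructure G c d) 2 μ m u v) ∧
      ∀ (L : LineBundle (HKQuotient G c)) (h : ∀ m, L.Fib m → L.Fib m → ℂ) (D : CovDer d L),
        IsHyperholomorphicLineBundle (quotientStructure G c d) (circleAct G c) 2 L h D →
          HasCurvature L D (twistedForm (quotientStructure G c d) 2 μ) := by
  have S : SmoothReduction G c d := ⟨hG, hc, hfree, hsmooth⟩
  exact ⟨S.isRotatingAction, S.isHyperholomorphicLineBundle hdχ, rotationMoment,
    S.isMomentMap_rotationMoment, S.twistedForm_cplx, fun L h D H =>
      H.hasCurvature S.isMomentMap_rotationMoment S.differentiableAt_formCoeff_dR_cplx⟩
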